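/- Let $(M,\Omega,\omega)$ be a compact (closed, smooth, Hausdorff) locally conformally symplectic (LCS) manifold of dimension $2n$: $\Omega$ is a nondegenerate 2-form and $\omega$ a closed 1-form with $d\Omega=-\omega\wedge\Omega$. Let $d^\omega\alpha=d\alpha+\omega\wedge\alpha$ and let $H^1_\omega(M)$ be the space of $d^\omega$-closed 1-forms modulo the forms $d^\omega f$, $f\in C^\infty(M)$. An LCS diffeomorphism is a diffeomorphism $g$ of $M$ with $g^*\Omega=a^{-1}\Omega$ and $g^*\omega=\omega+d(\ln a)$ for some smooth function $a>0$. A vector field $X$ is an infinitesimal LCS automorphism with factor $f\in C^\infty(M)$ if $L_X\Omega=-f\Omega$ and $L_X\omega=df$; it belongs to $\ker\Phi$ if $\Phi(X):=\omega(X)-f=0$. A path in $\ker\Phi$ is a smooth isotopy $\{g_t\}_{t\in[0,1]}$ of LCS diffeomorphisms with $g_0=\mathrm{id}$ whose generating vector fields $X_t$, $\frac{d}{dt}g_t=X_t\circ g_t$, all lie in $\ker\Phi$. Let $(\ker\Phi)_0$ be the group of endpoints $g_1$ of such paths, let $\widetilde{(\ker\Phi)}_0$ be its universal cover, i.e. the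 group (under pointwise composition) of such paths modulo smooth homotopy with fixed endpoints within $\ker\Phi$, and let $\tilde\pi:\widetilde{(\ker\Phi)}_0\to(\ker\Phi)_0$, $[\{g_t\}]\mapsto g_1$, be the covering projection, with kernel $\pi_1((\ker\Phi)_0)$. Then Haller's lifted flux $$\widetilde\Psi:\widetilde{(\ker\Phi)}_0\to H^1_\omega(M),\qquad \widetilde\Psi([\{g_t\}])=\Big[\int_0^1 i_{X_t}\Omega\,dt\Big]$$ is a well-defined group homomorphism. Put $\Delta:=\widetilde\Psi(\pi_1((\ker\Phi)_0))$ and $\mathrm{Ham}_\Omega(M):=\tilde\pi(\ker\widetilde\Psi)\subset(\ker\Phi)_0$. If $\Delta$ is discrete, i.e. $U\cap\Delta=\{0\}$ for some open $U\subset H^1_\omega(M)$, then $\widetilde\Psi$ induces a group homomorphism $\mathcal F:(\ker\Phi)_0\to H^1_\omega(M)/\Delta$, $\mathcal F(\tilde\pi(u))=\widetilde\Psi(u)+\Delta$, and with the inclusion $i$ the sequence of groups $$1\longrightarrow \mathrm{Ham}_\Omega(M)\xrightarrow{\;i\;}(\ker\Phi)_0\xrightarrow{\;\mathcal F\;}H^1_\omega(M)/\Delta\longrightarrow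 1$$ is exact. -/

import Mathlib

set_option linter.unusedSectionVars false

open scoped Manifold ContDiff Topology

namespace LCS

section LinearAlgebra

variable {V : Type*} [AddCommGroup V] [Module ℝ V]

/-- The quotient of a subspace `Z` by (its intersection with) a subspace `B`. -/
abbrev Subquotient (Z B : Submodule ℝ V) : Type _ := Z ⧸ B.submoduleOf Z

/-- The quotient map. -/
def Subquotient.mk (Z B : Submodule ℝ V) : Z →ₗ[ℝ] Subquotient Z B := (B.submoduleOf Z).mkQ

theorem Subquotient.mk_surjective (Z B : Submodule ℝ V) :
    Function.Surjective (Subquotient.mk Z B) :=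
  (B.submoduleOf Z).mkQ_surjective

theorem Subquotient.mk_eq_zero (Z B : Submodule ℝ V) (x : Z) :
    Subquotient.mk Z B x = 0 ↔ (x : V) ∈ B :=
  Submodule.Quotient.mk_eq_zero _

end LinearAlgebra

section FormsA

variable {E : Type*} [NormedAddCommGroup E] [NormedSpace ℝ E]
  {M : Type*} [TopologicalSpace M] [ChartedSpace E M]
  {N : Type*} [TopologicalSpace N] [ChartedSpace E N]
  {N' : Type*} [TopologicalSpace N'] [ChartedSpace E N']

/-- A differential `k`-form on a manifold `M` modelled on `E`, given by its values. In Mathlib the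
tangent space `T_x M` is the model space `E` (the identification is the one by the preferred chart
at `x`), so a form is a family of alternating maps on `E` and a vector field is a map `M → E`.
Regularity is a separate predicate. -/
abbrev Form (E M : Type*) [NormedAddCommGroup E] [NormedSpace ℝ E] (k : ℕ) : Type _ :=
  M → E [⋀^Fin k]→L[ℝ] ℝ

/-- The tangent map `T_x f : T_x N → T_{f x} N'`. -/
noncomputable def tmap (f : N → N') (x : N) : E →L[ℝ] E := mfderiv 𝓘(ℝ, E) 𝓘(ℝ, E) f x

/-- The pullback `f^* α`. -/
noncomputable def pullback {k : ℕ} (f : N → N') (α : Form E N' k) : Form E N k := fun x =>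
  (α (f x)).compContinuousLinearMap (tmap f x)

/-- The expression of `α` in the preferred chart at `x`: a form on the target of this chart. -/
noncomputable def localRep {k : ℕ} (α : Form E M k) (x : M) : Form E E k :=
  pullback (extChartAt 𝓘(ℝ, E) x).symm α

/-- A form is smooth if its expressions in the preferred charts at all points are smooth. -/
def SmoothForm {k : ℕ} (α : Form E M k) : Prop :=
  ∀ x : M, ContDiffOn ℝ ∞ (localRep α x) (extChartAt 𝓘(ℝ, E) x).target

/-- The exterior derivative, computed at `x` in the preferred chart at `x`. For smooth forms it
does not depend on the chart; see `d_pullback` for its naturality. -/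
noncomputable def d {k : ℕ} (α : Form E M k) : Form E M (k + 1) := fun x =>
  pullback (extChartAt 𝓘(ℝ, E) x) (extDeriv (localRep α x)) x

/-- The wedge product `η ∧ α` of a 1-form and a `k`-form; see `wedge_apply`. -/
noncomputable def wedge {k : ℕ} (η : Form E M 1) (α : Form E M k) : Form E M (k + 1) := fun x =>
  .alternatizeUncurryFin
    (((ContinuousAlternatingMap.ofSubsingleton ℝ E ℝ (0 : Fin 1)).symm (η x)).smulRight (α x))

/-- The Lichnerowicz differential `d^η α = d α + η ∧ α`. -/
noncomputable def twistedD {k : ℕ} (η : Form E M 1) (α : Form E M k) : Form E M (k + 1) :=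
  d α + wedge η α

/-- A function as a 0-form. -/
noncomputable def fn (f : M → ℝ) : Form E M 0 := fun x =>
  ContinuousAlternatingMap.constOfIsEmpty ℝ E (Fin 0) (f x)

/-- The interior product `i_X α`. -/
noncomputable def iprod {k : ℕ} (X : M → E) (α : Form E M (k + 1)) :
    Form E M k := fun x => (α x).curryLeft (X x)

/-- The Lie derivative `L_X α = d (i_X α) + i_X (d α)` (Cartan's formula). -/
noncomputable def lieD {k : ℕ} (X : M → E) (α : Form E M (k + 1)) :
    Form E M (k + 1) := d (iprod X α) + iprod X (d α)

theorem pullback_apply {k : ℕ} (f : N → N') (α : Form E N' k) (x : N) (v : Fin k → E) :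
    pullback f α x v = α (f x) (fun i => tmap f x (v i)) := rfl

theorem pullback_add {k : ℕ} (f : N → N') (α β : Form E N' k) :
    pullback f (α + β) = pullback f α + pullback f β := rfl

theorem pullback_smul {k : ℕ} (f : N → N') (c : ℝ) (α : Form E N' k) :
    pullback f (c • α) = c • pullback f α := rfl

theorem localRep_add {k : ℕ} (α β : Form E M k) (x : M) :
    localRep (α + β) x = localRep α x + localRep β x := rfl

theorem localRep_smul {k : ℕ} (c : ℝ) (α : Form E M k) (x : M) :
    localRep (c • α) x = c • localRep α x := rfl

theorem smoothForm_zero {k : ℕ} : SmoothForm (0 : Form E M k) := fun x => by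
  have : localRep (0 : Form E M k) x = 0 := rfl
  rw [this]; exact contDiffOn_const

theorem SmoothForm.add {k : ℕ} {α β : Form E M k} (hα : SmoothForm α) (hβ : SmoothForm β) :
    SmoothForm (α + β) := fun x => by
  rw [localRep_add]; exact (hα x).add (hβ x)

theorem SmoothForm.smul {k : ℕ} {α : Form E M k} (c : ℝ) (hα : SmoothForm α) :
    SmoothForm (c • α) := fun x => by
  rw [localRep_smul]; exact (hα x).const_smul c

theorem target_mem_nhds {x : M} {y : E} (hy : y ∈ (extChartAt 𝓘(ℝ, E) x).target) :
    (extChartAt 𝓘(ℝ, E) x).target ∈ 𝓝 y :=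
  (isOpen_extChartAt_target x).mem_nhds hy

theorem SmoothForm.contDiffAt {k : ℕ} {α : Form E M k} (hα : SmoothForm α) {x : M} {y : E}
    (hy : y ∈ (extChartAt 𝓘(ℝ, E) x).target) : ContDiffAt ℝ ∞ (localRep α x) y :=
  (hα x).contDiffAt (target_mem_nhds hy)

theorem SmoothForm.differentiableAt {k : ℕ} {α : Form E M k} (hα : SmoothForm α) {x : M} {y : E}
    (hy : y ∈ (extChartAt 𝓘(ℝ, E) x).target) : DifferentiableAt ℝ (localRep α x) y :=
  (hα.contDiffAt hy).differentiableAt (by simp)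

theorem d_add {k : ℕ} {α β : Form E M k} (hα : SmoothForm α) (hβ : SmoothForm β) :
    d (α + β) = d α + d β := by
  ext x v
  simp only [d, pullback_apply, localRep_add, Pi.add_apply,
    extDeriv_add (hα.differentiableAt (mem_extChartAt_target x))
    (hβ.differentiableAt (mem_extChartAt_target x)), ContinuousAlternatingMap.add_apply]

theorem d_smul {k : ℕ} (c : ℝ) (α : Form E M k) : d (c • α) = c • d α := by
  ext x v
  simp only [d, pullback_apply, localRep_smul, extDeriv_smul, Pi.smul_apply,
    ContinuousAlternatingMap.smul_apply]

theorem wedge_apply {k : ℕ} (η : Form E M 1) (α : Form E M k) (x : M) (v : Fin (k + 1) → E) :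
    wedge η α x v = ∑ i : Fin (k + 1), (-1) ^ (i : ℕ) * (η x (fun _ => v i) * α x (i.removeNth v)) := by
  simp [wedge, ContinuousAlternatingMap.alternatizeUncurryFin_apply]

theorem wedge_add {k : ℕ} (η : Form E M 1) (α β : Form E M k) :
    wedge η (α + β) = wedge η α + wedge η β := by
  ext x v
  simp [wedge_apply, mul_add, Finset.sum_add_distrib]

theorem wedge_smul {k : ℕ} (η : Form E M 1) (c : ℝ) (α : Form E M k) :
    wedge η (c • α) = c • wedge η α := by
  ext x v
  simp [wedge_apply, Finset.mul_sum]
  grind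

theorem twistedD_add {k : ℕ} (η : Form E M 1) {α β : Form E M k} (hα : SmoothForm α)
    (hβ : SmoothForm β) : twistedD η (α + β) = twistedD η α + twistedD η β := by
  rw [twistedD, twistedD, twistedD, d_add hα hβ, wedge_add]; abel

theorem twistedD_smul {k : ℕ} (η : Form E M 1) (c : ℝ) (α : Form E M k) :
    twistedD η (c • α) = c • twistedD η α := by
  rw [twistedD, twistedD, d_smul, wedge_smul, smul_add]

theorem tmap_comp {f : N → N'} {g : M → N} {x : M}
    (hf : MDifferentiableAt 𝓘(ℝ, E) 𝓘(ℝ, E) f (g x)) (hg : MDifferentiableAt 𝓘(ℝ, E) 𝓘(ℝ, E) g x) :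
    tmap (f ∘ g) x = (tmap f (g x) ∘L tmap g x : E →L[ℝ] E) := mfderiv_comp x hf hg

theorem tmap_congr {f g : N → N'} {x : N} (h : f =ᶠ[𝓝 x] g) :
  (tmap f x : E →L[ℝ] E) = tmap g x := h.mfderiv_eq

theorem tmap_eq_fderiv (f : E → E) (x : E) : tmap f x = fderiv ℝ f x := mfderiv_eq_fderiv

theorem pullback_comp {k : ℕ} {f : N → N'} {g : M → N} {x : M}
    (hf : MDifferentiableAt 𝓘(ℝ, E) 𝓘(ℝ, E) f (g x)) (hg : MDifferentiableAt 𝓘(ℝ, E) 𝓘(ℝ, E) g x)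
    (α : Form E N' k) : pullback (f ∘ g) α x = pullback g (pullback f α) x := by
  ext v; simp only [pullback_apply, tmap_comp hf hg]; rfl

theorem pullback_congr {k : ℕ} {f g : N → N'} {x : N} (h : f =ᶠ[𝓝 x] g) (α : Form E N' k) :
    pullback f α x = pullback g α x := by
  ext v; simp only [pullback_apply, tmap_congr h, h.self_of_nhds]

theorem pullback_id {k : ℕ} (α : Form E N k) : pullback id α = α := by
  ext x v; simp only [pullback_apply, tmap, mfderiv_id]; rfl

variable [IsManifold 𝓘(ℝ, E) ∞ M]

theorem contMDiffAt_symm {x : M} {y : E} (hy : y ∈ (extChartAt 𝓘(ℝ, E) x).target) :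
    ContMDiffAt 𝓘(ℝ, E) 𝓘(ℝ, E) ∞ (extChartAt 𝓘(ℝ, E) x).symm y :=
  (contMDiffOn_extChartAt_symm x).contMDiffAt (target_mem_nhds hy)

theorem mdiffAt_symm {x : M} {y : E} (hy : y ∈ (extChartAt 𝓘(ℝ, E) x).target) :
    MDifferentiableAt 𝓘(ℝ, E) 𝓘(ℝ, E) (extChartAt 𝓘(ℝ, E) x).symm y :=
  (contMDiffAt_symm hy).mdifferentiableAt (by simp)

theorem contMDiffAt_ext {x y : M} (hy : y ∈ (extChartAt 𝓘(ℝ, E) x).source) :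
    ContMDiffAt 𝓘(ℝ, E) 𝓘(ℝ, E) ∞ (extChartAt 𝓘(ℝ, E) x) y :=
  contMDiffAt_extChartAt' (by simpa using hy)

theorem mdiffAt_ext {x y : M} (hy : y ∈ (extChartAt 𝓘(ℝ, E) x).source) :
    MDifferentiableAt 𝓘(ℝ, E) 𝓘(ℝ, E) (extChartAt 𝓘(ℝ, E) x) y :=
  (contMDiffAt_ext hy).mdifferentiableAt (by simp)

/-- The map `g` in the preferred charts at `x` and `z`. -/
noncomputable def coordMap (g : M → M) (x z : M) : E → E :=
  extChartAt 𝓘(ℝ, E) z ∘ g ∘ (extChartAt 𝓘(ℝ, E) x).symm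

theorem coordMap_contMDiffAt {g : M → M} (hg : ContMDiff 𝓘(ℝ, E) 𝓘(ℝ, E) ∞ g)
    {x z : M} {y : E} (hy : y ∈ (extChartAt 𝓘(ℝ, E) x).target)
    (hz : g ((extChartAt 𝓘(ℝ, E) x).symm y) ∈ (extChartAt 𝓘(ℝ, E) z).source) :
    ContMDiffAt 𝓘(ℝ, E) 𝓘(ℝ, E) ∞ (coordMap g x z : E → E) y :=
  (contMDiffAt_ext hz).comp y (hg.contMDiffAt.comp y (contMDiffAt_symm hy))

theorem localRep_pullback {k : ℕ} {g : M → M} (hg : ContMDiff 𝓘(ℝ, E) 𝓘(ℝ, E) ∞ g)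
    (α : Form E M k) (x z : M) {y : E} (hy : y ∈ (extChartAt 𝓘(ℝ, E) x).target)
    (hz : g ((extChartAt 𝓘(ℝ, E) x).symm y) ∈ (extChartAt 𝓘(ℝ, E) z).source) :
    localRep (pullback g α) x =ᶠ[𝓝 y] pullback (coordMap g x z) (localRep α z) := by
  have hopen : (g ∘ (extChartAt 𝓘(ℝ, E) x).symm) ⁻¹' (extChartAt 𝓘(ℝ, E) z).source ∈ 𝓝 y :=
    (hg.contMDiffAt.comp y (contMDiffAt_symm hy)).continuousAt.preimage_mem_nhds
      ((isOpen_extChartAt_source z).mem_nhds hz)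
  filter_upwards [target_mem_nhds hy, hopen, eventually_mem_nhds_iff.2 hopen] with w hw hw' hw''
  have hzt : coordMap g x z w ∈ (extChartAt 𝓘(ℝ, E) z).target :=
    (extChartAt 𝓘(ℝ, E) z).map_source hw'
  rw [localRep, localRep, ← pullback_comp (hg.mdifferentiable (by simp) _) (mdiffAt_symm hw),
    ← pullback_comp (mdiffAt_symm hzt) ((coordMap_contMDiffAt hg hw hw').mdifferentiableAt (by simp))]
  apply pullback_congr
  filter_upwards [hw''] with u hu
  exact ((extChartAt 𝓘(ℝ, E) z).left_inv hu).symm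

theorem SmoothForm.pullback {g : M → M} (hg : ContMDiff 𝓘(ℝ, E) 𝓘(ℝ, E) ∞ g)
    {α : Form E M 1} (hα : SmoothForm α) : SmoothForm (pullback g α) := by
  intro x y hy
  apply ContDiffAt.contDiffWithinAt
  have hz := mem_extChartAt_source (I := 𝓘(ℝ, E)) (g ((extChartAt 𝓘(ℝ, E) x).symm y))
  refine ContDiffAt.congr_of_eventuallyEq ?_ (localRep_pullback hg α x _ hy hz)
  have h1 := (coordMap_contMDiffAt hg hy hz).contDiffAt
  have h2 : ContDiffAt ℝ ∞ (fun w =>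
      fderiv ℝ (coordMap g x (g ((extChartAt 𝓘(ℝ, E) x).symm y)) : E → E) w) y :=
    h1.fderiv_right (by simp)
  have h3 := ContDiffAt.comp (f := coordMap g x (g ((extChartAt 𝓘(ℝ, E) x).symm y))) y
    (hα.contDiffAt (mem_extChartAt_target (I := 𝓘(ℝ, E)) (g ((extChartAt 𝓘(ℝ, E) x).symm y)))) h1
  let e : (E →L[ℝ] ℝ) ≃ₗᵢ[ℝ] (E [⋀^Fin 1]→L[ℝ] ℝ) :=
    ContinuousAlternatingMap.ofSubsingletonLIE (0 : Fin 1)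
  have h4 := e.contDiff.contDiffAt.comp y ((e.symm.contDiff.contDiffAt.comp y h3).clm_comp h2)
  refine h4.congr_of_eventuallyEq (Filter.Eventually.of_forall fun w => ?_)
  ext v
  simp only [pullback_apply, tmap_eq_fderiv]
  have he (A : E [⋀^Fin 1]→L[ℝ] ℝ) (L : E →L[ℝ] E) :
      e (e.symm A ∘L L) v = A (fun _ => L (v 0)) := rfl
  simp only [Function.comp_apply, he]
  congr 1
  ext i
  rw [Subsingleton.elim i 0]

theorem two_le_infty : minSmoothness ℝ 2 ≤ (∞ : WithTop ℕ∞) := by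
  rw [minSmoothness_of_isRCLikeNormedField]
  exact WithTop.coe_le_coe.2 (le_top : (2 : ℕ∞) ≤ ⊤)

theorem d_pullback {k : ℕ} {g : M → M} (hg : ContMDiff 𝓘(ℝ, E) 𝓘(ℝ, E) ∞ g)
    {α : Form E M k} (hα : SmoothForm α) : d (LCS.pullback g α) = LCS.pullback g (d α) := by
  ext1 x
  have hx := mem_extChartAt_target (I := 𝓘(ℝ, E)) x
  have hxs := mem_extChartAt_source (I := 𝓘(ℝ, E)) x
  have hgx := mem_extChartAt_source (I := 𝓘(ℝ, E)) (g x)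
  have hz : g ((extChartAt 𝓘(ℝ, E) x).symm (extChartAt 𝓘(ℝ, E) x x)) ∈ (extChartAt 𝓘(ℝ, E) (g x)).source := by
    rw [extChartAt_to_inv]; exact hgx
  have hc := coordMap_contMDiffAt hg hx hz
  have h0 : coordMap g x (g x) (extChartAt 𝓘(ℝ, E) x x) = extChartAt 𝓘(ℝ, E) (g x) (g x) := by
    simp only [coordMap, Function.comp_apply, extChartAt_to_inv]
  have h1 : extDeriv (localRep (LCS.pullback g α) x) (extChartAt 𝓘(ℝ, E) x x) =
      LCS.pullback (coordMap g x (g x)) (extDeriv (localRep α (g x))) (extChartAt 𝓘(ℝ, E) x x) := by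
    rw [(localRep_pullback hg α x (g x) hx hz).extDeriv_eq]
    have h5 : DifferentiableAt ℝ (localRep α (g x))
        (coordMap g x (g x) (extChartAt 𝓘(ℝ, E) x x)) := by
      rw [h0]; exact hα.differentiableAt (mem_extChartAt_target _)
    have := extDeriv_pullback h5 hc.contDiffAt two_le_infty
    simp only [← tmap_eq_fderiv] at this
    exact this
  have h2 : d (LCS.pullback g α) x = LCS.pullback (extChartAt 𝓘(ℝ, E) x)
      (LCS.pullback (coordMap g x (g x)) (extDeriv (localRep α (g x)))) x := by
    ext v; rw [d, pullback_apply, h1]; rfl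
  have h3 : LCS.pullback g (d α) x =
     LCS.pullback g (LCS.pullback (extChartAt 𝓘(ℝ, E) (g x)) (extDeriv (localRep α (g x)))) x := rfl
  rw [h2, h3, ← pullback_comp (hc.mdifferentiableAt (by simp)) (mdiffAt_ext hxs),
    ← pullback_comp (mdiffAt_ext hgx) (hg.mdifferentiable (by simp) _)]
  apply pullback_congr
  filter_upwards [(isOpen_extChartAt_source x).mem_nhds hxs] with u hu
  simp only [coordMap, Function.comp_apply, (extChartAt 𝓘(ℝ, E) x).left_inv hu]

end FormsA

section FormsB
variable {E : Type*} [NormedAddCommGroup E] [NormedSpace ℝ E]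
  {M : Type*} [TopologicalSpace M] [ChartedSpace E M]

/-- A vector field is smooth if it is a smooth section of the tangent bundle. -/
def SmoothVF [IsManifold 𝓘(ℝ, E) ∞ M] (X : M → E) : Prop :=
  ContMDiff 𝓘(ℝ, E) (𝓘(ℝ, E)).tangent ∞ (fun x => (⟨x, X x⟩ : TangentBundle 𝓘(ℝ, E) M))

theorem pullback_fn (f : M → ℝ) (g : M → M) : pullback g (fn f : Form E M 0) = fn (f ∘ g) := by
  ext x v; rfl

theorem localRep_fn (f : M → ℝ) (x : M) :
    localRep (fn f : Form E M 0) x = fn (f ∘ (extChartAt 𝓘(ℝ, E) x).symm) := by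
  ext y v; rfl

theorem d_fn_apply (f : M → ℝ) (x : M) (v : Fin 1 → E) :
    d (fn f : Form E M 0) x v = fderiv ℝ (f ∘ (extChartAt 𝓘(ℝ, E) x).symm)
      (extChartAt 𝓘(ℝ, E) x x) (tmap (extChartAt 𝓘(ℝ, E) x) x (v 0)) := by
  rw [d, localRep_fn, pullback_apply]
  unfold fn
  rw [extDeriv_constOfIsEmpty]; rfl

theorem d_neg {k : ℕ} (α : Form E M k) : d (-α) = - d α := by
  have h (β : Form E M (k + 1)) : (-1 : ℝ) • β = -β := by ext; simp
  have h' : (-1 : ℝ) • α = -α := by ext; simp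
  rw [← h', d_smul, h]

theorem fn_neg (f : M → ℝ) : (fn (-f) : Form E M 0) = - fn f := rfl
theorem fn_add (f g : M → ℝ) : (fn (f + g) : Form E M 0) = fn f + fn g := rfl

theorem wedge_cons {k : ℕ} (η : Form E M 1) (α : Form E M (k + 1))
    (X : M → E) :
    iprod X (wedge η α) = (fun x => η x (fun _ => X x) • α x) - wedge η (iprod X α) := by
  ext x v
  have h1 (β : E [⋀^Fin (k + 2)]→L[ℝ] ℝ) (u : E) : β.curryLeft u v = β (Fin.cons u v) := rfl
  have h2 (β : E [⋀^Fin (k + 1)]→L[ℝ] ℝ) (u : E) (w : Fin k → E) :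
    β.curryLeft u w = β (Fin.cons u w) := rfl
  have h3 (i : Fin (k + 1)) (u : E) :
      i.succ.removeNth (Fin.cons u v : Fin (k + 2) → E) = Fin.cons u (i.removeNth v) := by
    funext j; exact congrFun (Fin.cons_comp_succ_succAbove u v i) j
  have h0 (u : E) : (0 : Fin (k + 2)).removeNth (Fin.cons u v : Fin (k + 2) → E) = v := by
    funext j; rfl
  change wedge η α x (Fin.cons (X x : E) v) =
    η x (fun _ => (X x : E)) * α x v - wedge η (iprod X α) x v
  rw [wedge_apply, wedge_apply, Fin.sum_univ_succ, sub_eq_add_neg, ← Finset.sum_neg_distrib]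
  congr 1
  · rw [h0]; simp
  · refine Finset.sum_congr rfl fun i _ => ?_
    rw [h3]
    change _ = -((-1) ^ (i : ℕ) * (η x (fun _ => v i) * α x (Fin.cons (X x : E) (i.removeNth v))))
    simp [pow_succ]

variable [IsManifold 𝓘(ℝ, E) ∞ M]

theorem smoothForm_fn {f : M → ℝ} (hf : ContMDiff 𝓘(ℝ, E) 𝓘(ℝ, ℝ) ∞ f) :
    SmoothForm (fn f : Form E M 0) := by
  intro x
  rw [localRep_fn]
  exact (ContinuousAlternatingMap.constOfIsEmptyLIE ℝ E ℝ (Fin 0)).contDiff.comp_contDiffOn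
    (contMDiffOn_iff_contDiffOn.1 (hf.comp_contMDiffOn (contMDiffOn_extChartAt_symm x)))

theorem differentiableAt_fn {f : M → ℝ} (hf : ContMDiff 𝓘(ℝ, E) 𝓘(ℝ, ℝ) ∞ f) (x : M) :
    DifferentiableAt ℝ (f ∘ (extChartAt 𝓘(ℝ, E) x).symm) (extChartAt 𝓘(ℝ, E) x x) := by
  have := hf.contMDiffAt.comp _ (contMDiffAt_symm (mem_extChartAt_target (I := 𝓘(ℝ, E)) x))
  exact this.contDiffAt.differentiableAt (by simp)

theorem pullback_localRep {k : ℕ} (α : Form E M k) (x : M) :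
    pullback (extChartAt 𝓘(ℝ, E) x) (localRep α x) x = α x := by
  rw [localRep, ← pullback_comp (mdiffAt_symm (mem_extChartAt_target x))
    (mdiffAt_ext (mem_extChartAt_source x))]
  conv_rhs => rw [← pullback_id α]
  apply pullback_congr
  filter_upwards [(isOpen_extChartAt_source (I := 𝓘(ℝ, E)) x).mem_nhds (mem_extChartAt_source x)] with u hu
  exact (extChartAt 𝓘(ℝ, E) x).left_inv hu

theorem d_fun_smul {k : ℕ} {f : M → ℝ} (hf : ContMDiff 𝓘(ℝ, E) 𝓘(ℝ, ℝ) ∞ f) {α : Form E M k}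
    (hα : SmoothForm α) :
    d (fun x => f x • α x) = wedge (d (fn f)) α + fun x => f x • d α x := by
  ext x v
  have h1 : localRep (fun x => f x • α x) x =
    fun y => (f ∘ (extChartAt 𝓘(ℝ, E) x).symm) y • localRep α x y := rfl
  have h2 := pullback_localRep α x
  have h3 : (f ∘ (extChartAt 𝓘(ℝ, E) x).symm) (extChartAt 𝓘(ℝ, E) x x) = f x := by simp
  rw [d, h1, pullback_apply, extDeriv, fderiv_fun_smul (differentiableAt_fn hf x)
    (hα.differentiableAt (mem_extChartAt_target x)),
    ContinuousAlternatingMap.alternatizeUncurryFin_add]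
  have h5 : (wedge (d (fn f)) α + fun x => f x • d α x) x v =
      f x * d α x v + wedge (d (fn f)) α x v := add_comm _ _
  rw [h5, ContinuousAlternatingMap.add_apply, wedge_apply,
    ContinuousAlternatingMap.alternatizeUncurryFin_smul, h3]
  congr 1
  rw [ContinuousAlternatingMap.alternatizeUncurryFin_apply]
  refine Finset.sum_congr rfl fun i _ => ?_
  have h4 : α x (i.removeNth v) = localRep α x (extChartAt 𝓘(ℝ, E) x x)
    (i.removeNth fun j => tmap (extChartAt 𝓘(ℝ, E) x) x (v j)) := by rw [← h2]; rfl
  rw [h4, d_fn_apply]; simp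

theorem d_exp {f : M → ℝ} (hf : ContMDiff 𝓘(ℝ, E) 𝓘(ℝ, ℝ) ∞ f) :
    (d (fn fun x => Real.exp (f x)) : Form E M 1) = fun x => Real.exp (f x) • d (fn f) x := by
  ext x v
  have h3 : (f ∘ (extChartAt 𝓘(ℝ, E) x).symm) (extChartAt 𝓘(ℝ, E) x x) = f x := by simp
  have h4 : ((fun x => Real.exp (f x)) ∘ (extChartAt 𝓘(ℝ, E) x).symm) =
    fun y => Real.exp ((f ∘ (extChartAt 𝓘(ℝ, E) x).symm) y) := rfl
  simp only [d_fn_apply, ContinuousAlternatingMap.smul_apply]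
  rw [h4, fderiv_exp (differentiableAt_fn hf x), h3]
  rfl

theorem SmoothVF.coord {X : M → E} (hX : SmoothVF X) (x : M) :
    ContDiffOn ℝ ∞ (fun y => tmap (extChartAt 𝓘(ℝ, E) x) ((extChartAt 𝓘(ℝ, E) x).symm y)
      (X ((extChartAt 𝓘(ℝ, E) x).symm y))) (extChartAt 𝓘(ℝ, E) x).target := by
  have h := hX.contMDiffOn (s := (trivializationAt E (TangentSpace 𝓘(ℝ, E)) x).baseSet)
  have h' := ((trivializationAt E (TangentSpace 𝓘(ℝ, E)) x).contMDiffOn_section_baseSet_iff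
    (IB := 𝓘(ℝ, E)) (n := ∞) (E := fun x : M => TangentSpace 𝓘(ℝ, E) x)
    (s := fun x => (X x : TangentSpace 𝓘(ℝ, E) x))).1 h
  have hm : Set.MapsTo (extChartAt 𝓘(ℝ, E) x).symm (extChartAt 𝓘(ℝ, E) x).target
      (trivializationAt E (TangentSpace 𝓘(ℝ, E)) x).baseSet := fun y hy => by
    simpa using (extChartAt 𝓘(ℝ, E) x).map_target hy
  have h2 := contMDiffOn_iff_contDiffOn.1 (h'.comp (contMDiffOn_extChartAt_symm x) hm)
  refine h2.congr fun y hy => ?_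
  have h3 : (extChartAt 𝓘(ℝ, E) x).symm y ∈ (chartAt E x).source := by
    simpa using (extChartAt 𝓘(ℝ, E) x).map_target hy
  have h4 := TangentBundle.continuousLinearMapAt_trivializationAt (I := 𝓘(ℝ, E)) h3
  have h5 := congrArg (fun L : E →L[ℝ] E => L (X ((extChartAt 𝓘(ℝ, E) x).symm y))) h4
  refine Eq.trans h5.symm ?_
  simp only [Function.comp_apply]
  exact congrFun ((trivializationAt E (TangentSpace 𝓘(ℝ, E)) x).coe_linearMapAt_of_mem (R := ℝ) (hm hy))
    (X ((extChartAt 𝓘(ℝ, E) x).symm y))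

theorem tmap_symm_tmap {x : M} {y : E} (hy : y ∈ (extChartAt 𝓘(ℝ, E) x).target) (v : E) :
    tmap (extChartAt 𝓘(ℝ, E) x).symm y
      (tmap (extChartAt 𝓘(ℝ, E) x) ((extChartAt 𝓘(ℝ, E) x).symm y) v) = v := by
  have hs := (extChartAt 𝓘(ℝ, E) x).map_target hy
  have h1 := tmap_comp (f := (extChartAt 𝓘(ℝ, E) x).symm) (g := extChartAt 𝓘(ℝ, E) x)
    (x := (extChartAt 𝓘(ℝ, E) x).symm y)
    (by rw [(extChartAt 𝓘(ℝ, E) x).right_inv hy]; exact mdiffAt_symm hy) (mdiffAt_ext hs)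
  rw [(extChartAt 𝓘(ℝ, E) x).right_inv hy] at h1
  have h2 : (extChartAt 𝓘(ℝ, E) x).symm ∘ (extChartAt 𝓘(ℝ, E) x)
      =ᶠ[𝓝 ((extChartAt 𝓘(ℝ, E) x).symm y)] id := by
    filter_upwards [(isOpen_extChartAt_source (I := 𝓘(ℝ, E)) x).mem_nhds hs] with u hu
    exact (extChartAt 𝓘(ℝ, E) x).left_inv hu
  rw [tmap_congr h2] at h1
  have h3 := congrArg (fun L : E →L[ℝ] E => L v) h1
  have h4 : tmap (E := E) (id : M → M) ((extChartAt 𝓘(ℝ, E) x).symm y) v = v := by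
    rw [tmap, mfderiv_id]; rfl
  exact h3.symm.trans h4

theorem SmoothForm.iprod {k : ℕ} {X : M → E} (hX : SmoothVF X)
    {α : Form E M (k + 1)} (hα : SmoothForm α) : SmoothForm (iprod X α) := by
  intro x
  have h1 := ((ContinuousAlternatingMap.curryLeftLI (𝕜 := ℝ) (E := E) (F := ℝ) (n := k)).contDiff.comp_contDiffOn
    (hα x)).clm_apply (hX.coord x)
  refine h1.congr fun y hy => ?_
  ext v
  change α ((extChartAt 𝓘(ℝ, E) x).symm y) (Fin.cons (X ((extChartAt 𝓘(ℝ, E) x).symm y) : E)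
      fun i => tmap (extChartAt 𝓘(ℝ, E) x).symm y (v i)) =
    α ((extChartAt 𝓘(ℝ, E) x).symm y) fun i => tmap (extChartAt 𝓘(ℝ, E) x).symm y
      ((Fin.cons (tmap (extChartAt 𝓘(ℝ, E) x) ((extChartAt 𝓘(ℝ, E) x).symm y)
        (X ((extChartAt 𝓘(ℝ, E) x).symm y))) v : Fin (k + 1) → E) i)
  congr 1
  funext i
  refine Fin.cases ?_ (fun j => ?_) i
  · exact (tmap_symm_tmap hy _).symm
  · rfl

end FormsB

section DiffGroup
variable {E : Type*} [NormedAddCommGroup E] [NormedSpace ℝ E]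
  {M : Type*} [TopologicalSpace M] [ChartedSpace E M]

theorem pullback_wedge {k : ℕ} (g : M → M) (η : Form E M 1) (α : Form E M k) :
    pullback g (wedge η α) = wedge (pullback g η) (pullback g α) := by
  ext x v
  simp only [pullback_apply, wedge_apply]
  rfl

/-- The smooth diffeomorphisms of `M`. -/
abbrev Diff (E M : Type*) [NormedAddCommGroup E] [NormedSpace ℝ E] [TopologicalSpace M]
    [ChartedSpace E M] : Type _ := M ≃ₘ⟮𝓘(ℝ, E), 𝓘(ℝ, E)⟯ M

/-- Diffeomorphisms form a group under composition, `(g * h) x = g (h x)`. -/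
noncomputable instance instGroupDiff : Group (Diff E M) where
  mul g h := h.trans g
  one := Diffeomorph.refl 𝓘(ℝ, E) M ∞
  inv g := g.symm
  mul_assoc _ _ _ := rfl
  one_mul _ := rfl
  mul_one _ := rfl
  inv_mul_cancel g := Diffeomorph.ext fun x => g.symm_apply_apply x

theorem mul_apply (g h : Diff E M) (x : M) : (g * h) x = g (h x) := rfl
theorem one_apply (x : M) : (1 : Diff E M) x = x := rfl
theorem inv_apply (g : Diff E M) (x : M) : g⁻¹ x = g.symm x := rfl
theorem coe_mul (g h : Diff E M) : ⇑(g * h) = g ∘ h := rfl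
theorem coe_one : ⇑(1 : Diff E M) = id := rfl
theorem coe_inv (g : Diff E M) : ⇑(g⁻¹) = g.symm := rfl

/-- A locally conformally symplectic structure: a smooth nondegenerate 2-form `Ω` and a smooth
closed 1-form `lee` (the Lee form `ω`) such that `d Ω = - ω ∧ Ω`. -/
structure LCSStructure (E M : Type*) [NormedAddCommGroup E] [NormedSpace ℝ E] [TopologicalSpace M]
    [ChartedSpace E M] where
  Ω : Form E M 2
  lee : Form E M 1
  smooth_Ω : SmoothForm Ω
  smooth_lee : SmoothForm lee
  nondegenerate : ∀ x v, (∀ w, Ω x ![v, w] = 0) → v = 0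
  closed_lee : d lee = 0
  d_Ω : d Ω = -wedge lee Ω

/-- `g` preserves the structure up to conformal change: `g^* Ω = a⁻¹ Ω` and `g^* ω = ω + d ln a`
for a smooth positive function `a`. -/
def IsLCSDiffeo (S : LCSStructure E M) (g : Diff E M) : Prop :=
  ∃ a : M → ℝ, ContMDiff 𝓘(ℝ, E) 𝓘(ℝ, ℝ) ∞ a ∧ (∀ x, 0 < a x) ∧
    pullback g S.Ω = (fun x => (a x)⁻¹ • S.Ω x) ∧
    pullback g S.lee = S.lee + d (fn fun x => Real.log (a x))

variable [IsManifold 𝓘(ℝ, E) ∞ M]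

/-- `X` is an infinitesimal automorphism, with conformal factor `f`:
`L_X Ω = - f Ω` and `L_X ω = d f`. -/
structure IsLCSField (S : LCSStructure E M) (X : M → E) (f : M → ℝ) : Prop where
  smooth_field : SmoothVF X
  smooth_factor : ContMDiff 𝓘(ℝ, E) 𝓘(ℝ, ℝ) ∞ f
  lie_Ω : lieD X S.Ω = fun x => -(f x • S.Ω x)
  lie_lee : lieD X S.lee = d (fn f)

/-- `X` is an infinitesimal automorphism (with factor `f`) in the kernel of the extended Lee
homomorphism `Φ(X) = ω(X) - f`. Equivalently `d^ω (i_X Ω) = 0`; see `inKerPhi_iff`. -/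
def InKerPhi (S : LCSStructure E M) (X : M → E) : Prop :=
  ∃ f : M → ℝ, IsLCSField S X f ∧ ∀ x, S.lee x (fun _ => X x) - f x = 0

theorem mdiff (g : Diff E M) (x : M) : MDifferentiableAt 𝓘(ℝ, E) 𝓘(ℝ, E) g x :=
  g.contMDiff.mdifferentiable (by simp) x

theorem pullback_mul {k : ℕ} (g h : Diff E M) (α : Form E M k) :
    pullback ⇑(g * h) α = pullback h (pullback g α) := by
  funext x; exact pullback_comp (mdiff g _) (mdiff h x) α

theorem pullback_inv_pullback {k : ℕ} (g : Diff E M) (α : Form E M k) :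
    pullback ⇑(g⁻¹) (pullback g α) = α := by
  rw [← pullback_mul, mul_inv_cancel, coe_one, pullback_id]

theorem contMDiff_of_smoothForm_fn {f : M → ℝ} (hf : SmoothForm (fn f : Form E M 0)) :
    ContMDiff 𝓘(ℝ, E) 𝓘(ℝ, ℝ) ∞ f := by
  intro x
  have h1 := hf.contDiffAt (mem_extChartAt_target (I := 𝓘(ℝ, E)) x)
  rw [localRep_fn] at h1
  have h2 : ContDiffAt ℝ ∞ (f ∘ (extChartAt 𝓘(ℝ, E) x).symm) (extChartAt 𝓘(ℝ, E) x x) :=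
    (ContinuousAlternatingMap.constOfIsEmptyLIE ℝ E ℝ (Fin 0)).symm.contDiff.contDiffAt.comp _ h1
  have h3 := h2.contMDiffAt.comp x (contMDiffAt_ext (mem_extChartAt_source (I := 𝓘(ℝ, E)) x))
  refine h3.congr_of_eventuallyEq ?_
  filter_upwards [(isOpen_extChartAt_source (I := 𝓘(ℝ, E)) x).mem_nhds
    (mem_extChartAt_source x)] with u hu
  change f u = f ((extChartAt 𝓘(ℝ, E) x).symm (extChartAt 𝓘(ℝ, E) x u))
  rw [(extChartAt 𝓘(ℝ, E) x).left_inv hu]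

theorem iprod_one (X : M → E) (η : Form E M 1) :
    iprod X η = fn fun x => η x (fun _ => X x) := by
  ext x v
  change η x (Fin.cons (X x) v) = η x (fun _ => X x)
  congr 1
  funext i
  refine Fin.cases rfl (fun j => j.elim0) i

theorem iprod_neg {k : ℕ} (X : M → E) (α : Form E M (k + 1)) : iprod X (-α) = -iprod X α := rfl

theorem lieD_Ω (S : LCSStructure E M) (X : M → E) :
    lieD X S.Ω = twistedD S.lee (iprod X S.Ω) - fun x => S.lee x (fun _ => X x) • S.Ω x := by
  rw [lieD, S.d_Ω, iprod_neg, wedge_cons, twistedD]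
  abel

theorem inKerPhi_iff (S : LCSStructure E M) (X : M → E) :
    InKerPhi S X ↔ SmoothVF X ∧ twistedD S.lee (iprod X S.Ω) = 0 := by
  constructor
  · rintro ⟨f, ⟨h1, h2, h3, h4⟩, h5⟩
    refine ⟨h1, ?_⟩
    have h6 : (fun x => S.lee x (fun _ => X x)) = f := funext fun x => by linarith [h5 x]
    have h7 := lieD_Ω S X
    rw [h3] at h7
    have h8 : twistedD S.lee (iprod X S.Ω) = (fun x => -(f x • S.Ω x)) +
      fun x => S.lee x (fun _ => X x) • S.Ω x := by rw [h7]; abel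
    rw [h8]
    funext x
    have := h5 x
    have h9 : S.lee x (fun _ => X x) = f x := by linarith
    simp [h9]
  · rintro ⟨h1, h2⟩
    have h6 : SmoothForm (fn fun x => S.lee x (fun _ => X x) : Form E M 0) := by
      rw [← iprod_one]; exact S.smooth_lee.iprod h1
    refine ⟨fun x => S.lee x (fun _ => X x), ⟨h1, contMDiff_of_smoothForm_fn h6, ?_, ?_⟩, by simp⟩
    · rw [lieD_Ω, h2]; funext x; simp
    · rw [lieD, S.closed_lee, iprod_one]
      exact add_zero _

/-- The push-forward `g_* X` of a vector field by a diffeomorphism. -/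
noncomputable def pushforward (g : Diff E M) (X : M → E) : M → E := fun y =>
  tmap g (g.symm y) (X (g.symm y))

theorem tmap_symm (g : Diff E M) (y : M) (v : E) :
    tmap g (g.symm y) (tmap g.symm y v) = v := by
  have h1 := tmap_comp (f := g) (g := g.symm) (x := y) (mdiff _ _) (mdiff g.symm _)
  have h2 : (g ∘ g.symm : M → M) = id := funext fun x => g.apply_symm_apply x
  rw [h2] at h1
  have h3 := congrArg (fun L : E →L[ℝ] E => L v) h1
  have h4 : tmap (E := E) (id : M → M) y v = v := by rw [tmap, mfderiv_id]; rfl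
  exact h3.symm.trans h4

theorem InKerPhi.pushforward_twistedD {S : LCSStructure E M} {X : M → E} (hX : InKerPhi S X)
    {g : Diff E M} (hg : IsLCSDiffeo S g) :
    SmoothForm (iprod (pushforward g X) S.Ω) ∧ twistedD S.lee (iprod (pushforward g X) S.Ω) = 0 := by
  obtain ⟨a, ha, hpos, hΩ, hlee⟩ := hg
  obtain ⟨hX, hd⟩ := (inKerPhi_iff S X).1 hX
  have hlog : ContMDiff 𝓘(ℝ, E) 𝓘(ℝ, ℝ) ∞ (fun x => -Real.log (a x)) := by
    intro x
    have : ContDiffAt ℝ ∞ (fun t => -Real.log t) (a x) := (Real.contDiffAt_log.2 (hpos x).ne').neg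
    exact this.contMDiffAt.comp x (ha x)
  have hexp : (fun x => (a x)⁻¹) = fun x => Real.exp (-Real.log (a x)) := funext fun x => by
    rw [Real.exp_neg, Real.exp_log (hpos x)]
  have hinv : ContMDiff 𝓘(ℝ, E) 𝓘(ℝ, ℝ) ∞ (fun x => (a x)⁻¹) := by
    rw [hexp]; exact fun x => Real.contDiff_exp.contDiffAt.contMDiffAt.comp x (hlog x)
  have hη := S.smooth_Ω.iprod hX
  set η := iprod X S.Ω with hηdef
  set β : Form E M 1 := fun x => (a x)⁻¹ • η x with hβ
  have hβs : SmoothForm β := by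
    intro x
    have h1 : localRep β x = fun y => ((fun x => (a x)⁻¹) ∘ (extChartAt 𝓘(ℝ, E) x).symm) y • localRep η x y := rfl
    rw [h1]
    exact (contMDiffOn_iff_contDiffOn.1 (hinv.comp_contMDiffOn (contMDiffOn_extChartAt_symm x))).smul (hη x)
  have key : iprod (pushforward g X) S.Ω = pullback g.symm β := by
    ext y v
    have h1 := congrFun hΩ (g.symm y)
    have h2 := congrArg (fun A : E [⋀^Fin 2]→L[ℝ] ℝ => A (Fin.cons (X (g.symm y))
      (fun i => tmap g.symm y (v i)))) h1
    refine Eq.trans ?_ h2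
    change S.Ω y _ = S.Ω (g (g.symm y)) _
    rw [g.apply_symm_apply]
    congr 1
    funext i
    refine Fin.cases rfl (fun j => ?_) i
    exact (tmap_symm g y (v j)).symm
  rw [key]
  refine ⟨hβs.pullback g.symm.contMDiff, ?_⟩
  rw [twistedD, d_pullback g.symm.contMDiff hβs]
  have h3 : S.lee = pullback g.symm (pullback g S.lee) := (pullback_inv_pullback g S.lee).symm
  have h4 : wedge S.lee (pullback g.symm β) = pullback g.symm (wedge (pullback g S.lee) β) := by
    rw [pullback_wedge, ← h3]
  rw [h4, hlee, ← pullback_add]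
  have h5 : d β = wedge (d (fn fun x => (a x)⁻¹)) η + fun x => (a x)⁻¹ • d η x := d_fun_smul hinv hη
  have h6 : (d (fn fun x => (a x)⁻¹) : Form E M 1) = fun x => (a x)⁻¹ • -(d (fn fun x => Real.log (a x)) x) := by
    have hexp' (x : M) : (a x)⁻¹ = Real.exp (-Real.log (a x)) := congrFun hexp x
    rw [hexp, d_exp hlog]
    have h7 : (fn fun x => -Real.log (a x) : Form E M 0) = -(fn fun x => Real.log (a x)) := rfl
    rw [h7, d_neg]
    funext x
    rw [hexp' x]; rfl
  have h8 : d β + wedge (S.lee + d (fn fun x => Real.log (a x))) β = fun x => (a x)⁻¹ • twistedD S.lee η x := by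
    rw [h5, h6]
    ext x v
    simp only [Pi.add_apply, ContinuousAlternatingMap.add_apply, wedge_apply, twistedD, hβ,
      ContinuousAlternatingMap.smul_apply, ContinuousAlternatingMap.neg_apply, smul_eq_mul]
    have h9 (F : Fin (1 + 1) → ℝ) : ∑ i, F i = F 0 + F 1 := Fin.sum_univ_two F
    simp only [h9]
    ring
  rw [h8, hd]
  ext x v
  simp [pullback_apply]

end DiffGroup

section Groups
variable {E : Type*} [NormedAddCommGroup E] [NormedSpace ℝ E]
  {M : Type*} [TopologicalSpace M] [ChartedSpace E M]

/-- A family of diffeomorphisms with parameters in `V` is smooth if `(v, x) ↦ γ v x` and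
`(v, x) ↦ (γ v)⁻¹ x` are smooth (the second follows from the first, and is recorded for
convenience). -/
def SmoothFamily (V : Type*) [NormedAddCommGroup V] [NormedSpace ℝ V] (γ : V → Diff E M) : Prop :=
  ContMDiff (𝓘(ℝ, V).prod 𝓘(ℝ, E)) 𝓘(ℝ, E) ∞ (fun p : V × M => γ p.1 p.2) ∧
  ContMDiff (𝓘(ℝ, V).prod 𝓘(ℝ, E)) 𝓘(ℝ, E) ∞ (fun p : V × M => (γ p.1)⁻¹ p.2)

theorem SmoothFamily.one {V : Type*} [NormedAddCommGroup V] [NormedSpace ℝ V] :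
    SmoothFamily V (1 : V → Diff E M) := ⟨contMDiff_snd, contMDiff_snd⟩

theorem SmoothFamily.mul {V : Type*} [NormedAddCommGroup V] [NormedSpace ℝ V] {γ δ : V → Diff E M}
    (hγ : SmoothFamily V γ) (hδ : SmoothFamily V δ) : SmoothFamily V (γ * δ) :=
  ⟨hγ.1.comp (contMDiff_fst.prodMk hδ.1), hδ.2.comp (contMDiff_fst.prodMk hγ.2)⟩

theorem SmoothFamily.inv {V : Type*} [NormedAddCommGroup V] [NormedSpace ℝ V] {γ : V → Diff E M}
    (hγ : SmoothFamily V γ) : SmoothFamily V γ⁻¹ := ⟨hγ.2, hγ.1⟩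

/-- The time-dependent vector field generating `γ`: `X_t (γ_t x) = d/dt (γ_t x)`. -/
noncomputable def generator (γ : ℝ → Diff E M) (t : ℝ) : M → E := fun y =>
  mfderiv 𝓘(ℝ, ℝ) 𝓘(ℝ, E) (fun s => γ s ((γ t).symm y)) t (1 : ℝ)

variable [IsManifold 𝓘(ℝ, E) ∞ M]

theorem IsLCSDiffeo.one (S : LCSStructure E M) : IsLCSDiffeo S 1 := by
  refine ⟨fun _ => 1, contMDiff_const, fun _ => one_pos, ?_, ?_⟩
  · rw [coe_one, pullback_id]; simp
  · rw [coe_one, pullback_id]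
    have h : (fn fun _ : M => Real.log 1 : Form E M 0) = (0 : ℝ) • (fn fun _ => 0) := by
      rw [Real.log_one]; ext; simp [fn]
    rw [h, d_smul]; simp

theorem log_smooth {a : M → ℝ} (ha : ContMDiff 𝓘(ℝ, E) 𝓘(ℝ, ℝ) ∞ a) (hpos : ∀ x, 0 < a x) :
    ContMDiff 𝓘(ℝ, E) 𝓘(ℝ, ℝ) ∞ (fun x => Real.log (a x)) := fun x =>
  (Real.contDiffAt_log.2 (hpos x).ne').contMDiffAt.comp x (ha x)

theorem IsLCSDiffeo.mul {S : LCSStructure E M} {g h : Diff E M} (hg : IsLCSDiffeo S g)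
    (hh : IsLCSDiffeo S h) : IsLCSDiffeo S (g * h) := by
  obtain ⟨a, ha, hap, ha1, ha2⟩ := hg
  obtain ⟨b, hb, hbp, hb1, hb2⟩ := hh
  have hah := ha.comp h.contMDiff
  refine ⟨fun x => a (h x) * b x, fun x => (hah x).mul (hb x), fun x => mul_pos (hap _) (hbp _), ?_, ?_⟩
  · rw [pullback_mul, ha1]
    ext x v
    have h1 := congrArg (fun A : E [⋀^Fin 2]→L[ℝ] ℝ => A v) (congrFun hb1 x)
    simp only [pullback_apply, ContinuousAlternatingMap.smul_apply] at h1 ⊢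
    rw [h1, mul_inv]; simp [mul_assoc]
  · rw [pullback_mul, ha2, pullback_add, hb2, ← d_pullback h.contMDiff
      (smoothForm_fn (log_smooth ha hap)), pullback_fn]
    have h1 : (fn fun x => Real.log (a (h x) * b x) : Form E M 0) =
        fn ((fun x => Real.log (a x)) ∘ h) + fn fun x => Real.log (b x) := by
      rw [← fn_add]; congr 1; funext x; exact Real.log_mul (hap _).ne' (hbp _).ne'
    have h2 : SmoothForm (fn ((fun x => Real.log (a x)) ∘ h) : Form E M 0) :=
      smoothForm_fn (log_smooth hah fun x => hap _)
    rw [h1, d_add h2 (smoothForm_fn (log_smooth hb hbp))]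
    abel

theorem IsLCSDiffeo.inv {S : LCSStructure E M} {g : Diff E M} (hg : IsLCSDiffeo S g) :
    IsLCSDiffeo S g⁻¹ := by
  obtain ⟨a, ha, hap, ha1, ha2⟩ := hg
  have hag : ContMDiff 𝓘(ℝ, E) 𝓘(ℝ, ℝ) ∞ fun x => a (g.symm x) := ha.comp g.symm.contMDiff
  refine ⟨fun x => (a (g.symm x))⁻¹, fun x => ?_, fun x => inv_pos.2 (hap _), ?_, ?_⟩
  · exact ContMDiffAt.comp x (f := fun x => a (g.symm x)) (g := fun t : ℝ => t⁻¹)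
      (contDiffAt_inv ℝ (hap _).ne').contMDiffAt (hag x)
  · have h1 : S.Ω = fun x => a x • pullback g S.Ω x := by
      rw [ha1]; funext x; rw [smul_smul, mul_inv_cancel₀ (hap x).ne', one_smul]
    conv_lhs => rw [h1]
    have h2 : pullback (⇑g⁻¹) (fun x => a x • pullback g S.Ω x) =
      fun x => a (g.symm x) • pullback (⇑g⁻¹) (pullback g S.Ω) x := rfl
    rw [h2, pullback_inv_pullback]
    funext x; simp
  · have h1 : S.lee = pullback g S.lee + -d (fn fun x => Real.log (a x)) := by rw [ha2]; abel
    conv_lhs => rw [h1]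
    rw [pullback_add, pullback_inv_pullback, ← d_neg]
    have h3 : SmoothForm (-(fn fun x => Real.log (a x) : Form E M 0)) := by
      have := (smoothForm_fn (log_smooth ha hap)).smul (-1)
      convert this using 1; ext; simp
    rw [← d_pullback g⁻¹.contMDiff h3]
    congr 2
    have h4 : (-(fn fun x => Real.log (a x)) : Form E M 0) = fn fun x => -Real.log (a x) := rfl
    rw [h4, pullback_fn]
    congr 1
    funext x
    simp [inv_apply]

theorem SmoothFamily.curve {γ : ℝ → Diff E M} (hγ : SmoothFamily ℝ γ) (x : M) (t : ℝ) :
    MDifferentiableAt 𝓘(ℝ, ℝ) 𝓘(ℝ, E) (fun s => γ s x) t :=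
  (hγ.1.comp (contMDiff_id.prodMk contMDiff_const)).mdifferentiable (by simp) t

/-- The velocity of the curve `s ↦ γ_s x`. -/
noncomputable def velocity (γ : ℝ → Diff E M) (t : ℝ) (x : M) : E :=
  mfderiv 𝓘(ℝ, ℝ) 𝓘(ℝ, E) (fun s => γ s x) t (1 : ℝ)

theorem generator_mul {γ δ : ℝ → Diff E M} (hγ : SmoothFamily ℝ γ) (hδ : SmoothFamily ℝ δ) (t : ℝ) :
    generator (γ * δ) t = generator γ t + pushforward (γ t) (generator δ t) := by
  funext y
  set x := (δ t).symm ((γ t).symm y) with hx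
  have hy : δ t x = (γ t).symm y := (δ t).apply_symm_apply _
  have hF : HasMFDerivAt (𝓘(ℝ, ℝ).prod 𝓘(ℝ, E)) 𝓘(ℝ, E) (fun p : ℝ × M => γ p.1 p.2) (t, δ t x) _ :=
    (hγ.1.mdifferentiable (by simp) _).hasMFDerivAt
  have hc := (hasMFDerivAt_id (I := 𝓘(ℝ, ℝ)) t).prodMk (hδ.curve x t).hasMFDerivAt
  have h1 := (hF.comp t hc).mfderiv
  have h3 := mfderiv_prod_eq_add_apply (v := ((1 : ℝ), generator δ t (δ t x)))
    hF.mdifferentiableAt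
  have h4 : generator (γ * δ) t y = mfderiv (𝓘(ℝ, ℝ).prod 𝓘(ℝ, E)) 𝓘(ℝ, E)
      (fun p : ℝ × M => γ p.1 p.2) (t, δ t x) ((1 : ℝ), generator δ t (δ t x)) := by
    have h5 := congrArg (fun L : ℝ →L[ℝ] E => L 1) h1
    have h6 : velocity δ t x = generator δ t (δ t x) := by
      change velocity δ t x = velocity δ t ((δ t).symm (δ t x))
      rw [(δ t).symm_apply_apply]
    rw [← h6]
    exact h5
  refine h4.trans (h3.trans ?_)
  change velocity γ t (δ t x) + tmap (γ t) (δ t x) (generator δ t (δ t x)) =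
    velocity γ t ((γ t).symm y) + tmap (γ t) ((γ t).symm y) (generator δ t ((γ t).symm y))
  rw [hy]

theorem generator_one (t : ℝ) : generator (1 : ℝ → Diff E M) t = 0 := by
  funext y
  have : (fun s : ℝ => (1 : ℝ → Diff E M) s (((1 : ℝ → Diff E M) t).symm y)) = fun _ => y := rfl
  rw [generator, this, mfderiv_const]; rfl

theorem generator_smooth {γ : ℝ → Diff E M} (hγ : SmoothFamily ℝ γ) (t : ℝ) :
    SmoothVF (generator γ t) := by
  have hinv : ContMDiff 𝓘(ℝ, E) 𝓘(ℝ, E) ∞ (fun y => (γ t).symm y) := (γ t).symm.contMDiff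
  let F₀ : M → TangentBundle 𝓘(ℝ, ℝ) ℝ × TangentBundle 𝓘(ℝ, E) M := fun y =>
    (⟨t, (1 : ℝ)⟩, ⟨(γ t).symm y, (0 : E)⟩)
  have S₀ : ContMDiff 𝓘(ℝ, E) ((𝓘(ℝ, ℝ)).tangent.prod (𝓘(ℝ, E)).tangent) ∞ F₀ :=
    contMDiff_const.prodMk
      ((Bundle.contMDiff_zeroSection ℝ (fun x : M => TangentSpace 𝓘(ℝ, E) x)).comp hinv)
  have S₂ := contMDiff_equivTangentBundleProd_symm (I := 𝓘(ℝ, ℝ)) (M := ℝ) (I' := 𝓘(ℝ, E)) (M' := M) (n := ∞)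
  have S₃ : ContMDiff _ _ ∞ (tangentMap (𝓘(ℝ, ℝ).prod 𝓘(ℝ, E)) 𝓘(ℝ, E) (fun p : ℝ × M => γ p.1 p.2)) :=
    hγ.1.contMDiff_tangentMap (by simp)
  have S := (S₃.comp S₂).comp S₀
  refine S.congr fun y => ?_
  have hF : MDifferentiableAt (𝓘(ℝ, ℝ).prod 𝓘(ℝ, E)) 𝓘(ℝ, E) (fun p : ℝ × M => γ p.1 p.2)
    (t, (γ t).symm y) := hγ.1.mdifferentiable (by simp) _
  have h3 := mfderiv_prod_eq_add_apply (v := ((1 : ℝ), (0 : E))) hF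
  have h4 : (mfderiv (𝓘(ℝ, ℝ).prod 𝓘(ℝ, E)) 𝓘(ℝ, E) (fun p : ℝ × M => γ p.1 p.2)
      (t, (γ t).symm y) ((1 : ℝ), (0 : E))) = generator γ t y := by
    have h7 : tmap (γ t) ((γ t).symm y) (0 : E) = 0 := map_zero _
    have h6 : generator γ t y + tmap (γ t) ((γ t).symm y) (0 : E) = generator γ t y := by
      rw [h7, add_zero]
    exact h3.trans h6
  have h5 (p q : M) (v w : E) (hpq : p = q) (hvw : v = w) :
      (⟨p, v⟩ : TangentBundle 𝓘(ℝ, E) M) = ⟨q, w⟩ := by subst hpq hvw; rfl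
  exact h5 _ _ _ _ ((γ t).apply_symm_apply y).symm h4.symm

theorem iprod_add {k : ℕ} (X Y : M → E) (α : Form E M (k + 1)) :
    iprod (X + Y) α = iprod X α + iprod Y α := by
  ext x v; simp [iprod]

/-- A smooth path of automorphisms that starts at the identity and whose generating vector fields
all lie in `ker Φ`. Paths are parametrized by `ℝ` to avoid one-sided derivatives; only their
restriction to `[0, 1]` enters the group `(ker Φ)_0`, its universal cover and the flux. -/
structure IsKerPhiIsotopy (S : LCSStructure E M) (γ : ℝ → Diff E M) : Prop where
  smooth : SmoothFamily ℝ γ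
  start : γ 0 = 1
  lcs : ∀ t, IsLCSDiffeo S (γ t)
  gen : ∀ t, InKerPhi S (generator γ t)

theorem IsKerPhiIsotopy.one (S : LCSStructure E M) : IsKerPhiIsotopy S (1 : ℝ → Diff E M) where
  smooth := .one
  start := rfl
  lcs _ := .one S
  gen t := (inKerPhi_iff _ _).2 ⟨generator_smooth .one t, by
    rw [generator_one]
    have h : iprod (0 : M → E) S.Ω = (0 : ℝ) • iprod (0 : M → E) S.Ω := by ext x v; simp [iprod]
    rw [h, twistedD_smul]; ext; simp⟩

theorem IsKerPhiIsotopy.mul {S : LCSStructure E M} {γ δ : ℝ → Diff E M}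
    (hγ : IsKerPhiIsotopy S γ) (hδ : IsKerPhiIsotopy S δ) : IsKerPhiIsotopy S (γ * δ) where
  smooth := hγ.smooth.mul hδ.smooth
  start := by rw [Pi.mul_apply, hγ.start, hδ.start, mul_one]
  lcs t := (hγ.lcs t).mul (hδ.lcs t)
  gen t := (inKerPhi_iff _ _).2 ⟨generator_smooth (hγ.smooth.mul hδ.smooth) t, by
    obtain ⟨h1, h2⟩ := (inKerPhi_iff _ _).1 (hγ.gen t)
    obtain ⟨h3, h4⟩ := (hδ.gen t).pushforward_twistedD (hγ.lcs t)
    rw [generator_mul hγ.smooth hδ.smooth, iprod_add, twistedD_add _ (S.smooth_Ω.iprod h1) h3,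
      h2, h4, add_zero]⟩

theorem IsKerPhiIsotopy.inv {S : LCSStructure E M} {γ : ℝ → Diff E M}
    (hγ : IsKerPhiIsotopy S γ) : IsKerPhiIsotopy S γ⁻¹ where
  smooth := hγ.smooth.inv
  start := by rw [Pi.inv_apply, hγ.start, inv_one]
  lcs t := (hγ.lcs t).inv
  gen t := (inKerPhi_iff _ _).2 ⟨generator_smooth hγ.smooth.inv t, by
    obtain ⟨h3, h4⟩ := (hγ.gen t).pushforward_twistedD (hγ.lcs t).inv
    have h1 := generator_mul hγ.smooth.inv hγ.smooth t
    rw [inv_mul_cancel, generator_one] at h1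
    have h5 : iprod (generator γ⁻¹ t) S.Ω =
        (-1 : ℝ) • iprod (pushforward (γ⁻¹ t) (generator γ t)) S.Ω := by
      have h6 : generator γ⁻¹ t = -pushforward (γ⁻¹ t) (generator γ t) :=
        eq_neg_of_add_eq_zero_left h1.symm
      rw [h6]; ext x v; simp [iprod]
    have h7 : iprod (pushforward (γ⁻¹ t) (generator γ t)) S.Ω =
      iprod (pushforward (γ t)⁻¹ (generator γ t)) S.Ω := rfl
    rw [h5, twistedD_smul, h7, h4]; ext; simp⟩

/-- The smooth paths in `ker Φ` from the identity, a group under pointwise composition. -/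
noncomputable def isotopyGroup (S : LCSStructure E M) : Subgroup (ℝ → Diff E M) where
  carrier := {γ | IsKerPhiIsotopy S γ}
  one_mem' := .one S
  mul_mem' := .mul
  inv_mem' := .inv

/-- `H` is a smooth homotopy relative endpoints, in the group integrating `ker Φ`, from the constant
path at the identity (`s = 0`) to the restriction of `γ` to `[0, 1]` (`s = 1`). -/
structure IsNullHomotopy (S : LCSStructure E M) (γ : ℝ → Diff E M) (H : ℝ × ℝ → Diff E M) : Prop where
  smooth : SmoothFamily (ℝ × ℝ) H
  row : ∀ s, (fun t => H (s, t)) ∈ isotopyGroup S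
  column : ∀ t, (fun s => H (s, t)) ∈ isotopyGroup S
  fixed : ∀ s, H (s, 1) = 1
  finish : ∀ t ∈ Set.Icc (0 : ℝ) 1, H (1, t) = γ t

/-- The paths whose restriction to `[0, 1]` is a loop that is contractible by a smooth homotopy
relative endpoints. Two paths `γ`, `δ` are homotopic relative endpoints iff `γ⁻¹ δ` is in here. -/
noncomputable def nullHomotopic (S : LCSStructure E M) : Subgroup (isotopyGroup S) where
  carrier := {γ | ∃ H, IsNullHomotopy S γ H}
  one_mem' := ⟨1, .one, fun _ => one_mem _, fun _ => one_mem _, fun _ => rfl, fun _ _ => rfl⟩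
  mul_mem' := by
    rintro γ δ ⟨H, h⟩ ⟨K, k⟩
    exact ⟨H * K, h.smooth.mul k.smooth, fun s => mul_mem (h.row s) (k.row s),
      fun t => mul_mem (h.column t) (k.column t), fun s => by simp [h.fixed, k.fixed],
      fun t ht => by simp [h.finish t ht, k.finish t ht]⟩
  inv_mem' := by
    rintro γ ⟨H, h⟩
    exact ⟨H⁻¹, h.smooth.inv, fun s => inv_mem (h.row s),
      fun t => inv_mem (h.column t), fun s => by simp [h.fixed],
      fun t ht => by simp [h.finish t ht]⟩

theorem SmoothFamily.comp {V W : Type*} [NormedAddCommGroup V] [NormedSpace ℝ V]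
    [NormedAddCommGroup W] [NormedSpace ℝ W] {γ : V → Diff E M} (hγ : SmoothFamily V γ)
    {f : W → V} (hf : ContDiff ℝ ∞ f) : SmoothFamily W (γ ∘ f) :=
  ⟨hγ.1.comp ((hf.contMDiff.comp contMDiff_fst).prodMk contMDiff_snd),
    hγ.2.comp ((hf.contMDiff.comp contMDiff_fst).prodMk contMDiff_snd)⟩

theorem SmoothFamily.const {V : Type*} [NormedAddCommGroup V] [NormedSpace ℝ V] (g : Diff E M) :
    SmoothFamily V (fun _ => g) :=
  ⟨g.contMDiff.comp contMDiff_snd, g⁻¹.contMDiff.comp contMDiff_snd⟩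

theorem generator_const (g : Diff E M) (t : ℝ) : generator (fun _ => g) t = 0 := by
  funext y
  rw [generator, mfderiv_const]; rfl

theorem IsKerPhiIsotopy.conj {S : LCSStructure E M} {γ : ℝ → Diff E M} (hγ : IsKerPhiIsotopy S γ)
    {g : Diff E M} (hg : IsLCSDiffeo S g) : IsKerPhiIsotopy S (fun s => g * γ s * g⁻¹) := by
  have hc : SmoothFamily ℝ (fun _ : ℝ => g) := .const g
  have hc' : SmoothFamily ℝ (fun _ : ℝ => g⁻¹) := .const g⁻¹
  have hs : SmoothFamily ℝ (fun s => g * γ s * g⁻¹) := (hc.mul hγ.smooth).mul hc'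
  refine ⟨hs, by simp [hγ.start], fun t => (hg.mul (hγ.lcs t)).mul hg.inv, fun t => ?_⟩
  refine (inKerPhi_iff _ _).2 ⟨generator_smooth hs t, ?_⟩
  have hp (h : Diff E M) : pushforward h (0 : M → E) = 0 := by
    funext y; exact map_zero _
  have h1 : generator (fun s => g * γ s * g⁻¹) t = pushforward g (generator γ t) := by
    have h2 := generator_mul (hc.mul hγ.smooth) hc' t
    rw [generator_mul hc hγ.smooth, generator_const, generator_const, hp, add_zero, zero_add] at h2
    exact h2
  rw [h1]
  exact ((hγ.gen t).pushforward_twistedD hg).2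

instance nullHomotopic_normal (S : LCSStructure E M) : (nullHomotopic S).Normal where
  conj_mem := by
    rintro γ ⟨H, h⟩ δ
    have hδ : IsKerPhiIsotopy S (δ : ℝ → Diff E M) := δ.2
    refine ⟨fun p => δ.1 p.2 * H p * (δ.1 p.2)⁻¹, ?_, fun s => ?_, fun t => ?_, fun s => ?_,
      fun t ht => ?_⟩
    · have h1 := hδ.smooth.comp (f := fun p : ℝ × ℝ => p.2) contDiff_snd
      exact (h1.mul h.smooth).mul h1.inv
    · exact mul_mem (mul_mem δ.2 (h.row s)) (inv_mem δ.2)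
    · exact IsKerPhiIsotopy.conj (h.column t) (hδ.lcs t)
    · simp [h.fixed]
    · simp [h.finish t ht]

/-- The universal cover of `(ker Φ)_0`: homotopy classes relative endpoints of paths starting at
the identity, with pointwise composition of paths as product. -/
def UniversalCover (S : LCSStructure E M) : Type _ := isotopyGroup S ⧸ nullHomotopic S

noncomputable instance (S : LCSStructure E M) : Group (UniversalCover S) :=
  inferInstanceAs (Group (isotopyGroup S ⧸ nullHomotopic S))

/-- The homotopy class of a path. -/
noncomputable def isotopyClass (S : LCSStructure E M) : isotopyGroup S →* UniversalCover S :=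
  QuotientGroup.mk' (nullHomotopic S)

/-- The group `(ker Φ)_0`: the endpoints, at time one, of the smooth paths in `ker Φ` from the
identity. -/
noncomputable def kerPhiGroup (S : LCSStructure E M) : Subgroup (Diff E M) :=
  (isotopyGroup S).map (Pi.evalMonoidHom (fun _ : ℝ => Diff E M) 1)

/-- The endpoint of a path. -/
noncomputable def timeOne (S : LCSStructure E M) : isotopyGroup S →* kerPhiGroup S :=
  (Pi.evalMonoidHom (fun _ : ℝ => Diff E M) 1).subgroupMap (isotopyGroup S)

/-- The covering projection from the universal cover onto `(ker Φ)_0`, sending the class of a path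
to its endpoint. Its kernel is the fundamental group of `(ker Φ)_0`. -/
noncomputable def coverProj (S : LCSStructure E M) : UniversalCover S →* kerPhiGroup S :=
  QuotientGroup.lift (nullHomotopic S) (timeOne S) (by
    rintro γ ⟨H, h⟩
    apply Subtype.ext
    change (γ : ℝ → Diff E M) 1 = 1
    rw [← h.finish 1 (by simp), h.fixed])

/-- The smooth `k`-forms closed under `d^η`. -/
def cocycles (E M : Type*) [NormedAddCommGroup E] [NormedSpace ℝ E] [TopologicalSpace M]
    [ChartedSpace E M] (η : Form E M 1) (k : ℕ) : Submodule ℝ (Form E M k) where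
  carrier := {α | SmoothForm α ∧ twistedD η α = 0}
  zero_mem' := ⟨smoothForm_zero, by
    have h : (0 : Form E M k) = (0 : ℝ) • (0 : Form E M k) := by ext; simp
    rw [h, twistedD_smul]; ext; simp⟩
  add_mem' hα hβ := ⟨hα.1.add hβ.1, by rw [twistedD_add η hα.1 hβ.1, hα.2, hβ.2, add_zero]⟩
  smul_mem' c α hα := ⟨hα.1.smul c, by rw [twistedD_smul, hα.2]; ext; simp⟩

/-- The forms `d^η β`, for `β` a smooth `k`-form. -/
def coboundaries (E M : Type*) [NormedAddCommGroup E] [NormedSpace ℝ E] [TopologicalSpace M]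
    [ChartedSpace E M] (η : Form E M 1) (k : ℕ) : Submodule ℝ (Form E M (k + 1)) where
  carrier := {α | ∃ β : Form E M k, SmoothForm β ∧ twistedD η β = α}
  zero_mem' := ⟨0, smoothForm_zero, by
    have h : (0 : Form E M k) = (0 : ℝ) • (0 : Form E M k) := by ext; simp
    rw [h, twistedD_smul]; ext; simp⟩
  add_mem' := by
    rintro _ _ ⟨α, hα, rfl⟩ ⟨β, hβ, rfl⟩
    exact ⟨α + β, hα.add hβ, twistedD_add η hα hβ⟩
  smul_mem' := by
    rintro c _ ⟨α, hα, rfl⟩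
    exact ⟨c • α, hα.smul c, twistedD_smul η c α⟩

/-- The first Lichnerowicz cohomology `H^1_ω(M)`. -/
def H1 (S : LCSStructure E M) : Type _ :=
  Subquotient (cocycles E M S.lee 1) (coboundaries E M S.lee 0)

noncomputable instance instAddCommGroupH1 (S : LCSStructure E M) : AddCommGroup (H1 S) :=
  inferInstanceAs (AddCommGroup (Subquotient (cocycles E M S.lee 1) (coboundaries E M S.lee 0)))

noncomputable instance instModuleH1 (S : LCSStructure E M) : Module ℝ (H1 S) :=
  inferInstanceAs (Module ℝ (Subquotient (cocycles E M S.lee 1) (coboundaries E M S.lee 0)))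

/-- The class of a twisted cocycle. -/
noncomputable def cohomologyClass (S : LCSStructure E M) : cocycles E M S.lee 1 →ₗ[ℝ] H1 S :=
  Subquotient.mk (cocycles E M S.lee 1) (coboundaries E M S.lee 0)

theorem cohomologyClass_surjective (S : LCSStructure E M) :
    Function.Surjective (cohomologyClass S) :=
  Subquotient.mk_surjective (cocycles E M S.lee 1) (coboundaries E M S.lee 0)

theorem cohomologyClass_eq_zero (S : LCSStructure E M) (α : cocycles E M S.lee 1) :
    cohomologyClass S α = 0 ↔ ∃ β : Form E M 0, SmoothForm β ∧ twistedD S.lee β = α.1 :=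
  Subquotient.mk_eq_zero (cocycles E M S.lee 1) (coboundaries E M S.lee 0) α

/-- The 1-form `∫₀¹ i_{X_t} Ω dt` of a path with generator `X_t`. -/
noncomputable def fluxForm (S : LCSStructure E M) (γ : ℝ → Diff E M) : Form E M 1 := fun x =>
  ∫ t in (0 : ℝ)..1, iprod (generator γ t) S.Ω x

/-- `Ψ` is the lifted flux: it sends the class of every path `γ` to the class of
`∫₀¹ i_{X_t} Ω dt`, which is a smooth twisted cocycle. As every element of the universal cover is
the class of a path, there is at most one such `Ψ`. -/
def IsFluxHom (S : LCSStructure E M) (Ψ : UniversalCover S →* Multiplicative (H1 S)) : Prop :=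
  ∀ γ : isotopyGroup S, ∃ h : fluxForm S γ ∈ cocycles E M S.lee 1,
    Ψ (isotopyClass S γ) = Multiplicative.ofAdd (cohomologyClass S ⟨fluxForm S γ, h⟩)

/-- The period group `Δ`: the image under the flux of the fundamental group of `(ker Φ)_0`. -/
noncomputable def periodGroup {S : LCSStructure E M} (Ψ : UniversalCover S →* Multiplicative (H1 S)) :
    AddSubgroup (H1 S) := Subgroup.toAddSubgroup' ((coverProj S).ker.map Ψ)

/-- `Δ` is discrete in `H^1_ω(M)`: some open set meets it in zero only. The topology is the canonical
one of a real vector space (for compact `M` the space is finite-dimensional and this is its usual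
topology). -/
def IsDiscretePeriodGroup {S : LCSStructure E M} (Ψ : UniversalCover S →* Multiplicative (H1 S)) : Prop :=
  ∃ U : Set (H1 S), IsOpen[moduleTopology ℝ (H1 S)] U ∧ U ∩ periodGroup Ψ = {0}

/-- The group `Ham_Ω(M)`: the projection to `(ker Φ)_0` of the kernel of the lifted flux. -/
noncomputable def hamiltonianGroup {S : LCSStructure E M} (Ψ : UniversalCover S →* Multiplicative (H1 S)) :
    Subgroup (kerPhiGroup S) := Ψ.ker.map (coverProj S)

end Groups

end LCS

/-!
# The flux sequence of a locally conformally symplectic manifold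

The lifted flux is well defined and multiplicative because of one statement about squares of
diffeomorphisms. Let `K_{s,t}` be a smooth square with `K_{s,0} = id` whose rows `t ↦ K_{s,t}` are
paths in `ker Φ`. Then the flux of the row `s = 1` is the flux of the row `s = 0` plus the flux of the
path of endpoints `s ↦ K_{s,1}`, up to a twisted coboundary (`IsKerPhiSquare.exists_fluxForm_sub`).
Applied to a null-homotopy, it shows that contractible loops have exact flux; applied to the square
`γ_{st} δ_t`, whose rows `s = 0, 1` are `δ` and `γ δ` and whose path of endpoints is `γ_s δ_1`, it shows
that the flux is a homomorphism.

The statement about squares is a computation with differential forms. Let `D` be the map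
`(s, t, x) ↦ K_{s,t}⁻¹ x`. Since `D` is the identity at `t = 0`, the closed form `D^* ω - ω` is `d g` for
`g` the integral of the Lee form `ω` along the curves in the direction of `t` (`hasFDerivAt_gaugeRep`).
Hence `C = e^g D^* Ω` satisfies `d C + ω ∧ C = 0` on the product of `M` with the plane of parameters
(`twistedPullback_closed`). The components of this equation in one parameter and two directions of `M`
say that `e^g (K_{s,t}⁻¹)^* Ω` does not depend on `t`, because the generators lie in `ker Φ`; so it is `Ω`
(`exp_gaugeLog_smul_pullback`). It follows that the mixed components of `C` are, up to sign, the
contractions of `Ω` with the generators `X` and `Y` of the square in the directions of `t` and `s`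
(`IsKerPhiSquare.localRep_iprod_generatorAt`), and the component of `d C + ω ∧ C = 0` in both parameters
and one direction of `M` reads `∂_s (i_X Ω) - ∂_t (i_Y Ω) = d^ω h` (`IsKerPhiSquare.fderiv_iprod_sub`).
Green's formula on the unit square finishes the argument.

The flux is surjective because a twisted cocycle `η` is `i_X Ω` for a smooth vector field `X`, whose
flow is a path in `ker Φ`, by the same conformality statement, with constant generator `X`
(`liftedFlux_surjective`). This needs the smooth global flow of a vector field on a compact manifold,
which is built from the implicit function theorem in a space of continuous curves
(`exists_contDiffAt_solution`, `contMDiff_flow`).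

The exact sequence is then formal: `F` is the homomorphism induced by the flux on the quotient of
the universal cover by the fundamental group, and an element of `(ker Φ)_0` is in the kernel of `F` if
and only if one of its lifts can be corrected by a loop to have zero flux.
-/

namespace LCS

/-! ### Integrals depending on a parameter -/

section ParametricIntegral

universe u

variable {P : Type u} [NormedAddCommGroup P] [NormedSpace ℝ P] [ProperSpace P]

/-- Differentiation under the integral sign; the derivative is bounded on the compact set
`[a, b] × B(p, ε)`. -/
theorem hasFDerivAt_intervalIntegral_of_contDiffOn {F : Type*} [NormedAddCommGroup F]
    [NormedSpace ℝ F] [CompleteSpace F] {O : Set P} (hO : IsOpen O) {f : ℝ × P → F}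
    (hf : ContDiffOn ℝ 1 f (Set.univ ×ˢ O)) {p : P} (hp : p ∈ O) (a b : ℝ) :
    HasFDerivAt (fun q => ∫ t in a..b, f (t, q))
      (∫ t in a..b, fderiv ℝ f (t, p) ∘L .inr ℝ ℝ P) p := by
  have hUO : IsOpen (Set.univ ×ˢ O : Set (ℝ × P)) := isOpen_univ.prod hO
  obtain ⟨ε, hε, hεO⟩ := Metric.nhds_basis_closedBall.mem_iff.1 (hO.mem_nhds hp)
  have hc : ContinuousOn (fun q : ℝ × P => fderiv ℝ f q ∘L .inr ℝ ℝ P) (Set.univ ×ˢ O) :=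
    (hf.continuousOn_fderiv_of_isOpen hUO le_rfl).clm_comp continuousOn_const
  have hK : IsCompact (Set.uIcc a b ×ˢ Metric.closedBall p ε) :=
    isCompact_uIcc.prod (isCompact_closedBall p ε)
  obtain ⟨C, hC⟩ := hK.exists_bound_of_continuousOn
    (hc.mono (Set.prod_mono (Set.subset_univ _) hεO))
  have hline (q : P) (hq : q ∈ O) : Continuous fun t : ℝ => f (t, q) :=
    continuousOn_univ.1 (hf.continuousOn.comp (by fun_prop) fun t _ => ⟨trivial, hq⟩)
  have hline' : Continuous fun t : ℝ => fderiv ℝ f (t, p) ∘L .inr ℝ ℝ P :=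
    continuousOn_univ.1 (hc.comp (f := fun t : ℝ => (t, p)) (by fun_prop) fun t _ => ⟨trivial, hp⟩)
  refine (intervalIntegral.hasFDerivAt_integral_of_dominated_of_fderiv_le
    (F := fun q t => f (t, q)) (F' := fun q t => fderiv ℝ f (t, q) ∘L .inr ℝ ℝ P)
    (bound := fun _ => C) (Metric.closedBall_mem_nhds p hε) ?_ ?_ ?_ ?_ ?_ ?_)
  · filter_upwards [hO.mem_nhds hp] with q hq using (hline q hq).aestronglyMeasurable
  · exact (hline p hp).intervalIntegrable _ _
  · exact hline'.aestronglyMeasurable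
  · exact .of_forall fun t ht q hq => hC (t, q) ⟨Set.uIoc_subset_uIcc ht, hq⟩
  · exact intervalIntegrable_const
  · refine .of_forall fun t _ q hq => ?_
    have h1 : HasFDerivAt f (fderiv ℝ f (t, q)) (t, q) :=
      ((hf.contDiffAt (hUO.mem_nhds ⟨trivial, hεO hq⟩)).differentiableAt (by simp)).hasFDerivAt
    exact h1.comp q (hasFDerivAt_prodMk_right t q)

/-- Integrals of smooth functions are smooth in the parameters. The values and the parameters live
in the same universe because the induction replaces `F` by `P →L[ℝ] F`. -/
theorem contDiffOn_intervalIntegral {F : Type u} [NormedAddCommGroup F]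
    [NormedSpace ℝ F] [CompleteSpace F] {O : Set P} (hO : IsOpen O) {f : ℝ × P → F}
    (hf : ContDiffOn ℝ ∞ f (Set.univ ×ˢ O)) (a b : ℝ) :
    ContDiffOn ℝ ∞ (fun q => ∫ t in a..b, f (t, q)) O := by
  have hUO : IsOpen (Set.univ ×ˢ O : Set (ℝ × P)) := isOpen_univ.prod hO
  refine contDiffOn_infty.2 fun n => ?_
  induction n generalizing F with
  | zero =>
    refine contDiffOn_zero.2 fun q hq => ?_
    exact (hasFDerivAt_intervalIntegral_of_contDiffOn hO (hf.of_le (by simp)) hq a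
      b).continuousAt.continuousWithinAt
  | succ n ih =>
    have h1 (q : P) (hq : q ∈ O) := hasFDerivAt_intervalIntegral_of_contDiffOn hO
      (hf.of_le (by simp)) hq a b
    push_cast
    refine (contDiffOn_succ_iff_fderiv_of_isOpen hO).2
      ⟨fun q hq => (h1 q hq).differentiableAt.differentiableWithinAt, by simp, ?_⟩
    have h2 : ContDiffOn ℝ ∞ (fun q : ℝ × P => fderiv ℝ f q ∘L .inr ℝ ℝ P) (Set.univ ×ˢ O) :=
      (hf.fderiv_of_isOpen hUO (by simp)).clm_comp contDiffOn_const
    exact (ih h2).congr fun q hq => (h1 q hq).fderiv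

end ParametricIntegral

/-! ### Smoothness of the pullback of alternating maps -/

section Alternating

variable {E E' : Type*} [NormedAddCommGroup E] [NormedSpace ℝ E] [NormedAddCommGroup E']
  [NormedSpace ℝ E'] {W : Type*} [NormedAddCommGroup W] [NormedSpace ℝ W]

/-- Alternatization of continuous multilinear maps, as a continuous linear map. -/
noncomputable def alternatizationCLM (E : Type*) [NormedAddCommGroup E] [NormedSpace ℝ E] (k : ℕ) :
    ContinuousMultilinearMap ℝ (fun _ : Fin k => E) ℝ →L[ℝ] E [⋀^Fin k]→L[ℝ] ℝ :=
  LinearMap.mkContinuous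
    { toFun := fun f => ContinuousMultilinearMap.alternatization f
      map_add' := fun f g => map_add _ f g
      map_smul' := fun c f => by
        ext v
        simp only [ContinuousMultilinearMap.alternatization_apply_apply, Finset.smul_sum,
          smul_apply, ContinuousAlternatingMap.smul_apply, RingHom.id_apply,
          smul_comm c] }
    (Fintype.card (Equiv.Perm (Fin k))) fun f => by
      refine ContinuousAlternatingMap.opNorm_le_bound (f := ContinuousMultilinearMap.alternatization f)
        (by positivity) fun v => ?_
      rw [ContinuousMultilinearMap.alternatization_apply_apply]
      refine (norm_sum_le _ _).trans ?_
      rw [mul_assoc, ← nsmul_eq_mul]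
      refine Finset.sum_le_card_nsmul _ _ _ fun σ _ => ?_
      have h1 : ‖Equiv.Perm.sign σ • f (v ∘ σ)‖ = ‖f (v ∘ σ)‖ := by
        rcases Int.units_eq_one_or (Equiv.Perm.sign σ) with h | h <;> simp [h]
      rw [h1]
      refine (f.le_opNorm _).trans (le_of_eq ?_)
      congr 1
      exact Equiv.prod_comp σ fun i => ‖v i‖

theorem alternatizationCLM_coe {k : ℕ} (α : E [⋀^Fin k]→L[ℝ] ℝ) :
    alternatizationCLM E k α.toContinuousMultilinearMap = (k.factorial : ℝ) • α := by
  ext v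
  change ContinuousMultilinearMap.alternatization _ v = _
  have h (σ : Equiv.Perm (Fin k)) :
      Equiv.Perm.sign σ • α.toContinuousMultilinearMap (v ∘ σ) = α v := by
    have h1 : α (v ∘ σ) = Equiv.Perm.sign σ • α v := α.toAlternatingMap.map_perm v σ
    rw [ContinuousAlternatingMap.coe_toContinuousMultilinearMap, h1, smul_smul, Int.units_mul_self,
      one_smul]
  rw [ContinuousMultilinearMap.alternatization_apply_apply, Finset.sum_congr rfl fun σ _ => h σ]
  simp [Fintype.card_perm]

/-- Pullback of alternating maps is smooth in the alternating map and in the linear map. For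
multilinear maps this holds because the pullback is a polynomial; an alternating map is recovered
from its underlying multilinear map by alternatization and division by `k!`. -/
theorem contDiffAt_compContinuousLinearMap {k : ℕ} {n : WithTop ℕ∞} {α : W → E [⋀^Fin k]→L[ℝ] ℝ}
    {T : W → E' →L[ℝ] E} {w : W} (hα : ContDiffAt ℝ n α w) (hT : ContDiffAt ℝ n T w) :
    ContDiffAt ℝ n (fun w => (α w).compContinuousLinearMap (T w)) w := by
  have h1 : ContDiffAt ℝ n (fun w => ContinuousMultilinearMap.compContinuousLinearMapContinuousMultilinear
      ℝ (fun _ : Fin k => E') (fun _ : Fin k => E) ℝ (fun _ => T w)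
      (α w).toContinuousMultilinearMap) w := by
    refine ContDiffAt.clm_apply ?_ ?_
    · exact (ContinuousMultilinearMap.contDiff _).contDiffAt.comp w (contDiffAt_pi.2 fun _ => hT)
    · exact (ContinuousAlternatingMap.toContinuousMultilinearMapLI (𝕜 := ℝ) (E := E)
        (F := ℝ) (ι := Fin k)).contDiff.contDiffAt.comp w hα
  have h2 := (((Nat.factorial k : ℝ)⁻¹ •
    alternatizationCLM E' k).contDiff (n := n)).contDiffAt.comp w h1
  refine h2.congr_of_eventuallyEq (.of_forall fun w => ?_)
  have h3 := alternatizationCLM_coe ((α w).compContinuousLinearMap (T w))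
  have h4 : (k.factorial : ℝ) ≠ 0 := by positivity
  change _ = (k.factorial : ℝ)⁻¹ • alternatizationCLM E' k
    ((α w).compContinuousLinearMap (T w)).toContinuousMultilinearMap
  rw [h3, smul_smul, inv_mul_cancel₀ h4, one_smul]

end Alternating

/-! ### Superposition operators -/

section Superposition

universe u

variable {K : Type*} [TopologicalSpace K] [CompactSpace K]
  {E : Type u} [NormedAddCommGroup E] [NormedSpace ℝ E]
  {F : Type*} [NormedAddCommGroup F] [NormedSpace ℝ F]

/-- Pointwise application of a continuous family of operators to a continuous function, as a
continuous bilinear map. -/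
noncomputable def pointwiseApply (K E F : Type*) [TopologicalSpace K] [CompactSpace K]
    [NormedAddCommGroup E] [NormedSpace ℝ E] [NormedAddCommGroup F] [NormedSpace ℝ F] :
    C(K, E →L[ℝ] F) →L[ℝ] C(K, E) →L[ℝ] C(K, F) :=
  LinearMap.mkContinuous₂
    (LinearMap.mk₂ ℝ (fun (A : C(K, E →L[ℝ] F)) (h : C(K, E)) =>
        (⟨fun t => A t (h t), A.continuous.clm_apply h.continuous⟩ : C(K, F)))
      (fun _ _ _ => by ext; simp) (fun _ _ _ => by ext; simp) (fun _ _ _ => by ext; simp)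
      (fun _ _ _ => by ext; simp)) 1 fun A h => by
    rw [one_mul]
    refine (ContinuousMap.norm_le _ (by positivity)).2 fun t => ?_
    exact ((A t).le_opNorm _).trans
      (mul_le_mul (A.norm_coe_le_norm t) (h.norm_coe_le_norm t) (norm_nonneg _) (norm_nonneg A))

/-- The superposition operator `v ↦ f ∘ v` is differentiable, with derivative the multiplication by
`f' ∘ v`. The remainder is uniformly small because `v ↦ f' ∘ v` is continuous for the uniform
norm. -/
theorem hasFDerivAt_superposition {f : E → F} (hf : ContDiff ℝ 1 f) (w : C(K, E)) :
    HasFDerivAt (fun v : C(K, E) => (⟨f, hf.continuous⟩ : C(E, F)).comp v)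
      (pointwiseApply K E F
        ((⟨fderiv ℝ f, hf.continuous_fderiv (by simp)⟩ : C(E, E →L[ℝ] F)).comp w)) w := by
  set f' : C(E, E →L[ℝ] F) := ⟨fderiv ℝ f, hf.continuous_fderiv (by simp)⟩ with hf'
  rw [hasFDerivAt_iff_isLittleO_nhds_zero, Asymptotics.isLittleO_iff]
  intro ε hε
  have hcont : Continuous fun v : C(K, E) => f'.comp v := f'.continuous_postcomp
  obtain ⟨δ, hδ, h⟩ := (Metric.continuousAt_iff (f := fun v : C(K, E) => f'.comp v) (a := w)).1
    hcont.continuousAt ε hε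
  filter_upwards [Metric.ball_mem_nhds (0 : C(K, E)) hδ] with v hv
  rw [mem_ball_zero_iff] at hv
  refine (ContinuousMap.norm_le _ (by positivity)).2 fun t => ?_
  have hder : ∀ x ∈ Metric.closedBall (w t) ‖v t‖, HasFDerivWithinAt f (fderiv ℝ f x)
      (Metric.closedBall (w t) ‖v t‖) x := fun x _ =>
    ((hf.differentiable (by simp)) x).hasFDerivAt.hasFDerivWithinAt
  have hbd : ∀ x ∈ Metric.closedBall (w t) ‖v t‖, ‖fderiv ℝ f x - fderiv ℝ f (w t)‖ ≤ ε := by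
    intro x hx
    -- The value `x` is attained at `t` by a constant translate of `w`, which lies in the ball where
    -- `f' ∘ w` varies by less than `ε`.
    have h1 : dist (w + ContinuousMap.const K (x - w t)) w < δ := by
      rw [dist_eq_norm, add_sub_cancel_left]
      refine lt_of_le_of_lt ((ContinuousMap.norm_le _ (norm_nonneg v)).2 fun _ => ?_) hv
      rw [mem_closedBall_iff_norm] at hx
      exact hx.trans (v.norm_coe_le_norm t)
    have h2 := (ContinuousMap.dist_lt_iff hε).1 (h h1) t
    rw [dist_eq_norm] at h2
    simpa [hf'] using h2.le
  have h3 := (convex_closedBall (w t) ‖v t‖).norm_image_sub_le_of_norm_hasFDerivWithin_le' hder hbd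
    (x := w t) (y := w t + v t) (by simp) (by simp)
  rw [add_sub_cancel_left] at h3
  exact h3.trans (mul_le_mul_of_nonneg_left (v.norm_coe_le_norm t) hε.le)

/-- Superposition with a function of class `C^n` is a map of class `C^n` between spaces of
continuous functions on a compact space. -/
theorem contDiff_superposition {F : Type u} [NormedAddCommGroup F] [NormedSpace ℝ F]
    (n : ℕ) {f : E → F} (hf : ContDiff ℝ n f) :
    ContDiff ℝ n (fun v : C(K, E) => (⟨f, hf.continuous⟩ : C(E, F)).comp v) := by
  induction n generalizing F with
  | zero => exact contDiff_zero.2 (ContinuousMap.continuous_postcomp _)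
  | succ n ih =>
    have h1 : ContDiff ℝ 1 f := hf.of_le (by simp)
    push_cast at hf ⊢
    refine contDiff_succ_iff_fderiv.2
      ⟨fun w => (hasFDerivAt_superposition h1 w).differentiableAt, by simp, ?_⟩
    have h2 : ContDiff ℝ n (fderiv ℝ f) := (contDiff_succ_iff_fderiv.1 hf).2.2
    have h3 : fderiv ℝ (fun v : C(K, E) => (⟨f, hf.continuous⟩ : C(E, F)).comp v) =
        fun w => pointwiseApply K E F ((⟨fderiv ℝ f, h2.continuous⟩ : C(E, E →L[ℝ] F)).comp w) :=
      funext fun w => (hasFDerivAt_superposition h1 w).fderiv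
    rw [h3]
    exact (pointwiseApply K E F).contDiff.comp (ih h2)

end Superposition

/-! ### Local solutions of differential equations -/

section LocalFlow

universe u

variable {E : Type u} [NormedAddCommGroup E] [NormedSpace ℝ E] [CompleteSpace E]

theorem neg_two_le_two : (-2 : ℝ) ≤ 2 := by norm_num

/-- The primitive vanishing at `0` of a continuous function on `[-2, 2]`. -/
noncomputable def primitiveFn {E : Type*} [NormedAddCommGroup E] [NormedSpace ℝ E]
    (v : C(Set.Icc (-2 : ℝ) 2, E)) : C(Set.Icc (-2 : ℝ) 2, E) :=
  ⟨fun r => ∫ s in (0 : ℝ)..r, Set.IccExtend neg_two_le_two v s,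
    (intervalIntegral.continuous_primitive (fun _ _ =>
      (v.continuous.Icc_extend' (h := neg_two_le_two)).intervalIntegrable _ _) 0).comp
        continuous_subtype_val⟩

/-- Primitives, as a continuous linear operator. -/
noncomputable def primitiveCLM (E : Type*) [NormedAddCommGroup E] [NormedSpace ℝ E] :
    C(Set.Icc (-2 : ℝ) 2, E) →L[ℝ] C(Set.Icc (-2 : ℝ) 2, E) :=
  LinearMap.mkContinuous
    { toFun := primitiveFn
      map_add' := fun v w => by
        ext r
        exact intervalIntegral.integral_add
          ((v.continuous.Icc_extend' (h := neg_two_le_two)).intervalIntegrable _ _)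
          ((w.continuous.Icc_extend' (h := neg_two_le_two)).intervalIntegrable _ _)
      map_smul' := fun c v => by
        ext r
        exact intervalIntegral.integral_smul c _ } 2 fun v => by
      refine (ContinuousMap.norm_le (primitiveFn v) (by positivity)).2 fun r => ?_
      refine (intervalIntegral.norm_integral_le_of_norm_le_const (C := ‖v‖) fun s _ =>
        v.norm_coe_le_norm _).trans ?_
      rw [mul_comm, sub_zero]
      exact mul_le_mul_of_nonneg_right (abs_le.2 ⟨r.2.1, r.2.2⟩) (norm_nonneg v)

/-- Local solutions of `u' = τ f(u)` on `(-2, 2)`, for small `τ`, depend `C^n`-smoothly on `τ` and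
on the initial value. They come from the implicit function theorem for the integral equation
`u = y + τ ∫ f(u)` in the space of continuous curves: at `τ = 0` its linearization is the
identity. -/
theorem exists_contDiffAt_solution {f : E → E} (n : ℕ) (hn : n ≠ 0) (hf : ContDiff ℝ n f) (y₀ : E) :
    ∃ u : ℝ × E → ℝ → E, ContDiffAt ℝ n (fun p => u p 1) (0, y₀) ∧ u (0, y₀) 1 = y₀ ∧
      ∀ V ∈ 𝓝 y₀, ∀ᶠ p in 𝓝 ((0 : ℝ), y₀), u p 0 = p.2 ∧
        ∀ r ∈ Set.Ioo (-2 : ℝ) 2, HasDerivAt (u p) (p.1 • f (u p r)) r ∧ u p r ∈ V := by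
  let I := Set.Icc (-2 : ℝ) 2
  let N : C(I, E) → C(I, E) := fun v => (⟨f, hf.continuous⟩ : C(E, E)).comp v
  have hN : ContDiff ℝ n N := contDiff_superposition n hf
  have hn' : (n : WithTop ℕ∞) ≠ 0 := by exact_mod_cast hn
  let cst : E →L[ℝ] C(I, E) := LinearMap.mkContinuous
    { toFun := ContinuousMap.const I, map_add' := fun _ _ => rfl, map_smul' := fun _ _ => rfl } 1
    fun y => (ContinuousMap.norm_le _ (by positivity)).2 fun _ => le_of_eq (one_mul ‖y‖).symm
  let G : (ℝ × E) × C(I, E) → C(I, E) := fun q =>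
    q.2 - cst q.1.2 - q.1.1 • primitiveCLM E (N q.2)
  let p₀ : (ℝ × E) × C(I, E) := ((0, y₀), cst y₀)
  have hG : ContDiffAt ℝ n G p₀ := by
    refine ContDiff.contDiffAt ?_
    have h1 : ContDiff ℝ n fun q : (ℝ × E) × C(I, E) => primitiveCLM E (N q.2) :=
      (primitiveCLM E).contDiff.comp (hN.comp contDiff_snd)
    have h2 : ContDiff ℝ n fun q : (ℝ × E) × C(I, E) => cst q.1.2 :=
      cst.contDiff.comp (contDiff_snd.comp contDiff_fst)
    exact (contDiff_snd.sub h2).sub ((contDiff_fst.comp contDiff_fst).smul h1)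
  have hinr : (fderiv ℝ G p₀ ∘L .inr ℝ (ℝ × E) C(I, E)) = .id ℝ _ := by
    have h1 := (hG.differentiableAt hn').hasFDerivAt.comp (cst y₀)
      (hasFDerivAt_prodMk_right (𝕜 := ℝ) (0, y₀) (cst y₀))
    have h2 : (G ∘ fun v => ((0, y₀), v)) = fun v => v - cst y₀ := by
      funext v; simp [G]
    rw [h2] at h1
    exact h1.unique ((hasFDerivAt_id _).sub_const _)
  have hinv : (fderiv ℝ G p₀ ∘L .inr ℝ (ℝ × E) C(I, E)).IsInvertible := by
    rw [hinr]; exact ⟨ContinuousLinearEquiv.refl ℝ _, rfl⟩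
  have hG0 : G p₀ = 0 := by simp [G, p₀]
  set U := hG.implicitFunction hn' hinv with hU
  have hUs : ContDiffAt ℝ n U (0, y₀) := hG.contDiffAt_implicitFunction hn' hinv
  have hU0 : U (0, y₀) = cst y₀ := hG.implicitFunction_apply_self hn' hinv
  have hUe := hG.eventually_apply_implicitFunction hn' hinv
  refine ⟨fun p r => Set.IccExtend neg_two_le_two (U p) r, ?_, ?_, fun V hV => ?_⟩
  · have h1 : (fun p => Set.IccExtend neg_two_le_two (U p) 1) =
        fun p => ContinuousMap.evalCLM ℝ (⟨1, by norm_num, by norm_num⟩ : I) (U p) := by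
      funext p
      exact Set.IccExtend_of_mem _ _ _
    rw [h1]
    exact (ContinuousLinearMap.contDiff _).contDiffAt.comp _ hUs
  · change Set.IccExtend neg_two_le_two (U (0, y₀)) 1 = y₀
    rw [Set.IccExtend_of_mem _ _ (⟨by norm_num, by norm_num⟩ : (1 : ℝ) ∈ I), hU0]
    rfl
  · obtain ⟨ε, hε, hεV⟩ := Metric.mem_nhds_iff.1 hV
    have h1 : ∀ᶠ p in 𝓝 ((0 : ℝ), y₀), dist (U p) (cst y₀) < ε := by
      have := hUs.continuousAt.tendsto
      rw [hU0] at this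
      exact this (Metric.ball_mem_nhds _ hε)
    filter_upwards [hUe, h1] with p hp hp'
    have key (r : I) : U p r = p.2 + p.1 • ∫ s in (0 : ℝ)..r,
        Set.IccExtend neg_two_le_two (N (U p)) s := by
      have h2 : U p - cst p.2 - p.1 • primitiveCLM E (N (U p)) = 0 := hp.trans hG0
      have h3 := congrArg (fun v : C(I, E) => v r) h2
      have h4 : U p r - p.2 - p.1 • (∫ s in (0 : ℝ)..r,
        Set.IccExtend neg_two_le_two (N (U p)) s) = 0 := h3
      rw [sub_sub] at h4
      exact sub_eq_zero.1 h4
    refine ⟨?_, fun r hr => ⟨?_, ?_⟩⟩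
    · rw [Set.IccExtend_of_mem _ _ (⟨by norm_num, by norm_num⟩ : (0 : ℝ) ∈ I), key]
      simp
    · have h5 : HasDerivAt (fun r => p.2 + p.1 • ∫ s in (0 : ℝ)..r,
          Set.IccExtend neg_two_le_two (N (U p)) s)
          (p.1 • Set.IccExtend neg_two_le_two (N (U p)) r) r := by
        refine HasDerivAt.const_add _ (HasDerivAt.const_smul _ ?_)
        have hc : Continuous (Set.IccExtend neg_two_le_two (N (U p))) :=
          (N (U p)).continuous.Icc_extend'
        exact intervalIntegral.integral_hasDerivAt_right (hc.intervalIntegrable _ _)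
          hc.stronglyMeasurable.stronglyMeasurableAtFilter hc.continuousAt
      refine h5.congr_of_eventuallyEq ?_
      filter_upwards [isOpen_Ioo.mem_nhds hr] with s hs
      rw [Set.IccExtend_of_mem _ _ (Set.Ioo_subset_Icc_self hs)]
      exact key _
    · rw [Set.IccExtend_of_mem _ _ (Set.Ioo_subset_Icc_self hr)]
      exact hεV (lt_of_le_of_lt (ContinuousMap.dist_apply_le_dist (f := U p) (g := cst y₀) _) hp')

end LocalFlow

/-! ### The flow of a vector field on a compact manifold -/

section Flow

universe u

variable {E : Type u} [NormedAddCommGroup E] [NormedSpace ℝ E] [FiniteDimensional ℝ E]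
  {M : Type*} [TopologicalSpace M] [ChartedSpace E M] [IsManifold 𝓘(ℝ, E) ∞ M]

/-- Near `x₀`, integral curves of `τ X` for small `τ` exist on `(-2, 2)` and depend smoothly on `τ`
and on the initial value. -/
theorem exists_contMDiffAt_integralCurve {X : M → E} (hX : SmoothVF X) (x₀ : M) (n : ℕ)
    (hn : n ≠ 0) :
    ∃ c : ℝ × M → ℝ → M,
      ContMDiffAt (𝓘(ℝ, ℝ).prod 𝓘(ℝ, E)) 𝓘(ℝ, E) n (fun p => c p 1) (0, x₀) ∧
      ∀ᶠ p in 𝓝 ((0 : ℝ), x₀), c p 0 = p.2 ∧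
        IsMIntegralCurveOn (I := 𝓘(ℝ, E)) (c p) (fun x => (p.1 • X x : E)) (Set.Ioo (-2) 2) := by
  have : CompleteSpace E := FiniteDimensional.complete ℝ E
  set φ := extChartAt 𝓘(ℝ, E) x₀ with hφ
  set y₀ := φ x₀ with hy₀
  have hy₀t : y₀ ∈ φ.target := mem_extChartAt_target x₀
  obtain ⟨ρ, hρ, hρU⟩ := Metric.nhds_basis_closedBall.mem_iff.1 (target_mem_nhds hy₀t)
  -- A cutoff extends the vector field from the chart to the whole model space.
  let χ : ContDiffBump y₀ := ⟨ρ / 2, ρ, by positivity, by linarith⟩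
  let Xc : E → E := fun y => tmap φ (φ.symm y) (X (φ.symm y))
  have hXc : ContDiffOn ℝ ∞ Xc φ.target := hX.coord x₀
  let f : E → E := fun y => χ y • Xc y
  have hf : ContDiff ℝ ∞ f := by
    refine contDiff_iff_contDiffAt.2 fun y => ?_
    by_cases hy : y ∈ tsupport χ
    · have hy' : y ∈ φ.target := hρU (by rwa [χ.tsupport_eq] at hy)
      exact χ.contDiff.contDiffAt.smul (hXc.contDiffAt (target_mem_nhds hy'))
    · have h1 : f =ᶠ[𝓝 y] fun _ => 0 := by
        filter_upwards [notMem_tsupport_iff_eventuallyEq.1 hy] with z hz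
        simp [f, hz]
      exact contDiffAt_const.congr_of_eventuallyEq h1
  obtain ⟨u, hu1, hu2, hu3⟩ := exists_contDiffAt_solution n hn (hf.of_le (by exact_mod_cast le_top)) y₀
  have hpair : ContMDiffAt (𝓘(ℝ, ℝ).prod 𝓘(ℝ, E)) 𝓘(ℝ, ℝ × E) n
      (fun p : ℝ × M => (p.1, φ p.2)) (0, x₀) := by
    refine ContMDiffAt.prodMk_space contMDiffAt_fst ?_
    exact (((contMDiffAt_ext (mem_extChartAt_source x₀)).of_le
      (by exact_mod_cast le_top)).comp (0, x₀) contMDiffAt_snd)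
  refine ⟨fun p r => φ.symm (u (p.1, φ p.2) r), ?_, ?_⟩
  · have h1 : ContMDiffAt (𝓘(ℝ, ℝ).prod 𝓘(ℝ, E)) 𝓘(ℝ, E) n
        (fun p : ℝ × M => u (p.1, φ p.2) 1) (0, x₀) :=
      hu1.contMDiffAt.comp ((0 : ℝ), x₀) hpair
    have h2 : ContMDiffAt 𝓘(ℝ, E) 𝓘(ℝ, E) n φ.symm (u (0, φ x₀) 1) := by
      rw [← hy₀, hu2]
      exact (contMDiffAt_symm hy₀t).of_le (by exact_mod_cast le_top)
    exact h2.comp ((0 : ℝ), x₀) h1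
  · have hV : Metric.ball y₀ (ρ / 2) ∈ 𝓝 y₀ := Metric.ball_mem_nhds _ (by positivity)
    have h3 : ∀ᶠ p : ℝ × M in 𝓝 (0, x₀), p.2 ∈ φ.source :=
      continuousAt_snd.eventually ((isOpen_extChartAt_source (I := 𝓘(ℝ, E)) x₀).mem_nhds
        (mem_extChartAt_source x₀))
    filter_upwards [hpair.continuousAt.eventually (hu3 _ hV), h3] with p hp hp2
    refine ⟨?_, fun r hr => ?_⟩
    · rw [hp.1]; exact φ.left_inv hp2
    · obtain ⟨h4, h5⟩ := hp.2 r hr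
      set z := u (p.1, φ p.2) r with hz
      have hzt : z ∈ φ.target := hρU (Metric.ball_subset_closedBall
        (Metric.ball_subset_ball (by linarith) h5))
      have h6 := (mdiffAt_symm hzt).hasMFDerivAt.comp r h4.hasFDerivAt.hasMFDerivAt
      have h7 : f z = Xc z := by
        have : χ z = 1 := χ.one_of_mem_closedBall (Metric.ball_subset_closedBall h5)
        simp [f, this]
      refine HasMFDerivAt.hasMFDerivWithinAt (h6.congr_mfderiv ?_)
      ext
      have h8 : tmap φ.symm z (p.1 • f z) = p.1 • X (φ.symm z) := by
        rw [map_smul, h7]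
        congr 1
        exact tmap_symm_tmap hzt _
      have h9 : tmap φ.symm z ((1 : ℝ) • p.1 • f z) = (1 : ℝ) • (p.1 • X (φ.symm z)) := by
        rw [one_smul, one_smul, h8]
      exact h9

variable [T2Space M] [CompactSpace M]

theorem SmoothVF.contMDiff_one {X : M → E} (hX : SmoothVF X) (a : ℝ) :
    ContMDiff 𝓘(ℝ, E) (𝓘(ℝ, E)).tangent 1
      (fun x => (⟨x, a • X x⟩ : TangentBundle 𝓘(ℝ, E) M)) := by
  have h1 : ContMDiff 𝓘(ℝ, E) (𝓘(ℝ, E)).tangent ∞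
      (fun x => (⟨x, X x⟩ : TangentBundle 𝓘(ℝ, E) M)) := hX
  have h2 := ContMDiff.smul_section (V := fun x : M => TangentSpace 𝓘(ℝ, E) x)
    (s := fun x => (X x : TangentSpace 𝓘(ℝ, E) x)) (contMDiff_const (c := a)) h1
  exact h2.of_le (by simp)

instance isManifold_one : IsManifold 𝓘(ℝ, E) 1 M := .of_le (n := ∞) (by simp)

/-- On a compact manifold the time of existence of integral curves has a positive lower bound, so
that they exist for all times. -/
theorem exists_isMIntegralCurve {X : M → E} (hX : SmoothVF X) (x : M) :
    ∃ γ : ℝ → M, γ 0 = x ∧ IsMIntegralCurve (I := 𝓘(ℝ, E)) γ (fun x => (X x : E)) := by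
  have hev : ∀ᶠ τ in 𝓝 (0 : ℝ), ∀ x ∈ (Set.univ : Set M), ∃ c : ℝ → M, c 0 = x ∧
      IsMIntegralCurveOn (I := 𝓘(ℝ, E)) c (fun x => (τ • X x : E)) (Set.Ioo (-2) 2) := by
    refine isCompact_univ.eventually_forall_of_forall_eventually fun x _ => ?_
    obtain ⟨c, -, hc⟩ := exists_contMDiffAt_integralCurve hX x 1 one_ne_zero
    filter_upwards [hc] with p hp using ⟨c p, hp⟩
  obtain ⟨ε, hε, hball⟩ := Metric.eventually_nhds_iff.1 hev
  have hτ := hball (y := ε / 2) (by simp [abs_of_pos hε]; linarith)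
  have h1 : ContMDiff 𝓘(ℝ, E) (𝓘(ℝ, E)).tangent 1
      (fun x => (⟨x, X x⟩ : TangentBundle 𝓘(ℝ, E) M)) := by
    simpa using hX.contMDiff_one 1
  refine exists_isMIntegralCurve_of_isMIntegralCurveOn (ε := ε) h1 hε (fun x => ?_) x
  obtain ⟨c, hc0, hc⟩ := hτ x trivial
  refine ⟨c ∘ (· * (2 / ε)), by simp [hc0], ?_⟩
  have h2 := hc.comp_mul (2 / ε)
  have h4 : Set.Ioo (-ε) ε ⊆ {t | t * (2 / ε) ∈ Set.Ioo (-2) 2} := by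
    intro t ht
    have h5 : t * (2 / ε) = 2 * (t / ε) := by ring
    have h6 : -1 < t / ε := by rw [lt_div_iff₀ hε]; linarith [ht.1]
    have h7 : t / ε < 1 := by rw [div_lt_iff₀ hε]; linarith [ht.2]
    change t * (2 / ε) ∈ Set.Ioo (-2) 2
    rw [h5]
    constructor <;> linarith
  have h3 : ((2 / ε) • fun x => ((ε / 2) • X x : E)) = X := by
    funext x
    change (2 / ε) • (ε / 2) • X x = X x
    rw [smul_smul, div_mul_div_cancel₀ hε.ne', div_self two_ne_zero, one_smul]
  exact Eq.subst (motive := fun Y : M → E => IsMIntegralCurveOn (I := 𝓘(ℝ, E))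
    (c ∘ (· * (2 / ε))) Y (Set.Ioo (-ε) ε)) h3 (h2.mono h4)

/-- The global flow of a smooth vector field on a compact manifold. -/
noncomputable def flow {X : M → E} (hX : SmoothVF X) (t : ℝ) (x : M) : M :=
  (exists_isMIntegralCurve hX x).choose t

theorem flow_zero {X : M → E} (hX : SmoothVF X) (x : M) : flow hX 0 x = x :=
  (exists_isMIntegralCurve hX x).choose_spec.1

theorem isMIntegralCurve_flow {X : M → E} (hX : SmoothVF X) (x : M) :
    IsMIntegralCurve (I := 𝓘(ℝ, E)) (fun t => flow hX t x) (fun x => (X x : E)) :=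
  (exists_isMIntegralCurve hX x).choose_spec.2

theorem flow_add {X : M → E} (hX : SmoothVF X) (s t : ℝ) (x : M) :
    flow hX (s + t) x = flow hX s (flow hX t x) := by
  have h1 : ContMDiff 𝓘(ℝ, E) (𝓘(ℝ, E)).tangent 1
      (fun x => (⟨x, X x⟩ : TangentBundle 𝓘(ℝ, E) M)) := by
    simpa using hX.contMDiff_one 1
  exact congrFun (isMIntegralCurve_Ioo_eq_of_contMDiff_boundaryless (t₀ := 0) h1
    ((isMIntegralCurve_flow hX x).comp_add t) (isMIntegralCurve_flow hX (flow hX t x))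
    (by simp [flow_zero])) s

/-- The flow is smooth at time zero: near `(0, x)` it is the time-one value of the solution for the
rescaled field `τ X`, by uniqueness. -/
theorem contMDiffAt_flow_zero {X : M → E} (hX : SmoothVF X) (n : ℕ) (hn : n ≠ 0) (x : M) :
    ContMDiffAt (𝓘(ℝ, ℝ).prod 𝓘(ℝ, E)) 𝓘(ℝ, E) n (fun p : ℝ × M => flow hX p.1 p.2) (0, x) := by
  obtain ⟨c, hc, hev⟩ := exists_contMDiffAt_integralCurve hX x n hn
  refine hc.congr_of_eventuallyEq ?_
  filter_upwards [hev] with p hp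
  have h1 := ((isMIntegralCurve_flow hX p.2).comp_mul p.1).isMIntegralCurveOn (Set.Ioo (-2) 2)
  have h2 := isMIntegralCurveOn_Ioo_eqOn_of_contMDiff_boundaryless (t₀ := 0) (by simp)
    (hX.contMDiff_one p.1) h1 hp.2 (by simp [flow_zero, hp.1])
  simpa using h2 (show (1 : ℝ) ∈ Set.Ioo (-2 : ℝ) 2 by norm_num)

/-- The flow is smooth: near time `0` by smooth dependence on initial values, and everywhere by
the group law. The order `n` is kept finite because only then does regularity at a point spread to
a neighbourhood. -/
theorem contMDiff_flow {X : M → E} (hX : SmoothVF X) :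
    ContMDiff (𝓘(ℝ, ℝ).prod 𝓘(ℝ, E)) 𝓘(ℝ, E) ∞ (fun p : ℝ × M => flow hX p.1 p.2) := by
  refine contMDiff_infty.2 fun m => ?_
  suffices h : ContMDiff (𝓘(ℝ, ℝ).prod 𝓘(ℝ, E)) 𝓘(ℝ, E) ((m + 1 : ℕ) : WithTop ℕ∞)
      (fun p : ℝ × M => flow hX p.1 p.2) from h.of_le (by norm_cast; omega)
  set n := m + 1
  have hev : ∀ᶠ τ in 𝓝 (0 : ℝ), ∀ x ∈ (Set.univ : Set M),
      ContMDiffAt (𝓘(ℝ, ℝ).prod 𝓘(ℝ, E)) 𝓘(ℝ, E) n (fun p : ℝ × M => flow hX p.1 p.2) (τ, x) := by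
    refine isCompact_univ.eventually_forall_of_forall_eventually fun x _ => ?_
    exact (contMDiffAt_iff_contMDiffAt_nhds (by simp)).1
      (contMDiffAt_flow_zero hX n (by omega) x)
  have hmap (t : ℝ) : ContMDiff 𝓘(ℝ, E) 𝓘(ℝ, E) n (flow hX t) := by
    have h1 : Filter.Tendsto (fun N : ℕ => t / ((N : ℝ) + 1)) Filter.atTop (𝓝 0) :=
      by simpa [Function.comp_def] using (tendsto_const_div_atTop_nhds_zero_nat t).comp (Filter.tendsto_add_atTop_nat 1)
    obtain ⟨N, hN⟩ := (h1.eventually hev).exists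
    -- The time-`t` map is an iterate of the time-`t / (N + 1)` map.
    have h2 (k : ℕ) : ContMDiff 𝓘(ℝ, E) 𝓘(ℝ, E) n (flow hX (k * (t / ((N : ℝ) + 1)))) := by
      induction k with
      | zero =>
        have : flow hX ((0 : ℕ) * (t / ((N : ℝ) + 1))) = id := by
          funext x; simp [flow_zero]
        rw [this]; exact contMDiff_id
      | succ k ih =>
        have : flow hX ((k + 1 : ℕ) * (t / ((N : ℝ) + 1))) =
            fun x => flow hX (t / ((N : ℝ) + 1)) (flow hX (k * (t / ((N : ℝ) + 1))) x) := by
          funext x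
          rw [← flow_add]; congr 1; push_cast; ring
        rw [this]
        intro x
        exact ContMDiffAt.comp x (f := fun x => (t / ((N : ℝ) + 1),
          flow hX (k * (t / ((N : ℝ) + 1))) x)) (hN _ trivial) (contMDiffAt_const.prodMk (ih x))
    have h3 := h2 (N + 1)
    have h4 : ((N + 1 : ℕ) : ℝ) * (t / ((N : ℝ) + 1)) = t := by
      push_cast; field_simp
    rwa [h4] at h3
  rintro ⟨t₀, x₀⟩
  have h5 : (fun p : ℝ × M => flow hX p.1 p.2) =
      fun p : ℝ × M => flow hX (p.1 - t₀) (flow hX t₀ p.2) := by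
    funext p; rw [← flow_add, sub_add_cancel]
  rw [h5]
  have h6 : ContMDiffAt (𝓘(ℝ, ℝ).prod 𝓘(ℝ, E)) 𝓘(ℝ, E) n (fun p : ℝ × M => flow hX p.1 p.2)
      (t₀ - t₀, flow hX t₀ x₀) := by
    rw [sub_self]; exact contMDiffAt_flow_zero hX n (by omega) _
  have h7 : ContMDiffAt (𝓘(ℝ, ℝ).prod 𝓘(ℝ, E)) 𝓘(ℝ, ℝ) n (fun p : ℝ × M => p.1 - t₀) (t₀, x₀) :=
    ((contDiff_id.sub contDiff_const).contMDiff.contMDiffAt (x := t₀)).comp (t₀, x₀) contMDiffAt_fst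
  exact h6.comp (t₀, x₀) (h7.prodMk ((hmap t₀ x₀).comp (t₀, x₀) contMDiffAt_snd))

/-- The time-`t` map of the flow, as a diffeomorphism. -/
noncomputable def flowDiff {X : M → E} (hX : SmoothVF X) (t : ℝ) : Diff E M where
  toFun := flow hX t
  invFun := flow hX (-t)
  left_inv x := by rw [← flow_add, neg_add_cancel, flow_zero]
  right_inv x := by rw [← flow_add, add_neg_cancel, flow_zero]
  contMDiff_toFun := (contMDiff_flow hX).comp (contMDiff_const.prodMk contMDiff_id)
  contMDiff_invFun := (contMDiff_flow hX).comp (contMDiff_const.prodMk contMDiff_id)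

theorem smoothFamily_flowDiff {X : M → E} (hX : SmoothVF X) :
    SmoothFamily ℝ (flowDiff hX) :=
  ⟨contMDiff_flow hX, (contMDiff_flow hX).comp
    ((contDiff_neg.contMDiff.comp contMDiff_fst).prodMk contMDiff_snd)⟩

theorem flowDiff_zero {X : M → E} (hX : SmoothVF X) : flowDiff hX 0 = 1 :=
  Diffeomorph.ext fun x => flow_zero hX x

theorem generator_flowDiff {X : M → E} (hX : SmoothVF X) (t : ℝ) :
    generator (flowDiff hX) t = X := by
  funext y
  have h1 := isMIntegralCurve_flow hX ((flowDiff hX t).symm y) t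
  have h2 : generator (flowDiff hX) t y =
      (1 : ℝ) • X (flow hX t ((flowDiff hX t).symm y)) :=
    congrArg (fun L : ℝ →L[ℝ] E => L 1) h1.mfderiv
  rw [h2, one_smul]
  exact congrArg X ((flowDiff hX t).apply_symm_apply y)

end Flow

/-! ### Pullback of forms to normed spaces -/

section PullbackToVectorSpace

variable {E : Type*} [NormedAddCommGroup E] [NormedSpace ℝ E]
  {M : Type*} [TopologicalSpace M] [ChartedSpace E M]
  {W : Type*} [NormedAddCommGroup W] [NormedSpace ℝ W]

/-- The differential of a map from a normed space `W` to `M`. -/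
noncomputable def vtmap (G : W → M) (w : W) : W →L[ℝ] E := mfderiv 𝓘(ℝ, W) 𝓘(ℝ, E) G w

/-- The pullback of a form on `M` to a normed space `W`, which need not be the model space. -/
noncomputable def vpullback {k : ℕ} (G : W → M) (α : Form E M k) : Form W W k := fun w =>
  (α (G w)).compContinuousLinearMap (vtmap G w)

theorem vpullback_apply {k : ℕ} (G : W → M) (α : Form E M k) (w : W) (v : Fin k → W) :
    vpullback G α w v = α (G w) (fun i => vtmap G w (v i)) := rfl

theorem vpullback_wedge {k : ℕ} (G : W → M) (η : Form E M 1) (α : Form E M k) :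
    vpullback G (wedge η α) = wedge (vpullback G η) (vpullback G α) := by
  ext w v
  simp only [vpullback_apply, wedge_apply]
  rfl

variable [IsManifold 𝓘(ℝ, E) ∞ M]

/-- The pullback to a normed space in terms of the representative of the form in one fixed chart. -/
theorem vpullback_eventuallyEq {k : ℕ} {G : W → M} {w₀ : W}
    (hG : ∀ᶠ w in 𝓝 w₀, ContMDiffAt 𝓘(ℝ, W) 𝓘(ℝ, E) ∞ G w) (α : Form E M k) :
    vpullback G α =ᶠ[𝓝 w₀] fun w =>
      (localRep α (G w₀) (extChartAt 𝓘(ℝ, E) (G w₀) (G w))).compContinuousLinearMap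
        (fderiv ℝ (extChartAt 𝓘(ℝ, E) (G w₀) ∘ G) w) := by
  have h1 : ∀ᶠ w in 𝓝 w₀, G w ∈ (extChartAt 𝓘(ℝ, E) (G w₀)).source :=
    hG.self_of_nhds.continuousAt.eventually
      ((isOpen_extChartAt_source (I := 𝓘(ℝ, E)) (G w₀)).mem_nhds (mem_extChartAt_source (G w₀)))
  filter_upwards [hG, h1, eventually_eventually_nhds.2 h1] with w hw hw1 hw2
  set φ := extChartAt 𝓘(ℝ, E) (G w₀) with hφ
  have hm : MDifferentiableAt 𝓘(ℝ, W) 𝓘(ℝ, E) (φ ∘ G) w :=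
    (mdiffAt_ext hw1).comp w (hw.mdifferentiableAt (by simp))
  have h2 : vtmap G w = (tmap φ.symm (φ (G w)) ∘L fderiv ℝ (φ ∘ G) w : W →L[ℝ] E) := by
    have h3 : φ.symm ∘ (φ ∘ G) =ᶠ[𝓝 w] G := by
      filter_upwards [hw2] with u hu using φ.left_inv hu
    have h4 := mfderiv_comp w (mdiffAt_symm (φ.map_source hw1)) hm
    rw [h3.mfderiv_eq] at h4
    refine Eq.trans h4 ?_
    rw [← mfderiv_eq_fderiv]
    rfl
  ext v
  rw [vpullback_apply, h2]
  change _ = α (φ.symm (φ (G w))) (fun i => tmap φ.symm (φ (G w)) (fderiv ℝ (φ ∘ G) w (v i)))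
  rw [φ.left_inv hw1]
  rfl

theorem contDiffAt_chart_comp {G : W → M} {w₀ : W} (hG : ContMDiffAt 𝓘(ℝ, W) 𝓘(ℝ, E) ∞ G w₀) :
    ContDiffAt ℝ ∞ (extChartAt 𝓘(ℝ, E) (G w₀) ∘ G) w₀ :=
  ((contMDiffAt_ext (mem_extChartAt_source (G w₀))).comp w₀ hG).contDiffAt

theorem contDiffAt_vpullback {k : ℕ} {G : W → M} {w₀ : W}
    (hG : ∀ᶠ w in 𝓝 w₀, ContMDiffAt 𝓘(ℝ, W) 𝓘(ℝ, E) ∞ G w) {α : Form E M k} (hα : SmoothForm α) :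
    ContDiffAt ℝ ∞ (vpullback G α) w₀ := by
  refine ContDiffAt.congr_of_eventuallyEq ?_ (vpullback_eventuallyEq hG α)
  have h1 := contDiffAt_chart_comp hG.self_of_nhds
  exact contDiffAt_compContinuousLinearMap
    ((hα.contDiffAt (mem_extChartAt_target (G w₀))).comp w₀ h1) (h1.fderiv_right (by simp))

theorem extDeriv_vpullback {k : ℕ} {G : W → M} {w₀ : W}
    (hG : ∀ᶠ w in 𝓝 w₀, ContMDiffAt 𝓘(ℝ, W) 𝓘(ℝ, E) ∞ G w) {α : Form E M k} (hα : SmoothForm α) :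
    extDeriv (vpullback G α) w₀ = vpullback G (d α) w₀ := by
  have h1 := contDiffAt_chart_comp hG.self_of_nhds
  have h2 := extDeriv_pullback (𝕜 := ℝ) (f := extChartAt 𝓘(ℝ, E) (G w₀) ∘ G)
    (x := w₀) (hα.differentiableAt (mem_extChartAt_target (G w₀))) h1
    two_le_infty
  refine (vpullback_eventuallyEq hG α).extDeriv_eq.trans (h2.trans ?_)
  have h3 := mfderiv_comp w₀ (mdiffAt_ext (mem_extChartAt_source (I := 𝓘(ℝ, E)) (G w₀)))
    (hG.self_of_nhds.mdifferentiableAt (by simp))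
  rw [mfderiv_eq_fderiv] at h3
  rw [h3]
  rfl

end PullbackToVectorSpace

/-! ### Representatives of forms at the centre of a chart -/

section LocalRepresentatives

variable {E : Type*} [NormedAddCommGroup E] [NormedSpace ℝ E]
  {M : Type*} [TopologicalSpace M] [ChartedSpace E M] [IsManifold 𝓘(ℝ, E) ∞ M]

theorem eq_of_localRep_eq {k : ℕ} {α β : Form E M k} {x : M}
    (h : localRep α x (extChartAt 𝓘(ℝ, E) x x) = localRep β x (extChartAt 𝓘(ℝ, E) x x)) :
    α x = β x := by
  rw [← pullback_localRep α x, ← pullback_localRep β x]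
  ext v
  simp only [pullback_apply, h]

theorem tmap_tmap_symm {x : M} {y : E} (hy : y ∈ (extChartAt 𝓘(ℝ, E) x).target) (v : E) :
    tmap (extChartAt 𝓘(ℝ, E) x) ((extChartAt 𝓘(ℝ, E) x).symm y)
      (tmap (extChartAt 𝓘(ℝ, E) x).symm y v) = v := by
  have hs := (extChartAt 𝓘(ℝ, E) x).map_target hy
  have h1 := tmap_comp (f := extChartAt 𝓘(ℝ, E) x) (g := (extChartAt 𝓘(ℝ, E) x).symm)
    (x := y) (mdiffAt_ext hs) (mdiffAt_symm hy)
  have h2 : (extChartAt 𝓘(ℝ, E) x) ∘ (extChartAt 𝓘(ℝ, E) x).symm =ᶠ[𝓝 y] id := by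
    filter_upwards [target_mem_nhds hy] with u hu
    exact (extChartAt 𝓘(ℝ, E) x).right_inv hu
  rw [tmap_congr h2] at h1
  have h3 := congrArg (fun L : E →L[ℝ] E => L v) h1
  have h4 : tmap (E := E) (id : E → E) y v = v := by
    rw [tmap, mfderiv_id]; rfl
  exact h3.symm.trans h4

/-- At the centre of a chart the representative of `d α` is the exterior derivative of the
representative of `α`. -/
theorem localRep_d {k : ℕ} (α : Form E M k) (x : M) :
    localRep (d α) x (extChartAt 𝓘(ℝ, E) x x) =
      extDeriv (localRep α x) (extChartAt 𝓘(ℝ, E) x x) := by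
  ext v
  have hx := mem_extChartAt_target (I := 𝓘(ℝ, E)) x
  have h1 (w : E) := tmap_tmap_symm hx w
  rw [extChartAt_to_inv] at h1
  rw [localRep, pullback_apply, extChartAt_to_inv, d, pullback_apply]
  simp only [h1]

theorem localRep_wedge {k : ℕ} (η : Form E M 1) (α : Form E M k) (x : M) :
    localRep (wedge η α) x = wedge (localRep η x) (localRep α x) := by
  ext w v
  simp only [localRep, pullback_apply, wedge_apply]
  rfl

end LocalRepresentatives

/-! ### Families of forms and their integrals -/

section FormFamilies

-- The model space lies in `Type` because `contDiffOn_intervalIntegral` wants the parameters, here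
-- products of `ℝ` with the model space, in the universe of the values, which may be real numbers.
variable {E : Type} [NormedAddCommGroup E] [NormedSpace ℝ E] [FiniteDimensional ℝ E]
  {M : Type*} [TopologicalSpace M] [ChartedSpace E M] [IsManifold 𝓘(ℝ, E) ∞ M]
  {Q : Type} [NormedAddCommGroup Q] [NormedSpace ℝ Q]
  {Q' : Type} [NormedAddCommGroup Q'] [NormedSpace ℝ Q']

/-- A family of forms with parameters in `Q` that is smooth jointly in the parameter and the point
of the manifold. -/
def SmoothFormFamily {k : ℕ} (ζ : Q → Form E M k) : Prop :=
  ∀ x : M, ContDiffOn ℝ ∞ (fun w : Q × E => localRep (ζ w.1) x w.2)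
    (Set.univ ×ˢ (extChartAt 𝓘(ℝ, E) x).target)

/-- The form `∫₀¹ ζ_t dt`, computed pointwise. -/
noncomputable def formIntegral {k : ℕ} (ζ : ℝ → Form E M k) : Form E M k := fun x =>
  ∫ t in (0 : ℝ)..1, ζ t x

theorem isOpen_univ_prod_target (x : M) :
    IsOpen (Set.univ ×ˢ (extChartAt 𝓘(ℝ, E) x).target : Set (Q × E)) :=
  isOpen_univ.prod (isOpen_extChartAt_target x)

theorem SmoothFormFamily.comp {k : ℕ} {ζ : Q → Form E M k} (hζ : SmoothFormFamily ζ) {f : Q' → Q}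
    (hf : ContDiff ℝ ∞ f) : SmoothFormFamily (fun q => ζ (f q)) := fun x =>
  (hζ x).comp (f := fun w : Q' × E => (f w.1, w.2))
    ((hf.comp contDiff_fst).prodMk contDiff_snd).contDiffOn fun _ hw => ⟨trivial, hw.2⟩

theorem SmoothFormFamily.smoothForm {k : ℕ} {ζ : Q → Form E M k} (hζ : SmoothFormFamily ζ)
    (q : Q) : SmoothForm (ζ q) := fun x =>
  (hζ x).comp (f := fun y : E => (q, y)) (contDiff_const.prodMk contDiff_id).contDiffOn
    fun _ hy => ⟨trivial, hy⟩

theorem SmoothFormFamily.continuous_localRep {k : ℕ} {ζ : Q → Form E M k}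
    (hζ : SmoothFormFamily ζ) (x : M) {y : E} (hy : y ∈ (extChartAt 𝓘(ℝ, E) x).target) :
    Continuous fun q => localRep (ζ q) x y :=
  continuousOn_univ.1 ((hζ x).continuousOn.comp (f := fun q : Q => (q, y))
    (by fun_prop) fun _ _ => ⟨trivial, hy⟩)

theorem continuous_of_continuous_localRep {k : ℕ} {ζ : Q → Form E M k} {x : M}
    (h : Continuous fun q => localRep (ζ q) x (extChartAt 𝓘(ℝ, E) x x)) :
    Continuous fun q => ζ q x := by
  have h1 : (fun q => ζ q x) = fun q => ContinuousAlternatingMap.compContinuousLinearMapCLM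
      (tmap (extChartAt 𝓘(ℝ, E) x) x) (localRep (ζ q) x (extChartAt 𝓘(ℝ, E) x x)) := by
    funext q; exact (pullback_localRep (ζ q) x).symm
  rw [h1]
  exact (ContinuousLinearMap.continuous _).comp h

theorem SmoothFormFamily.continuous {k : ℕ} {ζ : Q → Form E M k} (hζ : SmoothFormFamily ζ)
    (x : M) : Continuous fun q => ζ q x :=
  continuous_of_continuous_localRep (hζ.continuous_localRep x (mem_extChartAt_target x))

theorem localRep_formIntegral {k : ℕ} {ζ : ℝ → Form E M k} (hζ : ∀ x, Continuous fun t => ζ t x)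
    (x : M) (y : E) :
    localRep (formIntegral ζ) x y = ∫ t in (0 : ℝ)..1, localRep (ζ t) x y :=
  ((ContinuousAlternatingMap.compContinuousLinearMapCLM
    (tmap (extChartAt 𝓘(ℝ, E) x).symm y)).intervalIntegral_comp_comm
      ((hζ _).intervalIntegrable 0 1)).symm

theorem formIntegral_apply {k : ℕ} {ζ : ℝ → Form E M k} {x : M} (hζ : Continuous fun t => ζ t x)
    (v : Fin k → E) : formIntegral ζ x v = ∫ t in (0 : ℝ)..1, ζ t x v :=
  ((ContinuousAlternatingMap.apply ℝ E ℝ v).intervalIntegral_comp_comm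
      (hζ.intervalIntegrable 0 1)).symm

theorem SmoothFormFamily.formIntegral [ProperSpace Q] {k : ℕ} {ζ : ℝ × Q → Form E M k}
    (hζ : SmoothFormFamily ζ) :
    SmoothFormFamily (fun q => formIntegral fun t => ζ (t, q)) := by
  intro x
  have h1 : ContDiffOn ℝ ∞ (fun w : ℝ × (Q × E) => localRep (ζ (w.1, w.2.1)) x w.2.2)
      (Set.univ ×ˢ (Set.univ ×ˢ (extChartAt 𝓘(ℝ, E) x).target)) :=
    (hζ x).comp (f := fun w : ℝ × (Q × E) => ((w.1, w.2.1), w.2.2))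
      (by fun_prop) fun w hw => ⟨trivial, hw.2.2⟩
  refine (contDiffOn_intervalIntegral (isOpen_univ_prod_target x) h1 0 1).congr fun w _ => ?_
  exact localRep_formIntegral (fun z => (hζ.continuous z).comp (by fun_prop)) x w.2

theorem SmoothFormFamily.fderiv_localRep {k : ℕ} {ζ : Q → Form E M k} (hζ : SmoothFormFamily ζ)
    (q : Q) (x : M) {y : E} (hy : y ∈ (extChartAt 𝓘(ℝ, E) x).target) :
    fderiv ℝ (localRep (ζ q) x) y =
      fderiv ℝ (fun w : Q × E => localRep (ζ w.1) x w.2) (q, y) ∘L .inr ℝ Q E :=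
  (((((hζ x).contDiffAt ((isOpen_univ_prod_target x).mem_nhds ⟨trivial, hy⟩)).differentiableAt
    (by simp)).hasFDerivAt).comp y (hasFDerivAt_prodMk_right q y)).fderiv

theorem SmoothFormFamily.continuous_d {k : ℕ} {ζ : Q → Form E M k} (hζ : SmoothFormFamily ζ)
    (x : M) : Continuous fun q => d (ζ q) x := by
  have hx := mem_extChartAt_target (I := 𝓘(ℝ, E)) x
  refine continuous_of_continuous_localRep (ζ := fun q => d (ζ q)) ?_
  simp only [localRep_d, extDeriv, hζ.fderiv_localRep _ x hx]
  refine (ContinuousLinearMap.continuous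
    (ContinuousAlternatingMap.alternatizeUncurryFinCLM ℝ E ℝ)).comp ?_
  refine Continuous.clm_comp ?_ continuous_const
  exact continuousOn_univ.1 (((hζ x).continuousOn_fderiv_of_isOpen (isOpen_univ_prod_target x)
    (by simp)).comp (f := fun q : Q => (q, extChartAt 𝓘(ℝ, E) x x)) (by fun_prop)
      fun _ _ => ⟨trivial, hx⟩)

theorem d_formIntegral {k : ℕ} {ζ : ℝ → Form E M k} (hζ : SmoothFormFamily ζ) :
    d (formIntegral ζ) = formIntegral fun t => d (ζ t) := by
  funext x
  have hx := mem_extChartAt_target (I := 𝓘(ℝ, E)) x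
  refine eq_of_localRep_eq ?_
  rw [localRep_d, localRep_formIntegral hζ.continuous_d]
  have h1 : localRep (formIntegral ζ) x = fun y => ∫ t in (0 : ℝ)..1, localRep (ζ t) x y :=
    funext fun y => localRep_formIntegral hζ.continuous x y
  have h2 := (hasFDerivAt_intervalIntegral_of_contDiffOn (isOpen_extChartAt_target x)
    ((hζ x).of_le (by simp)) hx 0 1).fderiv
  rw [extDeriv, h1, h2]
  simp only [localRep_d, extDeriv, ← hζ.fderiv_localRep _ x hx]
  have h3 : Continuous fun t => fderiv ℝ (localRep (ζ t) x) (extChartAt 𝓘(ℝ, E) x x) := by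
    simp only [hζ.fderiv_localRep _ x hx]
    refine Continuous.clm_comp ?_ continuous_const
    exact continuousOn_univ.1 (((hζ x).continuousOn_fderiv_of_isOpen (isOpen_univ_prod_target x)
      (by simp)).comp (f := fun q : ℝ => (q, extChartAt 𝓘(ℝ, E) x x)) (by fun_prop)
        fun _ _ => ⟨trivial, hx⟩)
  exact (ContinuousLinearMap.intervalIntegral_comp_comm (𝕜 := ℝ) (E := E →L[ℝ] E [⋀^Fin k]→L[ℝ] ℝ)
    (μ := MeasureTheory.volume)
    (F := E [⋀^Fin (k + 1)]→L[ℝ] ℝ)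
    (ContinuousAlternatingMap.alternatizeUncurryFinCLM ℝ E ℝ (n := k))
    (h3.intervalIntegrable 0 1)).symm

/-- The operation `α ↦ η ∧ α` at a point. -/
noncomputable def wedgeCLM (η : E [⋀^Fin 1]→L[ℝ] ℝ) (k : ℕ) :
    E [⋀^Fin k]→L[ℝ] ℝ →L[ℝ] E [⋀^Fin (k + 1)]→L[ℝ] ℝ :=
  ContinuousAlternatingMap.alternatizeUncurryFinCLM ℝ E ℝ ∘L
    ContinuousLinearMap.smulRightL ℝ E (E [⋀^Fin k]→L[ℝ] ℝ)
      ((ContinuousAlternatingMap.ofSubsingleton ℝ E ℝ (0 : Fin 1)).symm η)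

theorem SmoothFormFamily.continuous_twistedD {k : ℕ} {ζ : Q → Form E M k}
    (hζ : SmoothFormFamily ζ) (η : Form E M 1) (x : M) :
    Continuous fun q => twistedD η (ζ q) x :=
  (hζ.continuous_d x).add ((wedgeCLM (η x) k).continuous.comp (hζ.continuous x))

theorem twistedD_formIntegral {k : ℕ} {ζ : ℝ → Form E M k} (hζ : SmoothFormFamily ζ)
    (η : Form E M 1) :
    twistedD η (formIntegral ζ) = formIntegral fun t => twistedD η (ζ t) := by
  funext x
  rw [twistedD, d_formIntegral hζ]
  have h1 : wedge η (formIntegral ζ) x = ∫ t in (0 : ℝ)..1, wedge η (ζ t) x :=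
    ((wedgeCLM (η x) k).intervalIntegral_comp_comm
      ((hζ.continuous x).intervalIntegrable 0 1)).symm
  change formIntegral _ x + wedge η (formIntegral ζ) x = _
  rw [h1]
  exact (intervalIntegral.integral_add ((hζ.continuous_d x).intervalIntegrable 0 1)
    (((wedgeCLM (η x) k).continuous.comp (hζ.continuous x)).intervalIntegrable 0 1)).symm

end FormFamilies

/-! ### Generators of families with several parameters -/

section ParameterFamilies

variable {E : Type*} [NormedAddCommGroup E] [NormedSpace ℝ E]
  {M : Type*} [TopologicalSpace M] [ChartedSpace E M]
  {Q : Type*} [NormedAddCommGroup Q] [NormedSpace ℝ Q]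

/-- The derivative of `q ↦ L_q x` in the direction `τ`, a tangent vector at `L_q x`. -/
noncomputable def velocityAt (L : Q → Diff E M) (q τ : Q) (x : M) : E :=
  mfderiv 𝓘(ℝ, Q) 𝓘(ℝ, E) (fun q => L q x) q τ

/-- The vector field that generates the family `L` in the direction `τ` of the parameters. -/
noncomputable def generatorAt (L : Q → Diff E M) (q τ : Q) : M → E := fun y =>
  velocityAt L q τ ((L q).symm y)

/-- The map `(q, y) ↦ L_q y` in the preferred chart at `x`. -/
noncomputable def chartFamily (L : Q → Diff E M) (x : M) : Q × E → M := fun w =>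
  L w.1 ((extChartAt 𝓘(ℝ, E) x).symm w.2)

variable [IsManifold 𝓘(ℝ, E) ∞ M] {L : Q → Diff E M}

theorem SmoothFamily.mdiffAt_curve (hL : SmoothFamily Q L) (x : M) (q : Q) :
    MDifferentiableAt 𝓘(ℝ, Q) 𝓘(ℝ, E) (fun q => L q x) q :=
  (hL.1.comp (contMDiff_id.prodMk contMDiff_const)).mdifferentiable (by simp) q

theorem SmoothFamily.contMDiffAt_chartFamily (hL : SmoothFamily Q L) {x : M} {w : Q × E}
    (hw : w.2 ∈ (extChartAt 𝓘(ℝ, E) x).target) :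
    ContMDiffAt 𝓘(ℝ, Q × E) 𝓘(ℝ, E) ∞ (chartFamily L x) w := by
  have h1 : ContMDiffAt 𝓘(ℝ, Q × E) (𝓘(ℝ, Q).prod 𝓘(ℝ, E)) ∞
      (fun w : Q × E => (w.1, (extChartAt 𝓘(ℝ, E) x).symm w.2)) w :=
    contDiff_fst.contMDiff.contMDiffAt.prodMk
      ((contMDiffAt_symm hw).comp w contDiff_snd.contMDiff.contMDiffAt)
  exact hL.1.contMDiffAt.comp w h1

theorem SmoothFamily.eventually_contMDiffAt_chartFamily (hL : SmoothFamily Q L) {x : M} {w : Q × E}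
    (hw : w.2 ∈ (extChartAt 𝓘(ℝ, E) x).target) :
    ∀ᶠ u in 𝓝 w, ContMDiffAt 𝓘(ℝ, Q × E) 𝓘(ℝ, E) ∞ (chartFamily L x) u := by
  have h1 : ∀ᶠ u : Q × E in 𝓝 w, u.2 ∈ (extChartAt 𝓘(ℝ, E) x).target :=
    continuousAt_snd.eventually (target_mem_nhds hw)
  filter_upwards [h1] with u hu using hL.contMDiffAt_chartFamily hu

theorem SmoothFamily.mfderiv_prod (hL : SmoothFamily Q L) (q τ : Q) (x : M) (v : E) :
    (mfderiv (𝓘(ℝ, Q).prod 𝓘(ℝ, E)) 𝓘(ℝ, E) (fun p : Q × M => L p.1 p.2) (q, x) (τ, v) : E) =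
      velocityAt L q τ x + tmap (L q) x v :=
  mfderiv_prod_eq_add_apply (v := (τ, v)) (hL.1.mdifferentiable (by simp) (q, x))

/-- The differential of a family in a chart splits into the velocity in the direction of the
parameters and the tangent map of the member of the family. -/
theorem SmoothFamily.vtmap_chartFamily (hL : SmoothFamily Q L) {x : M} {w : Q × E}
    (hw : w.2 ∈ (extChartAt 𝓘(ℝ, E) x).target) (u : Q × E) :
    vtmap (chartFamily L x) w u = velocityAt L w.1 u.1 ((extChartAt 𝓘(ℝ, E) x).symm w.2) +
      tmap (L w.1) ((extChartAt 𝓘(ℝ, E) x).symm w.2) (tmap (extChartAt 𝓘(ℝ, E) x).symm w.2 u.2) := by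
  rw [← hL.mfderiv_prod]
  set φ := extChartAt 𝓘(ℝ, E) x
  have h0 : HasMFDerivAt 𝓘(ℝ, Q × E) 𝓘(ℝ, Q) (Prod.fst : Q × E → Q) w (.fst ℝ Q E) :=
    hasFDerivAt_fst.hasMFDerivAt
  have h1 : HasMFDerivAt 𝓘(ℝ, Q × E) 𝓘(ℝ, E) (fun w : Q × E => φ.symm w.2) w
      (tmap φ.symm w.2 ∘L .snd ℝ Q E : Q × E →L[ℝ] E) :=
    (mdiffAt_symm hw).hasMFDerivAt.comp w (hasFDerivAt_snd (𝕜 := ℝ) (p := w)).hasMFDerivAt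
  have h2 := (hL.1.mdifferentiable (by simp) (w.1, φ.symm w.2)).hasMFDerivAt.comp w (h0.prodMk h1)
  exact congrArg (fun T : Q × E →L[ℝ] E => T u) h2.mfderiv

/-- The velocity of the inverse family, from differentiating `L_q (L_q⁻¹ x) = x`. -/
theorem SmoothFamily.velocityAt_inv (hL : SmoothFamily Q L) (q τ : Q) (x : M) :
    velocityAt L⁻¹ q τ x = -tmap (L⁻¹ q) x (generatorAt L q τ x) := by
  set y := (L⁻¹ q) x with hy
  have hxy : L q y = x := (L q).apply_symm_apply x
  have h1 := (hL.1.mdifferentiable (by simp) (q, y)).hasMFDerivAt.comp q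
    ((hasMFDerivAt_id (I := 𝓘(ℝ, Q)) q).prodMk (hL.inv.mdiffAt_curve x q).hasMFDerivAt)
  have h2 : (fun p : Q × M => L p.1 p.2) ∘ (fun q => (id q, L⁻¹ q x)) = fun _ => x :=
    funext fun q => (L q).apply_symm_apply x
  have h3 := congrArg (fun T : Q →L[ℝ] E => T τ) h1.mfderiv
  have h4 : velocityAt L q τ y + tmap (L q) y (velocityAt L⁻¹ q τ x) = 0 := by
    rw [← hL.mfderiv_prod]
    refine h3.symm.trans ?_
    change mfderiv 𝓘(ℝ, Q) 𝓘(ℝ, E) ((fun p : Q × M => L p.1 p.2) ∘ (fun q => (id q, L⁻¹ q x))) q τ = 0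
    rw [h2, mfderiv_const]; rfl
  have h5 : velocityAt L q τ y = generatorAt L q τ x := rfl
  rw [h5] at h4
  have h7 : tmap (L q) y (velocityAt L⁻¹ q τ x) = -generatorAt L q τ x := eq_neg_of_add_eq_zero_right h4
  have h8 := tmap_symm (L q)⁻¹ y (velocityAt L⁻¹ q τ x)
  have h9 : ((L q)⁻¹).symm y = x := hxy
  rw [h9] at h8
  have h10 : tmap ((L q)⁻¹).symm y (velocityAt L⁻¹ q τ x) = -generatorAt L q τ x := h7
  rw [h10, map_neg] at h8
  exact h8.symm

/-- A curve in the space of parameters yields a path of diffeomorphisms; its generator is the one of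
the family in the direction of the curve. -/
theorem generatorAt_eq_generator {W : Type*} [NormedAddCommGroup W] [NormedSpace ℝ W]
    {L : W → Diff E M} (hL : SmoothFamily W L) {c : ℝ → W} {t : ℝ} {τ : W} (hc : HasDerivAt c τ t) :
    generator (fun s => L (c s)) t = generatorAt L (c t) τ := by
  funext y
  have h1 := (hL.mdiffAt_curve ((L (c t)).symm y) (c t)).hasMFDerivAt.comp t
    hc.hasFDerivAt.hasMFDerivAt
  have h2 := congrArg (fun T : ℝ →L[ℝ] E => T 1) h1.mfderiv
  refine Eq.trans h2 ?_
  have h3 : velocityAt L (c t) ((1 : ℝ) • τ) ((L (c t)).symm y) =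
    velocityAt L (c t) τ ((L (c t)).symm y) := by rw [one_smul]
  exact h3

end ParameterFamilies

/-! ### Primitives of closed 1-forms -/

section HomotopyFormula

variable {V : Type} [NormedAddCommGroup V] [NormedSpace ℝ V]

/-- The linear map `w ↦ w + (u - 1) T(w) e`. If `T e = 1` it multiplies the coordinate `T` by `u`,
and fixes the kernel of `T`. -/
noncomputable def scaleAlong (T : V →L[ℝ] ℝ) (e : V) (u : ℝ) : V →L[ℝ] V :=
  .id ℝ V + (u - 1) • T.smulRight e

theorem scaleAlong_apply (T : V →L[ℝ] ℝ) (e : V) (u : ℝ) (w : V) :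
    scaleAlong T e u w = w + (u - 1) • T w • e := rfl

theorem scaleAlong_one (T : V →L[ℝ] ℝ) (e : V) : scaleAlong T e 1 = .id ℝ V := by
  simp [scaleAlong]

theorem hasDerivAt_scaleAlong (T : V →L[ℝ] ℝ) (e : V) (w : V) (u : ℝ) :
    HasDerivAt (fun u => scaleAlong T e u w) (T w • e) u := by
  simpa [scaleAlong_apply] using
    (((hasDerivAt_id u).sub_const 1).smul_const (T w • e)).const_add w

variable [ProperSpace V] {O : Set V} {A : V → V →L[ℝ] ℝ} {T : V →L[ℝ] ℝ} {e : V}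

theorem contDiffOn_scaleAlong (hTO : ∀ u, ∀ w ∈ O, scaleAlong T e u w ∈ O)
    (hA : ContDiffOn ℝ ∞ A O) :
    ContDiffOn ℝ ∞ (fun p : ℝ × V => T p.2 * A (scaleAlong T e p.1 p.2) e) (Set.univ ×ˢ O) := by
  have h1 : ContDiff ℝ ∞ fun p : ℝ × V => scaleAlong T e p.1 p.2 := by
    simp only [scaleAlong_apply]; fun_prop
  have h2 : ContDiff ℝ ∞ fun p : ℝ × V => T p.2 := by fun_prop
  exact h2.contDiffOn.mul ((hA.comp h1.contDiffOn fun p hp => hTO _ _ hp.2).clm_apply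
    contDiffOn_const)

/-- The integrand of the homotopy formula is a total derivative: by closedness of `A`, the
derivative in `w` of `T(w) A(h_u w) e` is the derivative in `u` of `h_u^* A`, where `h_u` is
`scaleAlong T e u`. -/
theorem hasDerivAt_apply_scaleAlong (hO : IsOpen O) (hTO : ∀ u, ∀ w ∈ O, scaleAlong T e u w ∈ O)
    (hA : ContDiffOn ℝ ∞ A O) (hsymm : ∀ w ∈ O, ∀ a b, fderiv ℝ A w a b = fderiv ℝ A w b a)
    {w : V} (hw : w ∈ O) (a : V) (u : ℝ) :
    HasDerivAt (fun u => A (scaleAlong T e u w) (scaleAlong T e u a))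
      ((fderiv ℝ (fun p : ℝ × V => T p.2 * A (scaleAlong T e p.1 p.2) e) (u, w) ∘L
        .inr ℝ ℝ V) a) u := by
  set f := fun p : ℝ × V => T p.2 * A (scaleAlong T e p.1 p.2) e with hfdef
  have hdA : HasFDerivAt A (fderiv ℝ A (scaleAlong T e u w)) (scaleAlong T e u w) :=
    ((hA.contDiffAt (hO.mem_nhds (hTO u w hw))).differentiableAt (by simp)).hasFDerivAt
  have h2 : HasFDerivAt (fun w => f (u, w)) (fderiv ℝ f (u, w) ∘L .inr ℝ ℝ V) w :=
    ((((contDiffOn_scaleAlong hTO hA).contDiffAt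
      ((isOpen_univ.prod hO).mem_nhds ⟨trivial, hw⟩)).differentiableAt
        (by simp)).hasFDerivAt).comp w (hasFDerivAt_prodMk_right u w)
  have h4 : HasFDerivAt (fun w => A (scaleAlong T e u w) e) (ContinuousLinearMap.apply ℝ ℝ e ∘L
      (fderiv ℝ A (scaleAlong T e u w) ∘L scaleAlong T e u)) w :=
    (ContinuousLinearMap.apply ℝ ℝ e).hasFDerivAt.comp w
      (HasFDerivAt.comp w hdA (scaleAlong T e u).hasFDerivAt)
  have h5 : (fderiv ℝ f (u, w) ∘L .inr ℝ ℝ V) a =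
      T w * fderiv ℝ A (scaleAlong T e u w) (scaleAlong T e u a) e +
        A (scaleAlong T e u w) e * T a :=
    congrArg (fun B : V →L[ℝ] ℝ => B a) (h2.unique (T.hasFDerivAt.mul h4))
  have h6 : HasDerivAt (fun u => A (scaleAlong T e u w))
      (fderiv ℝ A (scaleAlong T e u w) (T w • e)) u :=
    hdA.comp_hasDerivAt u (hasDerivAt_scaleAlong T e w u)
  have h7 := hsymm (scaleAlong T e u w) (hTO u w hw) e (scaleAlong T e u a)
  refine (h6.clm_apply (hasDerivAt_scaleAlong T e a u)).congr_deriv ?_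
  rw [h5, ← h7, map_smul, map_smul, smul_apply, smul_eq_mul, smul_eq_mul]
  ring

/-- A closed 1-form differs from its pullback under `scaleAlong T e 0` by the differential of its
integral over segments in the direction `e`. -/
theorem hasFDerivAt_integral_scaleAlong (hO : IsOpen O)
    (hTO : ∀ u, ∀ w ∈ O, scaleAlong T e u w ∈ O)
    (hA : ContDiffOn ℝ ∞ A O) (hsymm : ∀ w ∈ O, ∀ a b, fderiv ℝ A w a b = fderiv ℝ A w b a)
    {w : V} (hw : w ∈ O) :
    HasFDerivAt (fun w => ∫ u in (0 : ℝ)..1, T w * A (scaleAlong T e u w) e)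
      (A w - A (scaleAlong T e 0 w) ∘L scaleAlong T e 0) w := by
  have hf := contDiffOn_scaleAlong hTO hA
  have h1 := hasFDerivAt_intervalIntegral_of_contDiffOn hO (hf.of_le (by simp)) hw 0 1
  have hcont : Continuous fun u : ℝ =>
      fderiv ℝ (fun p : ℝ × V => T p.2 * A (scaleAlong T e p.1 p.2) e) (u, w) ∘L .inr ℝ ℝ V := by
    refine Continuous.clm_comp ?_ continuous_const
    exact continuousOn_univ.1 ((hf.continuousOn_fderiv_of_isOpen (isOpen_univ.prod hO)
      (by simp)).comp (f := fun u : ℝ => (u, w)) (by fun_prop) fun _ _ => ⟨trivial, hw⟩)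
  refine h1.congr_fderiv ?_
  ext1 a
  rw [ContinuousLinearMap.intervalIntegral_apply (hcont.intervalIntegrable 0 1)]
  rw [intervalIntegral.integral_eq_sub_of_hasDerivAt
    (fun u _ => hasDerivAt_apply_scaleAlong hO hTO hA hsymm hw a u)
    ((hcont.clm_apply continuous_const).intervalIntegrable 0 1), scaleAlong_one]
  rfl

end HomotopyFormula

/-! ### Forms of low degree on normed spaces -/

section OneForms

variable {V : Type*} [NormedAddCommGroup V] [NormedSpace ℝ V]

/-- A 1-form on a normed space as a map into the dual space. -/
noncomputable def toDual (α : Form V V 1) : V → V →L[ℝ] ℝ := fun w =>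
  (ContinuousAlternatingMap.ofSubsingletonLIE (𝕜 := ℝ) (E := V) (F := ℝ) (0 : Fin 1)).symm (α w)

theorem toDual_apply (α : Form V V 1) (w a : V) : toDual α w a = α w (fun _ => a) := rfl

theorem contDiffOn_toDual {α : Form V V 1} {O : Set V} (hα : ContDiffOn ℝ ∞ α O) :
    ContDiffOn ℝ ∞ (toDual α) O :=
  (LinearIsometryEquiv.contDiff _).comp_contDiffOn hα

theorem fderiv_toDual {α : Form V V 1} {w : V} (hα : DifferentiableAt ℝ α w) (a b : V) :
    fderiv ℝ (toDual α) w a b = fderiv ℝ α w a (fun _ => b) := by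
  have h1 : HasFDerivAt (toDual α) _ w :=
    (ContinuousAlternatingMap.ofSubsingletonLIE (𝕜 := ℝ) (E := V) (F := ℝ)
      (0 : Fin 1)).symm.toContinuousLinearEquiv.toContinuousLinearMap.hasFDerivAt.comp w
        hα.hasFDerivAt
  rw [h1.fderiv]
  rfl

theorem fderiv_form_apply {k : ℕ} {α : Form V V k} {w : V} (hα : DifferentiableAt ℝ α w) (a : V)
    (v : Fin k → V) : fderiv ℝ (fun w => α w v) w a = fderiv ℝ α w a v :=
  congrArg (fun B : V →L[ℝ] ℝ => B a)
    ((ContinuousAlternatingMap.apply ℝ V ℝ v).hasFDerivAt.comp w hα.hasFDerivAt).fderiv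

theorem extDeriv_one_apply {α : Form V V 1} {w : V} (hα : DifferentiableAt ℝ α w) (a b : V) :
    extDeriv α w ![a, b] = fderiv ℝ α w a (fun _ => b) - fderiv ℝ α w b (fun _ => a) := by
  rw [extDeriv_apply hα, Fin.sum_univ_two]
  have h1 : (0 : Fin 2).removeNth ![a, b] = fun _ => b := by
    funext i; fin_cases i; rfl
  have h2 : (1 : Fin 2).removeNth ![a, b] = fun _ => a := by
    funext i; fin_cases i; rfl
  simp [h1, h2, sub_eq_add_neg, fderiv_form_apply hα]

theorem extDeriv_two_apply {α : Form V V 2} {w : V} (hα : DifferentiableAt ℝ α w) (a b c : V) :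
    extDeriv α w ![a, b, c] = fderiv ℝ α w a ![b, c] - fderiv ℝ α w b ![a, c] +
      fderiv ℝ α w c ![a, b] := by
  rw [extDeriv_apply hα, Fin.sum_univ_three]
  have h1 : (0 : Fin 3).removeNth ![a, b, c] = ![b, c] := by
    funext i; fin_cases i <;> rfl
  have h2 : (1 : Fin 3).removeNth ![a, b, c] = ![a, c] := by
    funext i; fin_cases i <;> rfl
  have h3 : (2 : Fin 3).removeNth ![a, b, c] = ![a, b] := by
    funext i; fin_cases i <;> rfl
  simp [h1, h2, h3, sub_eq_add_neg, fderiv_form_apply hα]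

theorem wedge_one_apply (η α : Form V V 1) (w a b : V) :
    wedge η α w ![a, b] = η w (fun _ => a) * α w (fun _ => b) - η w (fun _ => b) * α w (fun _ => a) := by
  rw [wedge_apply, Fin.sum_univ_two]
  have h1 : (0 : Fin 2).removeNth ![a, b] = fun _ => b := by
    funext i; fin_cases i; rfl
  have h2 : (1 : Fin 2).removeNth ![a, b] = fun _ => a := by
    funext i; fin_cases i; rfl
  simp [h1, h2, sub_eq_add_neg]

theorem wedge_two_apply (η : Form V V 1) (α : Form V V 2) (w a b c : V) :
    wedge η α w ![a, b, c] = η w (fun _ => a) * α w ![b, c] - η w (fun _ => b) * α w ![a, c] +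
      η w (fun _ => c) * α w ![a, b] := by
  rw [wedge_apply, Fin.sum_univ_three]
  have h1 : (0 : Fin 3).removeNth ![a, b, c] = ![b, c] := by
    funext i; fin_cases i <;> rfl
  have h2 : (1 : Fin 3).removeNth ![a, b, c] = ![a, c] := by
    funext i; fin_cases i <;> rfl
  have h3 : (2 : Fin 3).removeNth ![a, b, c] = ![a, b] := by
    funext i; fin_cases i <;> rfl
  simp [h1, h2, h3, sub_eq_add_neg]

end OneForms

/-! ### The conformal factor of a family -/

section Gauge

variable {E : Type} [NormedAddCommGroup E] [NormedSpace ℝ E]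
  {M : Type*} [TopologicalSpace M] [ChartedSpace E M]

/-- The logarithm of the conformal factor of a two-parameter family `L_{s,t}` with `L_{s,0} = id`:
the integral of the Lee form along the curves `t ↦ L_{s,t} x`, see `hasFDerivAt_gaugeLog`. -/
noncomputable def gaugeLog (S : LCSStructure E M) (L : ℝ × ℝ → Diff E M) (q : ℝ × ℝ) (x : M) : ℝ :=
  ∫ u in (0 : ℝ)..1, q.2 * S.lee (L (q.1, u * q.2) x)
    (fun _ => velocityAt L (q.1, u * q.2) (0, 1) x)

/-- The function `gaugeLog` in the preferred chart at `x`. -/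
noncomputable def gaugeRep (S : LCSStructure E M) (L : ℝ × ℝ → Diff E M) (x : M)
    (w : (ℝ × ℝ) × E) : ℝ := gaugeLog S L w.1 ((extChartAt 𝓘(ℝ, E) x).symm w.2)

/-- The coordinate `t` of `((s, t), y)`. -/
noncomputable def timeCoord (E : Type) [NormedAddCommGroup E] [NormedSpace ℝ E] :
    (ℝ × ℝ) × E →L[ℝ] ℝ := .snd ℝ ℝ ℝ ∘L .fst ℝ (ℝ × ℝ) E

theorem scaleAlong_timeCoord (u : ℝ) (w : (ℝ × ℝ) × E) :
    scaleAlong (timeCoord E) ((0, 1), 0) u w = ((w.1.1, u * w.1.2), w.2) := by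
  have h : w.1.2 + (u - 1) * w.1.2 = u * w.1.2 := by ring
  ext <;> simp [scaleAlong_apply, timeCoord, h]

variable [IsManifold 𝓘(ℝ, E) ∞ M]

theorem SmoothFamily.contDiffOn_vpullback {Q : Type*} [NormedAddCommGroup Q] [NormedSpace ℝ Q]
    {L : Q → Diff E M} (hL : SmoothFamily Q L) {k : ℕ} {α : Form E M k} (hα : SmoothForm α) (x : M) :
    ContDiffOn ℝ ∞ (vpullback (chartFamily L x) α)
      (Set.univ ×ˢ (extChartAt 𝓘(ℝ, E) x).target) := fun _ hw =>
  (contDiffAt_vpullback (hL.eventually_contMDiffAt_chartFamily hw.2) hα).contDiffWithinAt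

theorem SmoothFamily.extDeriv_vpullback {Q : Type*} [NormedAddCommGroup Q] [NormedSpace ℝ Q]
    {L : Q → Diff E M} (hL : SmoothFamily Q L) {k : ℕ} {α : Form E M k} (hα : SmoothForm α) {x : M}
    {w : Q × E} (hw : w.2 ∈ (extChartAt 𝓘(ℝ, E) x).target) :
    extDeriv (vpullback (chartFamily L x) α) w = vpullback (chartFamily L x) (d α) w :=
  LCS.extDeriv_vpullback (hL.eventually_contMDiffAt_chartFamily hw) hα

/-- Restricted to the directions tangent to `M`, the pullback by a family is the pullback by its
members. -/
theorem SmoothFamily.vpullback_inr {Q : Type*} [NormedAddCommGroup Q] [NormedSpace ℝ Q]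
    {L : Q → Diff E M} (hL : SmoothFamily Q L) {k : ℕ} (α : Form E M k) {x : M}
    {w : Q × E} (hw : w.2 ∈ (extChartAt 𝓘(ℝ, E) x).target) (v : Fin k → E) :
    vpullback (chartFamily L x) α w (fun i => (0, v i)) = localRep (pullback (L w.1) α) x w.2 v := by
  rw [vpullback_apply]
  refine congrArg (α (chartFamily L x w)) (funext fun i => ?_)
  rw [hL.vtmap_chartFamily hw]
  have h1 : velocityAt L w.1 0 ((extChartAt 𝓘(ℝ, E) x).symm w.2) = 0 := map_zero _
  rw [h1, zero_add]
  rfl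

variable [FiniteDimensional ℝ E] {S : LCSStructure E M} {L : ℝ × ℝ → Diff E M}

theorem gaugeRep_eq (hL : SmoothFamily (ℝ × ℝ) L) {x : M} {w : (ℝ × ℝ) × E}
    (hw : w.2 ∈ (extChartAt 𝓘(ℝ, E) x).target) :
    gaugeRep S L x w = ∫ u in (0 : ℝ)..1, timeCoord E w * toDual (vpullback (chartFamily L x) S.lee)
      (scaleAlong (timeCoord E) ((0, 1), 0) u w) ((0, 1), 0) := by
  refine intervalIntegral.integral_congr fun u _ => ?_
  simp only [scaleAlong_timeCoord, toDual_apply, vpullback_apply]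
  rw [hL.vtmap_chartFamily (w := ((w.1.1, u * w.1.2), w.2)) hw]
  simp only [map_zero, add_zero]
  rfl

theorem mapsTo_scaleAlong (x : M) (u : ℝ) :
    ∀ w ∈ (Set.univ ×ˢ (extChartAt 𝓘(ℝ, E) x).target : Set ((ℝ × ℝ) × E)),
      scaleAlong (timeCoord E) ((0, 1), 0) u w ∈
        (Set.univ ×ˢ (extChartAt 𝓘(ℝ, E) x).target : Set ((ℝ × ℝ) × E)) := by
  intro w hw
  rw [scaleAlong_timeCoord]
  exact ⟨trivial, hw.2⟩

theorem contDiffOn_gaugeRep (hL : SmoothFamily (ℝ × ℝ) L) (x : M) :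
    ContDiffOn ℝ ∞ (gaugeRep S L x) (Set.univ ×ˢ (extChartAt 𝓘(ℝ, E) x).target) :=
  (contDiffOn_intervalIntegral (isOpen_univ_prod_target x) (contDiffOn_scaleAlong
    (mapsTo_scaleAlong x) (contDiffOn_toDual (hL.contDiffOn_vpullback S.smooth_lee x))) 0 1).congr
      fun _ hw => gaugeRep_eq hL hw.2

theorem fderiv_vpullback_lee_comm (hL : SmoothFamily (ℝ × ℝ) L) {x : M} {w : (ℝ × ℝ) × E}
    (hw : w.2 ∈ (extChartAt 𝓘(ℝ, E) x).target) (a b : (ℝ × ℝ) × E) :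
    fderiv ℝ (toDual (vpullback (chartFamily L x) S.lee)) w a b =
      fderiv ℝ (toDual (vpullback (chartFamily L x) S.lee)) w b a := by
  have h1 : DifferentiableAt ℝ (vpullback (chartFamily L x) S.lee) w :=
    (contDiffAt_vpullback (hL.eventually_contMDiffAt_chartFamily hw)
      S.smooth_lee).differentiableAt (by simp)
  have h2 := extDeriv_one_apply h1 a b
  rw [hL.extDeriv_vpullback S.smooth_lee hw, S.closed_lee] at h2
  rw [fderiv_toDual h1, fderiv_toDual h1]
  have h3 : vpullback (chartFamily L x) (0 : Form E M 2) w ![a, b] = 0 := rfl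
  rw [h3] at h2
  linarith

/-- The pullback of the Lee form by a family that is the identity at time `0` is `ω + d g`, where
`g` is `gaugeLog`; here all parameters of the family count as variables. -/
theorem hasFDerivAt_gaugeRep (hL : SmoothFamily (ℝ × ℝ) L) (h0 : ∀ s, L (s, 0) = 1) {x : M}
    {w : (ℝ × ℝ) × E} (hw : w.2 ∈ (extChartAt 𝓘(ℝ, E) x).target) :
    HasFDerivAt (gaugeRep S L x) (toDual (vpullback (chartFamily L x) S.lee) w -
      toDual (localRep S.lee x) w.2 ∘L .snd ℝ (ℝ × ℝ) E) w := by
  have h1 := hasFDerivAt_integral_scaleAlong (isOpen_univ_prod_target x) (mapsTo_scaleAlong x)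
    (contDiffOn_toDual (hL.contDiffOn_vpullback S.smooth_lee x))
    (fun w hw => fderiv_vpullback_lee_comm hL hw.2) (w := w) ⟨trivial, hw⟩
  -- At `t = 0` the family is the identity, so that its velocity in the direction of `s` vanishes.
  have h2 : toDual (vpullback (chartFamily L x) S.lee)
      (scaleAlong (timeCoord E) ((0, 1), 0) 0 w) ∘L scaleAlong (timeCoord E) ((0, 1), 0) 0 =
      toDual (localRep S.lee x) w.2 ∘L .snd ℝ (ℝ × ℝ) E := by
    refine ContinuousLinearMap.ext fun a => ?_
    simp only [ContinuousLinearMap.comp_apply, scaleAlong_timeCoord, zero_mul, toDual_apply]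
    have h3 : velocityAt L (w.1.1, 0) (a.1.1, 0) ((extChartAt 𝓘(ℝ, E) x).symm w.2) = 0 := by
      have h4 : HasDerivAt (fun s : ℝ => ((w.1.1 + s * a.1.1, 0) : ℝ × ℝ)) (a.1.1, 0) 0 := by
        have := (((hasDerivAt_id (0 : ℝ)).mul_const a.1.1).const_add w.1.1).prodMk
          (hasDerivAt_const (0 : ℝ) (0 : ℝ))
        simpa using this
      have h5 := generatorAt_eq_generator hL h4
      have h6 : (fun s : ℝ => L (w.1.1 + s * a.1.1, 0)) = 1 := funext fun s => h0 _
      rw [h6, generator_one, zero_mul, add_zero] at h5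
      have h7 := congrFun h5 ((extChartAt 𝓘(ℝ, E) x).symm w.2)
      have h8 : (L (w.1.1, 0)).symm ((extChartAt 𝓘(ℝ, E) x).symm w.2) =
          (extChartAt 𝓘(ℝ, E) x).symm w.2 := by rw [h0]; rfl
      rw [generatorAt, h8] at h7
      exact h7.symm
    have h9 : vtmap (chartFamily L x) ((w.1.1, 0), w.2) ((a.1.1, 0), a.2) =
        tmap (extChartAt 𝓘(ℝ, E) x).symm w.2 a.2 := by
      rw [hL.vtmap_chartFamily (w := ((w.1.1, 0), w.2)) hw, h3, zero_add, h0, tmap, coe_one, mfderiv_id]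
      rfl
    rw [vpullback_apply, h9]
    have h10 : chartFamily L x ((w.1.1, 0), w.2) = (extChartAt 𝓘(ℝ, E) x).symm w.2 := by
      rw [chartFamily, h0]; rfl
    rw [h10]
    rfl
  rw [h2] at h1
  refine h1.congr_of_eventuallyEq ?_
  filter_upwards [(isOpen_univ_prod_target x).mem_nhds ⟨trivial, hw⟩] with z hz
  exact gaugeRep_eq hL hz.2

end Gauge

/-! ### The Lee form and the twisted differential under a family -/

section GaugeForms

variable {E : Type} [NormedAddCommGroup E] [NormedSpace ℝ E] [FiniteDimensional ℝ E]
  {M : Type*} [TopologicalSpace M] [ChartedSpace E M] [IsManifold 𝓘(ℝ, E) ∞ M]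
  {S : LCSStructure E M} {L : ℝ × ℝ → Diff E M}

theorem smoothForm_fn_gaugeLog (hL : SmoothFamily (ℝ × ℝ) L) (q : ℝ × ℝ) :
    SmoothForm (fn (gaugeLog S L q) : Form E M 0) := by
  intro x
  rw [localRep_fn]
  refine (ContinuousAlternatingMap.constOfIsEmptyLIE ℝ E ℝ (Fin 0)).contDiff.comp_contDiffOn ?_
  exact (contDiffOn_gaugeRep hL x).comp (f := fun y : E => (q, y))
    (contDiff_const.prodMk contDiff_id).contDiffOn fun _ hy => ⟨trivial, hy⟩

theorem contMDiff_gaugeLog (hL : SmoothFamily (ℝ × ℝ) L) (q : ℝ × ℝ) :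
    ContMDiff 𝓘(ℝ, E) 𝓘(ℝ, ℝ) ∞ (gaugeLog S L q) :=
  contMDiff_of_smoothForm_fn (smoothForm_fn_gaugeLog hL q)

theorem localRep_d_fn (f : M → ℝ) (x : M) (v : E) :
    localRep (d (fn f : Form E M 0)) x (extChartAt 𝓘(ℝ, E) x x) (fun _ => v) =
      fderiv ℝ (f ∘ (extChartAt 𝓘(ℝ, E) x).symm) (extChartAt 𝓘(ℝ, E) x x) v := by
  rw [localRep_d, localRep_fn]
  unfold fn
  rw [extDeriv_constOfIsEmpty]
  rfl

/-- The members of a smooth family starting at the identity preserve the Lee form up to the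
differential of `gaugeLog`. -/
theorem pullback_lee (hL : SmoothFamily (ℝ × ℝ) L) (h0 : ∀ s, L (s, 0) = 1) (q : ℝ × ℝ) :
    pullback (L q) S.lee = S.lee + d (fn (gaugeLog S L q)) := by
  funext x
  refine eq_of_localRep_eq ?_
  have hx := mem_extChartAt_target (I := 𝓘(ℝ, E)) x
  set y := extChartAt 𝓘(ℝ, E) x x
  have h1 := hasFDerivAt_gaugeRep (S := S) hL h0 (w := (q, y)) hx
  have h2 := (h1.comp y (hasFDerivAt_prodMk_right q y)).fderiv
  ext v
  have hv : v = fun _ => v 0 := funext fun i => by rw [Subsingleton.elim i 0]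
  rw [localRep_add, hv]
  change _ = localRep S.lee x y _ + localRep (d (fn (gaugeLog S L q))) x y _
  rw [localRep_d_fn]
  have h3 : gaugeLog S L q ∘ (extChartAt 𝓘(ℝ, E) x).symm = gaugeRep S L x ∘ fun y => (q, y) := rfl
  rw [h3, h2, ← hL.vpullback_inr S.lee (w := (q, y)) hx]
  simp only [ContinuousLinearMap.comp_apply, sub_apply, toDual_apply,
    ContinuousLinearMap.inr_apply, ContinuousLinearMap.coe_snd']
  ring

/-- If `f^* ω = ω + d h`, then `β ↦ e^h f^* β` commutes with the twisted differential. -/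
theorem twistedD_exp_pullback {f : Diff E M} {h : M → ℝ} (hh : ContMDiff 𝓘(ℝ, E) 𝓘(ℝ, ℝ) ∞ h)
    (hf : pullback f S.lee = S.lee + d (fn h)) {β : Form E M 1} (hβ : SmoothForm β) :
    twistedD S.lee (fun x => Real.exp (h x) • pullback f β x) =
      fun x => Real.exp (h x) • pullback f (twistedD S.lee β) x := by
  have hexp : ContMDiff 𝓘(ℝ, E) 𝓘(ℝ, ℝ) ∞ (fun x => Real.exp (h x)) := fun x =>
    Real.contDiff_exp.contDiffAt.contMDiffAt.comp x (hh x)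
  rw [twistedD, d_fun_smul hexp (hβ.pullback f.contMDiff), d_exp hh, d_pullback f.contMDiff hβ,
    twistedD, pullback_add, pullback_wedge, hf]
  ext x v
  simp only [Pi.add_apply, ContinuousAlternatingMap.add_apply, wedge_apply,
    ContinuousAlternatingMap.smul_apply, smul_eq_mul]
  have h9 (F : Fin (1 + 1) → ℝ) : ∑ i, F i = F 0 + F 1 := Fin.sum_univ_two F
  simp only [h9]
  ring

theorem smoothForm_exp_pullback {f : Diff E M} {h : M → ℝ} (hh : ContMDiff 𝓘(ℝ, E) 𝓘(ℝ, ℝ) ∞ h)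
    {β : Form E M 1} (hβ : SmoothForm β) :
    SmoothForm (fun x => Real.exp (h x) • pullback f β x) := by
  have hexp : ContMDiff 𝓘(ℝ, E) 𝓘(ℝ, ℝ) ∞ (fun x => Real.exp (h x)) := fun x =>
    Real.contDiff_exp.contDiffAt.contMDiffAt.comp x (hh x)
  intro x
  exact (contMDiffOn_iff_contDiffOn.1 (hexp.comp_contMDiffOn (contMDiffOn_extChartAt_symm x))).smul
    (hβ.pullback f.contMDiff x)

end GaugeForms

/-! ### The conformally rescaled pullback of the 2-form -/

section TwistedPullback

variable {E : Type} [NormedAddCommGroup E] [NormedSpace ℝ E]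
  {M : Type*} [TopologicalSpace M] [ChartedSpace E M]

/-- The form `e^g D^* Ω`, where `D` is the family `L` in the preferred chart at `x` and `g` is the
logarithm of its conformal factor. -/
noncomputable def twistedPullback (S : LCSStructure E M) (L : ℝ × ℝ → Diff E M) (x : M) :
    Form ((ℝ × ℝ) × E) ((ℝ × ℝ) × E) 2 := fun w =>
  Real.exp (gaugeRep S L x w) • vpullback (chartFamily L x) S.Ω w

variable [FiniteDimensional ℝ E] [IsManifold 𝓘(ℝ, E) ∞ M]
  {S : LCSStructure E M} {L : ℝ × ℝ → Diff E M}

theorem contDiffOn_twistedPullback (hL : SmoothFamily (ℝ × ℝ) L) (x : M) :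
    ContDiffOn ℝ ∞ (twistedPullback S L x) (Set.univ ×ˢ (extChartAt 𝓘(ℝ, E) x).target) :=
  (Real.contDiff_exp.comp_contDiffOn (contDiffOn_gaugeRep hL x)).smul
    (hL.contDiffOn_vpullback S.smooth_Ω x)

theorem differentiableAt_twistedPullback (hL : SmoothFamily (ℝ × ℝ) L) {x : M}
    {w : (ℝ × ℝ) × E} (hw : w.2 ∈ (extChartAt 𝓘(ℝ, E) x).target) :
    DifferentiableAt ℝ (twistedPullback S L x) w :=
  ((contDiffOn_twistedPullback hL x).contDiffAt
    ((isOpen_univ_prod_target x).mem_nhds ⟨trivial, hw⟩)).differentiableAt (by simp)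

/-- The form `C = e^g D^* Ω` satisfies `d C + ω ∧ C = 0`. -/
theorem twistedPullback_closed (hL : SmoothFamily (ℝ × ℝ) L) (h0 : ∀ s, L (s, 0) = 1) {x : M}
    {w : (ℝ × ℝ) × E} (hw : w.2 ∈ (extChartAt 𝓘(ℝ, E) x).target) (a b c : (ℝ × ℝ) × E) :
    fderiv ℝ (twistedPullback S L x) w a ![b, c] - fderiv ℝ (twistedPullback S L x) w b ![a, c] +
      fderiv ℝ (twistedPullback S L x) w c ![a, b] +
      (localRep S.lee x w.2 (fun _ => a.2) * twistedPullback S L x w ![b, c] -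
        localRep S.lee x w.2 (fun _ => b.2) * twistedPullback S L x w ![a, c] +
        localRep S.lee x w.2 (fun _ => c.2) * twistedPullback S L x w ![a, b]) = 0 := by
  have hB : DifferentiableAt ℝ (vpullback (chartFamily L x) S.Ω) w :=
    (contDiffAt_vpullback (hL.eventually_contMDiffAt_chartFamily hw)
      S.smooth_Ω).differentiableAt (by simp)
  have h1 := extDeriv_two_apply hB a b c
  rw [hL.extDeriv_vpullback S.smooth_Ω hw, S.d_Ω] at h1
  have h2 : vpullback (chartFamily L x) (-wedge S.lee S.Ω) w ![a, b, c] =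
      -wedge (vpullback (chartFamily L x) S.lee) (vpullback (chartFamily L x) S.Ω) w ![a, b, c] := by
    rw [← vpullback_wedge]; rfl
  rw [h2, wedge_two_apply] at h1
  have hg := hasFDerivAt_gaugeRep (S := S) hL h0 hw
  -- The product rule, with `d g = D^* ω - ω`.
  have h3 (u : (ℝ × ℝ) × E) (v : Fin 2 → (ℝ × ℝ) × E) :
      fderiv ℝ (twistedPullback S L x) w u v = Real.exp (gaugeRep S L x w) *
        fderiv ℝ (vpullback (chartFamily L x) S.Ω) w u v + Real.exp (gaugeRep S L x w) *
        (vpullback (chartFamily L x) S.lee w (fun _ => u) - localRep S.lee x w.2 (fun _ => u.2)) *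
          vpullback (chartFamily L x) S.Ω w v := by
    have h4 := (hg.exp.smul hB.hasFDerivAt).fderiv
    have h5 := congrArg (fun T : (ℝ × ℝ) × E →L[ℝ] ((ℝ × ℝ) × E) [⋀^Fin 2]→L[ℝ] ℝ => T u v) h4
    refine h5.trans ?_
    rfl
  have h6 (v : Fin 2 → (ℝ × ℝ) × E) : twistedPullback S L x w v =
    Real.exp (gaugeRep S L x w) * vpullback (chartFamily L x) S.Ω w v := rfl
  simp only [h3, h6]
  linear_combination (-Real.exp (gaugeRep S L x w)) * h1

/-- The derivative along `M` of a component of a form on `Q × E`. -/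
theorem fderiv_slice {Q : Type*} [NormedAddCommGroup Q] [NormedSpace ℝ Q] {k : ℕ}
    {C : Form (Q × E) (Q × E) k} {q : Q} {y : E} (hC : DifferentiableAt ℝ C (q, y)) (v : E)
    (u : Fin k → Q × E) :
    fderiv ℝ (fun y => C (q, y) u) y v = fderiv ℝ C (q, y) (0, v) u :=
  congrArg (fun B : E →L[ℝ] ℝ => B v) (((ContinuousAlternatingMap.apply ℝ (Q × E) ℝ u).hasFDerivAt.comp
    (q, y) hC.hasFDerivAt).comp y (hasFDerivAt_prodMk_right q y)).fderiv

/-- The components of `e^g D^* Ω` in terms of velocities and tangent maps of the family. -/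
theorem twistedPullback_eq (hL : SmoothFamily (ℝ × ℝ) L) {x : M}
    {w : (ℝ × ℝ) × E} (hw : w.2 ∈ (extChartAt 𝓘(ℝ, E) x).target) (a b : (ℝ × ℝ) × E) :
    twistedPullback S L x w ![a, b] =
      Real.exp (gaugeLog S L w.1 ((extChartAt 𝓘(ℝ, E) x).symm w.2)) *
        S.Ω (L w.1 ((extChartAt 𝓘(ℝ, E) x).symm w.2))
        ![velocityAt L w.1 a.1 ((extChartAt 𝓘(ℝ, E) x).symm w.2) +
            tmap (L w.1) ((extChartAt 𝓘(ℝ, E) x).symm w.2) (tmap (extChartAt 𝓘(ℝ, E) x).symm w.2 a.2),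
          velocityAt L w.1 b.1 ((extChartAt 𝓘(ℝ, E) x).symm w.2) +
            tmap (L w.1) ((extChartAt 𝓘(ℝ, E) x).symm w.2)
              (tmap (extChartAt 𝓘(ℝ, E) x).symm w.2 b.2)] := by
  rw [← hL.vtmap_chartFamily hw, ← hL.vtmap_chartFamily hw]
  change _ * vpullback (chartFamily L x) S.Ω w ![a, b] = _
  rw [vpullback_apply]
  congr 2
  funext i
  fin_cases i <;> rfl

theorem velocityAt_zero {Q : Type*} [NormedAddCommGroup Q] [NormedSpace ℝ Q] (L : Q → Diff E M)
    (q : Q) (x : M) : velocityAt L q 0 x = 0 := map_zero _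

end TwistedPullback

/-! ### Families generated by `ker Φ` are conformal -/

section ConformalFactor

variable {E : Type} [NormedAddCommGroup E] [NormedSpace ℝ E] [FiniteDimensional ℝ E]
  {M : Type*} [TopologicalSpace M] [ChartedSpace E M] [IsManifold 𝓘(ℝ, E) ∞ M]
  {S : LCSStructure E M} {L : ℝ × ℝ → Diff E M}

theorem velocityAt_eq_generatorAt {Q : Type*} [NormedAddCommGroup Q] [NormedSpace ℝ Q]
    (L : Q → Diff E M) (q τ : Q) (x : M) : velocityAt L q τ x = generatorAt L q τ (L q x) := by
  rw [generatorAt, (L q).symm_apply_apply]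

theorem hasDerivAt_row (s t : ℝ) : HasDerivAt (fun t : ℝ => (s, t)) ((0, 1) : ℝ × ℝ) t :=
  (hasDerivAt_const t s).prodMk (hasDerivAt_id t)

theorem hasDerivAt_column (s t : ℝ) : HasDerivAt (fun s : ℝ => (s, t)) ((1, 0) : ℝ × ℝ) s :=
  (hasDerivAt_id s).prodMk (hasDerivAt_const s t)

theorem SmoothFamily.generator_row (hL : SmoothFamily (ℝ × ℝ) L) (s t : ℝ) :
    generator (fun t => L (s, t)) t = generatorAt L (s, t) (0, 1) :=
  generatorAt_eq_generator hL (hasDerivAt_row s t)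

theorem SmoothFamily.generator_column (hL : SmoothFamily (ℝ × ℝ) L) (s t : ℝ) :
    generator (fun s => L (s, t)) s = generatorAt L (s, t) (1, 0) :=
  generatorAt_eq_generator hL (hasDerivAt_column s t)

theorem SmoothFamily.row (hL : SmoothFamily (ℝ × ℝ) L) (s : ℝ) :
    SmoothFamily ℝ (fun t => L (s, t)) :=
  hL.comp (f := fun t : ℝ => (s, t)) (by fun_prop)

theorem iprod_apply_one (X : M → E) (α : Form E M 2) (x : M) (v : E) :
    iprod X α x (fun _ => v) = α x ![X x, v] := by
  change α x (Fin.cons (X x) fun _ => v) = _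
  congr 1
  funext i
  fin_cases i <;> rfl

theorem gaugeLog_zero (L : ℝ × ℝ → Diff E M) (s : ℝ) (x : M) : gaugeLog S L (s, 0) x = 0 := by
  simp [gaugeLog]

theorem localRep_twistedD {k : ℕ} (η : Form E M 1) (α : Form E M k) (x : M) :
    localRep (twistedD η α) x (extChartAt 𝓘(ℝ, E) x x) =
      extDeriv (localRep α x) (extChartAt 𝓘(ℝ, E) x x) +
        wedge (localRep η x) (localRep α x) (extChartAt 𝓘(ℝ, E) x x) := by
  rw [twistedD, localRep_add, Pi.add_apply, localRep_d, localRep_wedge]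

/-- The conformal factor of a family with generators in `ker Φ`. The `t`-derivative of
`e^g L_{s,t}^* Ω` is the twisted differential of the form `e^g L_{s,t}^* (i_X Ω)`, which is a
twisted cocycle because `i_X Ω` is one. -/
theorem exp_gaugeLog_smul_pullback (hL : SmoothFamily (ℝ × ℝ) L) (h0 : ∀ s, L (s, 0) = 1)
    (hker : ∀ s t, twistedD S.lee (iprod (generator (fun t => L (s, t)) t) S.Ω) = 0)
    (q : ℝ × ℝ) (x : M) :
    Real.exp (gaugeLog S L q x) • pullback (L q) S.Ω x = S.Ω x := by
  have hx := mem_extChartAt_target (I := 𝓘(ℝ, E)) x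
  set y := extChartAt 𝓘(ℝ, E) x x with hy
  have hcoc (q : ℝ × ℝ) (v v' : E) :
      fderiv ℝ (twistedPullback S L x) (q, y) ((0, 1), 0) ![(0, v), (0, v')] = 0 := by
    obtain ⟨s, t⟩ := q
    -- `κ` is the contraction of `C = e^g D^* Ω` with `∂_t`, restricted to `M`. As `κ` is a twisted
    -- cocycle, closedness of `C` says that the `M`-components of `C` are constant in `t`.
    set β := iprod (generatorAt L (s, t) (0, 1)) S.Ω with hβ
    have hβs : SmoothForm β := by
      rw [hβ, ← hL.generator_row]
      exact S.smooth_Ω.iprod (generator_smooth (hL.row s) t)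
    set κ : Form E M 1 := fun x => Real.exp (gaugeLog S L (s, t) x) • pullback (L (s, t)) β x
      with hκ
    have hκs : SmoothForm κ := smoothForm_exp_pullback (contMDiff_gaugeLog hL (s, t)) hβs
    have hκ0 : twistedD S.lee κ = 0 := by
      rw [hκ, twistedD_exp_pullback (contMDiff_gaugeLog hL (s, t)) (pullback_lee hL h0 (s, t)) hβs,
        hβ, ← hL.generator_row, hker]
      ext x v
      simp [pullback_apply]
    have hrep {y : E} (hy : y ∈ (extChartAt 𝓘(ℝ, E) x).target) (v : E) :
        localRep κ x y (fun _ => v) =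
          twistedPullback S L x ((s, t), y) ![((0, 1), 0), (0, v)] := by
      rw [twistedPullback_eq hL (w := ((s, t), y)) hy]
      simp only [velocityAt_zero, map_zero, zero_add, add_zero]
      rw [velocityAt_eq_generatorAt, ← iprod_apply_one (generatorAt L (s, t) (0, 1))]
      rfl
    have hd : DifferentiableAt ℝ (localRep κ x) y := hκs.differentiableAt hx
    have hC := differentiableAt_twistedPullback (S := S) hL (w := ((s, t), y)) hx
    have hder (v u : E) : fderiv ℝ (localRep κ x) y v (fun _ => u) =
        fderiv ℝ (twistedPullback S L x) ((s, t), y) (0, v) ![((0, 1), 0), (0, u)] := by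
      rw [← fderiv_form_apply hd, ← fderiv_slice hC]
      refine congrArg (fun B : E →L[ℝ] ℝ => B v) (Filter.EventuallyEq.fderiv_eq ?_)
      filter_upwards [target_mem_nhds hx] with z hz using hrep hz u
    have h1 := localRep_twistedD S.lee κ x
    rw [hκ0] at h1
    have h2 := congrArg (fun A : E [⋀^Fin 2]→L[ℝ] ℝ => A ![v, v']) h1
    have h3 : (0 : ℝ) = extDeriv (localRep κ x) y ![v, v'] +
      wedge (localRep S.lee x) (localRep κ x) y ![v, v'] := h2
    rw [extDeriv_one_apply hd, wedge_one_apply, hder, hder, hrep hx, hrep hx] at h3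
    have h4 := twistedPullback_closed (S := S) hL h0 (w := ((s, t), y)) hx ((0, 1), 0) (0, v) (0, v')
    have h5 : localRep S.lee x y (fun _ => (0 : E)) = 0 :=
      (localRep S.lee x y).map_zero
    simp only [h5] at h4
    linarith
  obtain ⟨s, t⟩ := q
  refine eq_of_localRep_eq (α := fun x => Real.exp (gaugeLog S L (s, t) x) • pullback (L (s, t)) S.Ω x) ?_
  ext v
  have hv : v = ![v 0, v 1] := by funext i; fin_cases i <;> rfl
  have hrep (t : ℝ) : localRep (fun x => Real.exp (gaugeLog S L (s, t) x) • pullback (L (s, t)) S.Ω x) x y v =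
      twistedPullback S L x ((s, t), y) ![(0, v 0), (0, v 1)] := by
    rw [twistedPullback_eq hL (w := ((s, t), y)) hx]
    simp only [velocityAt_zero, zero_add]
    change _ * S.Ω _ _ = _
    congr 2
    funext i
    fin_cases i <;> rfl
  have hconst : (fun t : ℝ => twistedPullback S L x ((s, t), y) ![(0, v 0), (0, v 1)]) t =
      (fun t : ℝ => twistedPullback S L x ((s, t), y) ![(0, v 0), (0, v 1)]) 0 := by
    have hder (t : ℝ) : HasDerivAt
        (fun t : ℝ => twistedPullback S L x ((s, t), y) ![(0, v 0), (0, v 1)]) 0 t := by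
      have hC := differentiableAt_twistedPullback (S := S) hL (w := ((s, t), y)) hx
      have h1 := ((ContinuousAlternatingMap.apply ℝ ((ℝ × ℝ) × E) ℝ
        ![(0, v 0), (0, v 1)]).hasFDerivAt.comp ((s, t), y) hC.hasFDerivAt).comp_hasDerivAt t
          ((hasDerivAt_row s t).prodMk (hasDerivAt_const t y))
      exact (hcoc (s, t) (v 0) (v 1)) ▸ h1
    exact is_const_of_deriv_eq_zero (fun t => (hder t).differentiableAt)
      (fun t => (hder t).deriv) t 0
  rw [hrep]
  refine hconst.trans ?_
  change twistedPullback S L x ((s, 0), y) ![(0, v 0), (0, v 1)] = _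
  rw [← hrep]
  change Real.exp (gaugeLog S L (s, 0) _) * pullback (L (s, 0)) S.Ω _ _ = _
  rw [gaugeLog_zero, h0, coe_one, pullback_id, Real.exp_zero, one_mul]
  rfl

end ConformalFactor

/-! ### The flux around a square -/

section Square

variable {E : Type} [NormedAddCommGroup E] [NormedSpace ℝ E] [FiniteDimensional ℝ E]
  {M : Type*} [TopologicalSpace M] [ChartedSpace E M] [IsManifold 𝓘(ℝ, E) ∞ M]
  {S : LCSStructure E M} {K : ℝ × ℝ → Diff E M}

/-- A smooth square of diffeomorphisms all of whose rows `t ↦ K_{s,t}` are paths in `ker Φ`. -/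
structure IsKerPhiSquare (S : LCSStructure E M) (K : ℝ × ℝ → Diff E M) : Prop where
  smooth : SmoothFamily (ℝ × ℝ) K
  row : ∀ s, IsKerPhiIsotopy S (fun t => K (s, t))

theorem IsKerPhiSquare.inv_start (hK : IsKerPhiSquare S K) (s : ℝ) : K⁻¹ (s, 0) = 1 := by
  rw [Pi.inv_apply, (hK.row s).start, inv_one]

/-- The inverse of a square is a square too, so that its members preserve `Ω` up to the conformal
factor `e^{-g}`. -/
theorem IsKerPhiSquare.exp_smul_pullback (hK : IsKerPhiSquare S K) (q : ℝ × ℝ) (x : M) :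
    Real.exp (gaugeLog S K⁻¹ q x) • pullback (K⁻¹ q) S.Ω x = S.Ω x :=
  exp_gaugeLog_smul_pullback hK.smooth.inv hK.inv_start
    (fun s t => ((inKerPhi_iff _ _).1 ((hK.row s).inv.gen t)).2) q x

/-- The components of `C = e^g D^* Ω`, for `D` the inverse of the square `K`, in the directions of
the parameters are the contractions of `Ω` with the generators of `K`. -/
theorem IsKerPhiSquare.localRep_iprod_generatorAt (hK : IsKerPhiSquare S K) (q τ : ℝ × ℝ) {x : M}
    {y : E} (hy : y ∈ (extChartAt 𝓘(ℝ, E) x).target) (v : E) :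
    localRep (iprod (generatorAt K q τ) S.Ω) x y (fun _ => v) =
      -twistedPullback S K⁻¹ x (q, y) ![(τ, 0), (0, v)] := by
  rw [twistedPullback_eq hK.smooth.inv (w := (q, y)) hy]
  simp only [velocityAt_zero, map_zero, zero_add, add_zero]
  set z := (extChartAt 𝓘(ℝ, E) x).symm y
  set u := tmap (extChartAt 𝓘(ℝ, E) x).symm y v
  have h1 : localRep (iprod (generatorAt K q τ) S.Ω) x y (fun _ => v) =
    iprod (generatorAt K q τ) S.Ω z (fun _ => u) := rfl
  have h2 := congrArg (fun A : E [⋀^Fin 2]→L[ℝ] ℝ => A ![generatorAt K q τ z, u])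
    (hK.exp_smul_pullback q z)
  rw [h1, iprod_apply_one, hK.smooth.velocityAt_inv]
  refine h2.symm.trans ?_
  change Real.exp _ * S.Ω (K⁻¹ q z) (fun i => tmap (K⁻¹ q) z (![generatorAt K q τ z, u] i)) = _
  have h3 : (fun i => tmap (K⁻¹ q) z (![generatorAt K q τ z, u] i)) =
      ![tmap (K⁻¹ q) z (generatorAt K q τ z), tmap (K⁻¹ q) z u] := by
    funext i; fin_cases i <;> rfl
  have h4 (a b : E) : S.Ω (K⁻¹ q z) ![-a, b] = -S.Ω (K⁻¹ q z) ![a, b] :=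
    congrArg (fun A : E [⋀^Fin 1]→L[ℝ] ℝ => A ![b]) ((S.Ω (K⁻¹ q z)).curryLeft.map_neg a)
  rw [h3, h4, mul_neg, neg_neg]

theorem IsKerPhiSquare.smoothFormFamily_iprod (hK : IsKerPhiSquare S K) (τ : ℝ × ℝ) :
    SmoothFormFamily (fun q => iprod (generatorAt K q τ) S.Ω) := by
  intro x
  have h1 := ((ContinuousAlternatingMap.compContinuousLinearMapCLM
    (.inr ℝ (ℝ × ℝ) E) : (((ℝ × ℝ) × E) [⋀^Fin 1]→L[ℝ] ℝ) →L[ℝ] E [⋀^Fin 1]→L[ℝ] ℝ)).contDiff.comp_contDiffOn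
    (((ContinuousAlternatingMap.curryLeftLI (𝕜 := ℝ) (E := (ℝ × ℝ) × E) (F := ℝ)
      (n := 1)).contDiff.comp_contDiffOn
        (contDiffOn_twistedPullback (S := S) hK.smooth.inv x)).clm_apply
          (contDiffOn_const (c := ((τ, 0) : (ℝ × ℝ) × E))))
  refine h1.neg.congr fun w hw => ?_
  ext v
  have hv : v = fun _ => v 0 := funext fun i => by rw [Subsingleton.elim i 0]
  rw [hv, hK.localRep_iprod_generatorAt _ _ hw.2]
  change _ = -twistedPullback S K⁻¹ x w (Fin.cons (τ, 0) fun _ => (0, v 0))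
  congr 2
  funext i
  fin_cases i <;> rfl

/-- The function whose twisted differential measures the failure of the two generators of a square
to commute, see `IsKerPhiSquare.fderiv_iprod_sub`. -/
noncomputable def curvatureFn (S : LCSStructure E M) (K : ℝ × ℝ → Diff E M) (q : ℝ × ℝ) (x : M) : ℝ :=
  Real.exp (gaugeLog S K⁻¹ q x) * S.Ω (K⁻¹ q x)
    ![velocityAt K⁻¹ q (1, 0) x, velocityAt K⁻¹ q (0, 1) x]

/-- The function `curvatureFn` is the component of `C = e^g D^* Ω` in the directions of both
parameters. -/
theorem IsKerPhiSquare.curvatureFn_eq (hK : IsKerPhiSquare S K) (q : ℝ × ℝ) {x : M}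
    {y : E} (hy : y ∈ (extChartAt 𝓘(ℝ, E) x).target) :
    curvatureFn S K q ((extChartAt 𝓘(ℝ, E) x).symm y) =
      twistedPullback S K⁻¹ x (q, y) ![((1, 0), 0), ((0, 1), 0)] := by
  rw [twistedPullback_eq hK.smooth.inv (w := (q, y)) hy]
  simp only [map_zero, add_zero]
  rfl

theorem IsKerPhiSquare.smoothFormFamily_curvatureFn (hK : IsKerPhiSquare S K) :
    SmoothFormFamily (fun q => (fn (curvatureFn S K q) : Form E M 0)) := by
  intro x
  have h1 := (ContinuousAlternatingMap.constOfIsEmptyLIE ℝ E ℝ (Fin 0)).contDiff.comp_contDiffOn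
    ((ContinuousAlternatingMap.apply ℝ ((ℝ × ℝ) × E) ℝ
      ![((1, 0), 0), ((0, 1), 0)]).contDiff.comp_contDiffOn
        (contDiffOn_twistedPullback (S := S) hK.smooth.inv x))
  refine h1.congr fun w hw => ?_
  rw [localRep_fn]
  change ContinuousAlternatingMap.constOfIsEmpty ℝ E (Fin 0)
    (curvatureFn S K w.1 ((extChartAt 𝓘(ℝ, E) x).symm w.2)) = _
  rw [hK.curvatureFn_eq _ hw.2]
  rfl

/-- The derivative along the parameters of a component of a form on `Q × E`. -/
theorem fderiv_slice_left {V Q : Type*} [NormedAddCommGroup V] [NormedSpace ℝ V]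
    [NormedAddCommGroup Q] [NormedSpace ℝ Q] {k : ℕ} {C : Form (Q × V) (Q × V) k} {q : Q} {y : V}
    (hC : DifferentiableAt ℝ C (q, y)) (σ : Q) (u : Fin k → Q × V) :
    fderiv ℝ (fun q => C (q, y) u) q σ = fderiv ℝ C (q, y) (σ, 0) u :=
  congrArg (fun B : Q →L[ℝ] ℝ => B σ) (HasFDerivAt.comp (g := fun w => C w u) (f := fun q => (q, y))
    q ((ContinuousAlternatingMap.apply ℝ (Q × V) ℝ u).hasFDerivAt.comp (q, y) hC.hasFDerivAt)
      (hasFDerivAt_prodMk_left q y)).fderiv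

theorem form_one_apply (α : Form E M 1) (x : M) (v : E) :
    α x (fun _ => v) = localRep α x (extChartAt 𝓘(ℝ, E) x x)
      (fun _ => tmap (extChartAt 𝓘(ℝ, E) x) x v) := by
  conv_lhs => rw [← pullback_localRep α x]
  rfl

theorem IsKerPhiSquare.contDiff_iprod (hK : IsKerPhiSquare S K) (τ : ℝ × ℝ) (x : M) (v : E) :
    ContDiff ℝ ∞ (fun q => iprod (generatorAt K q τ) S.Ω x (fun _ => v)) := by
  have hx := mem_extChartAt_target (I := 𝓘(ℝ, E)) x
  have h0 : (fun q => iprod (generatorAt K q τ) S.Ω x (fun _ => v)) = fun q => localRep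
      (iprod (generatorAt K q τ) S.Ω) x (extChartAt 𝓘(ℝ, E) x x)
        (fun _ => tmap (extChartAt 𝓘(ℝ, E) x) x v) :=
    funext fun q => form_one_apply _ x v
  rw [h0]
  have h1 := (hK.smoothFormFamily_iprod τ x).comp
    (f := fun q : ℝ × ℝ => (q, extChartAt 𝓘(ℝ, E) x x))
    (contDiff_id.prodMk contDiff_const).contDiffOn (s := Set.univ) fun _ _ => ⟨trivial, hx⟩
  exact (ContinuousAlternatingMap.apply ℝ E ℝ _).contDiff.comp (contDiffOn_univ.1 h1)

/-- `∂_s (i_X Ω) - ∂_t (i_Y Ω) = d^ω h`, for `X` and `Y` the generators of a square in the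
directions of `t` and `s`. -/
theorem IsKerPhiSquare.fderiv_iprod_sub (hK : IsKerPhiSquare S K) (q : ℝ × ℝ) (x : M) (v : E) :
    fderiv ℝ (fun q => iprod (generatorAt K q (0, 1)) S.Ω x (fun _ => v)) q (1, 0) -
      fderiv ℝ (fun q => iprod (generatorAt K q (1, 0)) S.Ω x (fun _ => v)) q (0, 1) =
    twistedD S.lee (fn (curvatureFn S K q)) x (fun _ => v) := by
  have hx := mem_extChartAt_target (I := 𝓘(ℝ, E)) x
  set y := extChartAt 𝓘(ℝ, E) x x with hy
  set u := tmap (extChartAt 𝓘(ℝ, E) x) x v with hu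
  have h0 (τ : ℝ × ℝ) : (fun q => iprod (generatorAt K q τ) S.Ω x (fun _ => v)) = fun q => localRep
      (iprod (generatorAt K q τ) S.Ω) x y (fun _ => u) := funext fun q => form_one_apply _ x v
  rw [h0, h0, form_one_apply, ← hy, ← hu]
  have hC := differentiableAt_twistedPullback (S := S) hK.smooth.inv (w := (q, y)) hx
  -- The identity is the component of `d C + ω ∧ C = 0` in the directions `∂_s`, `∂_t` and `u`.
  have h1 (τ σ : ℝ × ℝ) : fderiv ℝ (fun q => localRep (iprod (generatorAt K q τ) S.Ω) x y
      (fun _ => u)) q σ =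
      -fderiv ℝ (twistedPullback S K⁻¹ x) (q, y) (σ, 0) ![(τ, 0), (0, u)] := by
    simp only [hK.localRep_iprod_generatorAt _ _ hx]
    rw [fderiv_fun_neg, neg_apply, fderiv_slice_left hC]
  rw [h1, h1, twistedD, localRep_add, Pi.add_apply, ContinuousAlternatingMap.add_apply,
    localRep_d_fn, localRep_wedge, wedge_apply]
  have h3 : fderiv ℝ (curvatureFn S K q ∘ (extChartAt 𝓘(ℝ, E) x).symm) y u =
      fderiv ℝ (twistedPullback S K⁻¹ x) (q, y) (0, u) ![((1, 0), 0), ((0, 1), 0)] := by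
    rw [← fderiv_slice hC]
    refine congrArg (fun B : E →L[ℝ] ℝ => B u) (Filter.EventuallyEq.fderiv_eq ?_)
    filter_upwards [target_mem_nhds hx] with z hz using hK.curvatureFn_eq q hz
  have h4 : localRep (fn (curvatureFn S K q) : Form E M 0) x y =
      ContinuousAlternatingMap.constOfIsEmpty ℝ E (Fin 0)
        (twistedPullback S K⁻¹ x (q, y) ![((1, 0), 0), ((0, 1), 0)]) := by
    rw [← hK.curvatureFn_eq q hx, localRep_fn]; rfl
  have h5 := twistedPullback_closed (S := S) hK.smooth.inv hK.inv_start (w := (q, y)) hx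
    ((1, 0), 0) ((0, 1), 0) (0, u)
  have h6 : localRep S.lee x y (fun _ => (0 : E)) = 0 := (localRep S.lee x y).map_zero
  simp only [h6] at h5
  have h7 (F : Fin (0 + 1) → ℝ) : ∑ i, F i = F 0 := Fin.sum_univ_one F
  rw [h3, h4, h7, ContinuousAlternatingMap.constOfIsEmpty_apply]
  simp only [Fin.val_zero, pow_zero, one_mul]
  linarith

/-- Green's formula on the unit square. -/
theorem integral_unit_square {a b : ℝ × ℝ → ℝ} (ha : ContDiff ℝ ∞ a) (hb : ContDiff ℝ ∞ b) :
    ∫ s in (0 : ℝ)..1, ∫ t in (0 : ℝ)..1, (fderiv ℝ a (s, t) (1, 0) - fderiv ℝ b (s, t) (0, 1)) =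
      (∫ t in (0 : ℝ)..1, a (1, t)) - (∫ t in (0 : ℝ)..1, a (0, t)) -
        (∫ s in (0 : ℝ)..1, b (s, 1)) + ∫ s in (0 : ℝ)..1, b (s, 0) := by
  have hc : Continuous fun q : ℝ × ℝ => fderiv ℝ a q (1, 0) + (-fderiv ℝ b q) (0, 1) :=
    ((ha.continuous_fderiv (by simp)).clm_apply continuous_const).add
      ((hb.continuous_fderiv (by simp)).neg.clm_apply continuous_const)
  have h1 := MeasureTheory.integral2_divergence_prod_of_hasFDerivAt_off_countable a (fun q => -b q)
    (fderiv ℝ a) (fun q => -fderiv ℝ b q) 0 0 1 1 ∅ Set.countable_empty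
    ha.continuous.continuousOn hb.continuous.neg.continuousOn
    (fun q _ => (ha.differentiable (by simp) q).hasFDerivAt)
    (fun q _ => (hb.differentiable (by simp) q).hasFDerivAt.neg)
    (hc.continuousOn.integrableOn_compact (isCompact_uIcc.prod isCompact_uIcc))
  simp only [neg_apply, ← sub_eq_add_neg, intervalIntegral.integral_neg] at h1
  rw [h1]
  ring

/-- The flux form of the path `K_{1,t}` differs from the one of `K_{0,t}` by the integral of the
generators of the path of endpoints `K_{s,1}`, up to a twisted coboundary. -/
theorem IsKerPhiSquare.exists_fluxForm_sub (hK : IsKerPhiSquare S K) :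
    ∃ β : Form E M 0, SmoothForm β ∧ twistedD S.lee β =
      fluxForm S (fun t => K (1, t)) - fluxForm S (fun t => K (0, t)) -
        fluxForm S (fun s => K (s, 1)) := by
  have h1 : SmoothFormFamily (fun s : ℝ => formIntegral
      fun t => (fn (curvatureFn S K (s, t)) : Form E M 0)) :=
    (hK.smoothFormFamily_curvatureFn.comp (f := fun q : ℝ × ℝ => (q.2, q.1))
      (by fun_prop)).formIntegral
  have h2 (s : ℝ) : SmoothFormFamily fun t : ℝ => (fn (curvatureFn S K (s, t)) : Form E M 0) :=
    hK.smoothFormFamily_curvatureFn.comp (f := fun t : ℝ => (s, t)) (by fun_prop)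
  refine ⟨formIntegral fun s => formIntegral fun t => fn (curvatureFn S K (s, t)),
    (h1.comp (f := fun q : ℝ × ℝ => q.1) contDiff_fst).formIntegral.smoothForm 0, ?_⟩
  have h4 := twistedD_formIntegral h1 S.lee
  rw [h4]
  funext x
  ext v
  have hv : v = fun _ => v 0 := funext fun i => congrArg v (Subsingleton.elim (α := Fin 1) i 0)
  rw [hv]
  set u := v 0
  have h5 : formIntegral (fun s => twistedD S.lee (formIntegral
      fun t => (fn (curvatureFn S K (s, t)) : Form E M 0))) x (fun _ => u) =
      ∫ s in (0 : ℝ)..1, ∫ t in (0 : ℝ)..1,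
        twistedD S.lee (fn (curvatureFn S K (s, t))) x (fun _ => u) := by
    rw [formIntegral_apply (h1.continuous_twistedD S.lee x)]
    refine intervalIntegral.integral_congr fun s _ => ?_
    change twistedD S.lee (formIntegral _) x (fun _ => u) = _
    rw [twistedD_formIntegral (h2 s),
      formIntegral_apply ((h2 s).continuous_twistedD S.lee x)]
  have h6 (τ : ℝ × ℝ) {c : ℝ → ℝ × ℝ} (hc : ContDiff ℝ ∞ c)
      (hc' : ∀ t, HasDerivAt c τ t) : fluxForm S (fun t => K (c t)) x (fun _ => u) =
        ∫ t in (0 : ℝ)..1, iprod (generatorAt K (c t) τ) S.Ω x (fun _ => u) := by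
    have h7 : fluxForm S (fun t => K (c t)) =
        formIntegral fun t => iprod (generatorAt K (c t) τ) S.Ω := by
      funext x
      refine intervalIntegral.integral_congr fun t _ => ?_
      simp only
      rw [generatorAt_eq_generator hK.smooth (hc' t)]
    rw [h7, formIntegral_apply (((hK.smoothFormFamily_iprod τ).comp hc).continuous x)]
  -- The fourth side of the square, `s ↦ K_{s,0} = id`, does not contribute.
  have h8 : ∫ s in (0 : ℝ)..1, iprod (generatorAt K (s, 0) (1, 0)) S.Ω x (fun _ => u) = 0 := by
    have h9 (s : ℝ) : iprod (generatorAt K (s, 0) (1, 0)) S.Ω x (fun _ => u) = 0 := by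
      have h10 : (fun s => K (s, 0)) = 1 := funext fun s => (hK.row s).start
      rw [← hK.smooth.generator_column, h10, generator_one, iprod_apply_one]
      exact (S.Ω x).map_coord_zero 0 rfl
    simp only [h9, intervalIntegral.integral_zero]
  have h11 := integral_unit_square (hK.contDiff_iprod (0, 1) x u) (hK.contDiff_iprod (1, 0) x u)
  simp only [hK.fderiv_iprod_sub] at h11
  rw [h5, h11, h8, add_zero, ← h6 (0, 1) (by fun_prop) (hasDerivAt_row 1),
    ← h6 (0, 1) (by fun_prop) (hasDerivAt_row 0),
    ← h6 (1, 0) (c := fun s => (s, 1)) (by fun_prop) (fun s => hasDerivAt_column s 1)]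
  rfl

end Square

/-! ### The lifted flux -/

section Flux

variable {E : Type} [NormedAddCommGroup E] [NormedSpace ℝ E] [FiniteDimensional ℝ E]
  {M : Type*} [TopologicalSpace M] [ChartedSpace E M] [IsManifold 𝓘(ℝ, E) ∞ M]
  {S : LCSStructure E M} {γ δ : ℝ → Diff E M}

/-- The flux form only depends on the restriction of the path to the unit interval. -/
theorem fluxForm_congr (h : ∀ t ∈ Set.Icc (0 : ℝ) 1, γ t = δ t) : fluxForm S γ = fluxForm S δ := by
  funext x
  refine intervalIntegral.integral_congr_Ioo_of_le zero_le_one fun t ht => ?_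
  have h1 : γ =ᶠ[𝓝 t] δ := by
    filter_upwards [isOpen_Ioo.mem_nhds ht] with s hs using h s ⟨hs.1.le, hs.2.le⟩
  have h2 : generator γ t = generator δ t := by
    funext y
    rw [generator, generator, h t ⟨ht.1.le, ht.2.le⟩]
    refine congrArg (fun T : ℝ →L[ℝ] E => T 1) (Filter.EventuallyEq.mfderiv_eq ?_)
    filter_upwards [h1] with s hs
    rw [hs]
  simp only [h2]

theorem fluxForm_one (S : LCSStructure E M) : fluxForm S 1 = 0 := by
  funext x
  have h (t : ℝ) : iprod (generator (1 : ℝ → Diff E M) t) S.Ω x = 0 := by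
    rw [generator_one]
    exact map_zero (S.Ω x).curryLeft
  simp only [fluxForm, h, intervalIntegral.integral_zero]
  rfl

/-- The contractions of `Ω` with the generators of a path depend smoothly on time: the path is the
row of a constant square. -/
theorem IsKerPhiIsotopy.smoothFormFamily (hγ : IsKerPhiIsotopy S γ) :
    SmoothFormFamily fun t => iprod (generator γ t) S.Ω := by
  have hK : IsKerPhiSquare S (fun q : ℝ × ℝ => γ q.2) :=
    ⟨hγ.smooth.comp (f := fun q : ℝ × ℝ => q.2) (by fun_prop), fun _ => hγ⟩
  have h1 := (hK.smoothFormFamily_iprod (0, 1)).comp (f := fun t : ℝ => ((0 : ℝ), t)) (by fun_prop)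
  simp only [← hK.smooth.generator_row] at h1
  exact h1

/-- The flux form is a smooth cocycle because the twisted differential commutes with the integral
over time. -/
theorem IsKerPhiIsotopy.fluxForm_mem_cocycles (hγ : IsKerPhiIsotopy S γ) :
    fluxForm S γ ∈ cocycles E M S.lee 1 := by
  refine ⟨(hγ.smoothFormFamily.comp (f := fun q : ℝ × ℝ => q.1)
    contDiff_fst).formIntegral.smoothForm 0, ?_⟩
  refine (twistedD_formIntegral hγ.smoothFormFamily S.lee).trans ?_
  simp only [((inKerPhi_iff _ _).1 (hγ.gen _)).2]
  funext x
  exact intervalIntegral.integral_zero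

/-- The flux form of a contractible loop is a twisted coboundary: in the square given by the
null-homotopy, all sides other than the loop itself are constant. -/
theorem IsNullHomotopy.exists_fluxForm {H : ℝ × ℝ → Diff E M} (hH : IsNullHomotopy S γ H) :
    ∃ β : Form E M 0, SmoothForm β ∧ twistedD S.lee β = fluxForm S γ := by
  have hK : IsKerPhiSquare S H := ⟨hH.smooth, hH.row⟩
  obtain ⟨β, hβ, h⟩ := hK.exists_fluxForm_sub
  have h0 : (fun t => H (0, t)) = 1 := funext fun t => IsKerPhiIsotopy.start (hH.column t)
  have h1 : (fun s => H (s, 1)) = 1 := funext fun s => hH.fixed s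
  rw [h0, h1, fluxForm_one, sub_zero, sub_zero, fluxForm_congr hH.finish] at h
  exact ⟨β, hβ, h⟩

/-- Slowing a path down by a constant factor. -/
theorem IsKerPhiIsotopy.comp_mul_left (hγ : IsKerPhiIsotopy S γ) (s : ℝ) :
    IsKerPhiIsotopy S (fun t => γ (s * t)) := by
  have hsm : SmoothFamily ℝ (fun t => γ (s * t)) :=
    hγ.smooth.comp (f := fun t : ℝ => s * t) (by fun_prop)
  refine ⟨hsm, by rw [mul_zero, hγ.start], fun t => hγ.lcs _, fun t => (inKerPhi_iff _ _).2
    ⟨generator_smooth hsm t, ?_⟩⟩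
  have h1 : HasDerivAt (fun t : ℝ => s * t) s t := by
    simpa using (hasDerivAt_id t).const_mul s
  have h2 : iprod (generator (fun t => γ (s * t)) t) S.Ω =
      s • iprod (generator γ (s * t)) S.Ω := by
    funext x
    rw [generatorAt_eq_generator hγ.smooth h1]
    have h3 : generatorAt γ (s * t) s x = s • generator γ (s * t) x := by
      let T : ℝ →L[ℝ] E :=
        mfderiv 𝓘(ℝ, ℝ) 𝓘(ℝ, E) (fun q => γ q ((γ (s * t)).symm x)) (s * t)
      have h4 := T.map_smul s (1 : ℝ)
      rw [smul_eq_mul, mul_one] at h4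
      exact h4
    change (S.Ω x).curryLeft (generatorAt γ (s * t) s x) = _
    rw [h3, map_smul]
    rfl
  rw [h2, twistedD_smul, ((inKerPhi_iff _ _).1 (hγ.gen _)).2]
  ext; simp

/-- The flux form of a product is the sum of the flux forms, up to a twisted coboundary. The square
with entries `γ_{st} δ_t` has `δ` and `γ δ` as its rows at `s = 0` and `s = 1`, and the path of
endpoints `γ_s δ_1` has the same generators as `γ`. -/
theorem IsKerPhiIsotopy.exists_fluxForm_mul (hγ : IsKerPhiIsotopy S γ) (hδ : IsKerPhiIsotopy S δ) :
    ∃ β : Form E M 0, SmoothForm β ∧ twistedD S.lee β =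
      fluxForm S (γ * δ) - fluxForm S δ - fluxForm S γ := by
  have hK : IsKerPhiSquare S (fun q : ℝ × ℝ => γ (q.1 * q.2) * δ q.2) :=
    ⟨(hγ.smooth.comp (f := fun q : ℝ × ℝ => q.1 * q.2) (by fun_prop)).mul
      (hδ.smooth.comp (f := fun q : ℝ × ℝ => q.2) (by fun_prop)),
      fun s => (hγ.comp_mul_left s).mul hδ⟩
  obtain ⟨β, hβ, h⟩ := hK.exists_fluxForm_sub
  simp only [one_mul, zero_mul, mul_one, hγ.start] at h
  have h1 : fluxForm S (fun s => γ s * δ 1) = fluxForm S γ := by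
    funext x
    refine intervalIntegral.integral_congr fun t _ => ?_
    have h2 : generator (fun s => γ s * δ 1) t = generator γ t := by
      refine (generator_mul hγ.smooth (.const (δ 1)) t).trans ?_
      rw [generator_const]
      have h3 : pushforward (γ t) (0 : M → E) = 0 := by funext y; exact map_zero _
      rw [h3, add_zero]
    simp only [h2]
  rw [h1] at h
  exact ⟨β, hβ, h⟩

/-- The class of the flux form of a path. -/
noncomputable def fluxClass (S : LCSStructure E M) : isotopyGroup S →* Multiplicative (H1 S) :=
  MonoidHom.mk' (fun γ => Multiplicative.ofAdd (cohomologyClass S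
    ⟨fluxForm S γ, IsKerPhiIsotopy.fluxForm_mem_cocycles γ.2⟩)) fun γ δ => by
    rw [← ofAdd_add]
    refine congrArg Multiplicative.ofAdd ?_
    rw [← map_add, ← sub_eq_zero, ← map_sub, cohomologyClass_eq_zero]
    obtain ⟨β, hβ, h⟩ := IsKerPhiIsotopy.exists_fluxForm_mul γ.2 δ.2
    refine ⟨β, hβ, h.trans ?_⟩
    rw [sub_sub, add_comm (fluxForm S δ)]
    rfl

/-- The lifted flux. -/
noncomputable def liftedFlux (S : LCSStructure E M) : UniversalCover S →* Multiplicative (H1 S) :=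
  QuotientGroup.lift (nullHomotopic S) (fluxClass S) (by
    rintro γ ⟨H, hH⟩
    exact congrArg Multiplicative.ofAdd ((cohomologyClass_eq_zero S _).2 hH.exists_fluxForm))

theorem isFluxHom_liftedFlux (S : LCSStructure E M) : IsFluxHom S (liftedFlux S) := fun γ =>
  ⟨IsKerPhiIsotopy.fluxForm_mem_cocycles γ.2, rfl⟩

end Flux

/-! ### Surjectivity of the flux -/

section Surjectivity

variable {E : Type} [NormedAddCommGroup E] [NormedSpace ℝ E]

/-- The map `v ↦ i_v A` from vectors to covectors given by a 2-form on a vector space. -/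
noncomputable def contraction (A : E [⋀^Fin 2]→L[ℝ] ℝ) : E →L[ℝ] E →L[ℝ] ℝ :=
  ((ContinuousAlternatingMap.ofSubsingletonLIE (𝕜 := ℝ) (E := E) (F := ℝ)
    (0 : Fin 1)).symm.toContinuousLinearEquiv : (E [⋀^Fin 1]→L[ℝ] ℝ) →L[ℝ] E →L[ℝ] ℝ) ∘L A.curryLeft

theorem contraction_apply (A : E [⋀^Fin 2]→L[ℝ] ℝ) (v w : E) :
    contraction A v w = A ![v, w] := by
  change A (Fin.cons v fun _ => w) = _
  congr 1
  funext i
  fin_cases i <;> rfl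

theorem contDiff_contraction :
    ContDiff ℝ ∞ (contraction : E [⋀^Fin 2]→L[ℝ] ℝ → E →L[ℝ] E →L[ℝ] ℝ) := by
  have h : ContDiff ℝ ∞ (ContinuousAlternatingMap.curryLeftLI (𝕜 := ℝ) (E := E) (F := ℝ)
    (n := 1)) := LinearIsometry.contDiff _
  exact contDiff_const.clm_comp h

variable [FiniteDimensional ℝ E]

/-- In finite dimension, a nondegenerate 2-form identifies vectors with covectors. -/
theorem exists_equiv_eq_contraction {A : E [⋀^Fin 2]→L[ℝ] ℝ}
    (hA : ∀ v, (∀ w, A ![v, w] = 0) → v = 0) :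
    ∃ e : E ≃L[ℝ] E →L[ℝ] ℝ, (e : E →L[ℝ] E →L[ℝ] ℝ) = contraction A := by
  have hinj : Function.Injective (contraction A : E →ₗ[ℝ] E →L[ℝ] ℝ) := by
    rw [← LinearMap.ker_eq_bot, LinearMap.ker_eq_bot']
    intro v hv
    refine hA v fun w => ?_
    rw [← contraction_apply]
    exact congrArg (fun T : E →L[ℝ] ℝ => T w) hv
  have hdim : Module.finrank ℝ E = Module.finrank ℝ (E →L[ℝ] ℝ) := by
    rw [← (LinearMap.toContinuousLinearMap (𝕜 := ℝ) (E := E) (F' := ℝ)).finrank_eq]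
    exact (Subspace.dual_finrank_eq (K := ℝ) (V := E)).symm
  refine ⟨(LinearEquiv.ofInjectiveOfFinrankEq _ hinj hdim).toContinuousLinearEquiv, ?_⟩
  ext v : 1
  rfl

variable {M : Type*} [TopologicalSpace M] [ChartedSpace E M] [IsManifold 𝓘(ℝ, E) ∞ M]

/-- A vector field is smooth if its expressions in the preferred charts are. -/
theorem smoothVF_of_coord {X : M → E}
    (hX : ∀ x : M, ContDiffOn ℝ ∞ (fun y => tmap (extChartAt 𝓘(ℝ, E) x)
      ((extChartAt 𝓘(ℝ, E) x).symm y) (X ((extChartAt 𝓘(ℝ, E) x).symm y)))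
        (extChartAt 𝓘(ℝ, E) x).target) : SmoothVF X := by
  intro x
  set e := trivializationAt E (TangentSpace 𝓘(ℝ, E)) x with he
  have hx : x ∈ e.baseSet := FiberBundle.mem_baseSet_trivializationAt' x
  refine (e.contMDiffAt_section_iff (IB := 𝓘(ℝ, E)) (n := ∞)
    (E := fun x : M => TangentSpace 𝓘(ℝ, E) x)
    (s := fun x => (X x : TangentSpace 𝓘(ℝ, E) x)) hx).2 ?_
  have h1 := ((hX x).contDiffAt (target_mem_nhds (mem_extChartAt_target x))).contMDiffAt.comp x
    (contMDiffAt_ext (mem_extChartAt_source (I := 𝓘(ℝ, E)) x))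
  refine h1.congr_of_eventuallyEq ?_
  filter_upwards [(isOpen_extChartAt_source (I := 𝓘(ℝ, E)) x).mem_nhds
    (mem_extChartAt_source x)] with z hz
  have hz' : z ∈ e.baseSet := by simpa [he] using hz
  have h3 : z ∈ (chartAt E x).source := by simpa using hz
  have h4 := TangentBundle.continuousLinearMapAt_trivializationAt (I := 𝓘(ℝ, E)) h3
  have h5 := congrArg (fun L : E →L[ℝ] E => L (X z)) h4
  simp only [Function.comp_apply, (extChartAt 𝓘(ℝ, E) x).left_inv hz]
  refine Eq.trans ?_ h5
  exact (congrFun (e.coe_linearMapAt_of_mem (R := ℝ) hz') (X z)).symm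

theorem localRep_Ω_nondegenerate (S : LCSStructure E M) {x : M} {y : E}
    (hy : y ∈ (extChartAt 𝓘(ℝ, E) x).target) (v : E)
    (hv : ∀ w, localRep S.Ω x y ![v, w] = 0) : v = 0 := by
  set ψ := (extChartAt 𝓘(ℝ, E) x).symm
  have h1 : tmap ψ y v = 0 := by
    refine S.nondegenerate (ψ y) _ fun w => ?_
    rw [← tmap_symm_tmap hy w]
    refine Eq.trans ?_ (hv (tmap (extChartAt 𝓘(ℝ, E) x) (ψ y) w))
    change _ = S.Ω (ψ y) _
    congr 1
    funext i
    fin_cases i <;> rfl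
  rw [← tmap_tmap_symm hy v]
  exact (congrArg _ h1).trans (map_zero _)

/-- The Hamiltonian correspondence: a smooth 1-form is the contraction of `Ω` with a smooth vector
field. -/
theorem exists_smoothVF_iprod_eq (S : LCSStructure E M) {η : Form E M 1} (hη : SmoothForm η) :
    ∃ X : M → E, SmoothVF X ∧ iprod X S.Ω = η := by
  set D := (ContinuousAlternatingMap.ofSubsingletonLIE (𝕜 := ℝ) (E := E) (F := ℝ)
    (0 : Fin 1)).symm
  set X : M → E := fun x => (contraction (S.Ω x)).inverse (D (η x)) with hX
  have hΩ (x : M) (w : E) : S.Ω x ![X x, w] = η x (fun _ => w) := by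
    obtain ⟨e, he⟩ := exists_equiv_eq_contraction (S.nondegenerate x)
    rw [← contraction_apply, hX]
    simp only
    rw [← he, ContinuousLinearMap.inverse_equiv]
    exact congrArg (fun T : E →L[ℝ] ℝ => T w) (e.apply_symm_apply (D (η x)))
  refine ⟨X, smoothVF_of_coord fun x => ?_, ?_⟩
  · set ψ := (extChartAt 𝓘(ℝ, E) x).symm with hψ
    set Y : E → E := fun y => (contraction (localRep S.Ω x y)).inverse (D (localRep η x y))
    have hY : ContDiffOn ℝ ∞ Y (extChartAt 𝓘(ℝ, E) x).target := by
      intro y hy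
      obtain ⟨e, he⟩ := exists_equiv_eq_contraction (localRep_Ω_nondegenerate S hy)
      have h1 : ContDiffAt ℝ ∞ ContinuousLinearMap.inverse (contraction (localRep S.Ω x y)) := by
        rw [← he]; exact contDiffAt_map_inverse e
      have h2 : ContDiffAt ℝ ∞ (fun y => contraction (localRep S.Ω x y)) y :=
        contDiff_contraction.contDiffAt.comp y (S.smooth_Ω.contDiffAt hy)
      exact ((h1.comp y h2).clm_apply
        (D.contDiff.contDiffAt.comp y (hη.contDiffAt hy))).contDiffWithinAt
    refine hY.congr fun y hy => ?_
    obtain ⟨e, he⟩ := exists_equiv_eq_contraction (localRep_Ω_nondegenerate S hy)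
    change _ = (contraction (localRep S.Ω x y)).inverse (D (localRep η x y))
    rw [← he, ContinuousLinearMap.inverse_equiv]
    refine (e.eq_symm_apply).2 ?_
    ext w
    have h3 (u : E) : e u w = localRep S.Ω x y ![u, w] := by
      rw [← contraction_apply, ← he]; rfl
    rw [h3]
    refine Eq.trans ?_ (hΩ (ψ y) (tmap ψ y w))
    change S.Ω (ψ y) _ = _
    congr 1
    funext i
    fin_cases i
    · exact tmap_symm_tmap hy _
    · rfl
  · ext x v
    have hv : v = fun _ => v 0 := funext fun i => by rw [Subsingleton.elim i 0]
    rw [hv, iprod_apply_one, hΩ]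

variable [T2Space M] [CompactSpace M]

/-- The flow of a vector field `X` with `d^ω (i_X Ω) = 0` is a path in `ker Φ`. -/
theorem isKerPhiIsotopy_flowDiff {S : LCSStructure E M} {X : M → E} (hX : SmoothVF X)
    (hd : twistedD S.lee (iprod X S.Ω) = 0) : IsKerPhiIsotopy S (flowDiff hX) := by
  have hs : SmoothFamily (ℝ × ℝ) (fun q : ℝ × ℝ => flowDiff hX q.2) :=
    (smoothFamily_flowDiff hX).comp (f := fun q : ℝ × ℝ => q.2) (by fun_prop)
  refine ⟨smoothFamily_flowDiff hX, flowDiff_zero hX, fun t => ?_, fun t => ?_⟩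
  · set L : ℝ × ℝ → Diff E M := fun q => flowDiff hX q.2 with hL
    have h0 (s : ℝ) : L (s, 0) = 1 := flowDiff_zero hX
    have hg := contMDiff_gaugeLog (S := S) hs (0, t)
    refine ⟨fun x => Real.exp (gaugeLog S L (0, t) x), fun x =>
      Real.contDiff_exp.contDiffAt.contMDiffAt.comp x (hg x), fun x => Real.exp_pos _, ?_, ?_⟩
    · funext x
      have h1 := exp_gaugeLog_smul_pullback (S := S) hs h0
        (fun s t => by rw [generator_flowDiff hX t, hd]) (0, t) x
      rw [← h1, smul_smul, inv_mul_cancel₀ (Real.exp_pos _).ne', one_smul]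
    · simp only [Real.log_exp]
      exact pullback_lee hs h0 (0, t)
  · rw [generator_flowDiff]
    exact (inKerPhi_iff _ _).2 ⟨hX, hd⟩

theorem fluxForm_flowDiff {S : LCSStructure E M} {X : M → E} (hX : SmoothVF X) :
    fluxForm S (flowDiff hX) = iprod X S.Ω := by
  funext x
  simp only [fluxForm, generator_flowDiff, intervalIntegral.integral_const, sub_zero, one_smul]

/-- Every class is a flux: the flow of the vector field dual to a cocycle `η` has flux form `η`. -/
theorem liftedFlux_surjective (S : LCSStructure E M) : Function.Surjective (liftedFlux S) := by
  intro c
  obtain ⟨⟨η, hη, hd⟩, h⟩ := cohomologyClass_surjective S (Multiplicative.toAdd c)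
  obtain ⟨X, hX, rfl⟩ := exists_smoothVF_iprod_eq S hη
  refine ⟨isotopyClass S ⟨flowDiff hX, isKerPhiIsotopy_flowDiff hX hd⟩, ?_⟩
  obtain ⟨h1, h2⟩ := isFluxHom_liftedFlux S ⟨flowDiff hX, isKerPhiIsotopy_flowDiff hX hd⟩
  rw [h2]
  refine (congrArg Multiplicative.ofAdd (Eq.trans ?_ h) : _ = Multiplicative.ofAdd _)
  exact congrArg _ (Subtype.ext (fluxForm_flowDiff hX))

theorem coverProj_surjective (S : LCSStructure E M) : Function.Surjective (coverProj S) := by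
  rintro ⟨_, γ, hγ, rfl⟩
  exact ⟨isotopyClass S ⟨γ, hγ⟩, rfl⟩

end Surjectivity
end LCS

/-! ### The exact sequence -/

theorem proposition3p4 (n : ℕ) {M : Type*} [TopologicalSpace M]
    [ChartedSpace (EuclideanSpace ℝ (Fin (2 * n))) M]
    [IsManifold 𝓘(ℝ, EuclideanSpace ℝ (Fin (2 * n))) ∞ M] [T2Space M] [CompactSpace M]
    (S : LCS.LCSStructure (EuclideanSpace ℝ (Fin (2 * n))) M) :
    ∃ Ψ : LCS.UniversalCover S →* Multiplicative (LCS.H1 S), LCS.IsFluxHom S Ψ ∧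
      (LCS.IsDiscretePeriodGroup Ψ →
        ∃ F : LCS.kerPhiGroup S →* Multiplicative (LCS.H1 S ⧸ LCS.periodGroup Ψ),
          (∀ u : LCS.UniversalCover S, F (LCS.coverProj S u) =
            Multiplicative.ofAdd (QuotientAddGroup.mk (Multiplicative.toAdd (Ψ u)))) ∧
          Function.Injective (LCS.hamiltonianGroup Ψ).subtype ∧
          (LCS.hamiltonianGroup Ψ).subtype.range = F.ker ∧
          Function.Surjective F) := by
  refine ⟨LCS.liftedFlux S, LCS.isFluxHom_liftedFlux S, fun _ => ?_⟩
  set Ψ := LCS.liftedFlux S with hΨ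
  let G : LCS.UniversalCover S →* Multiplicative (LCS.H1 S ⧸ LCS.periodGroup Ψ) :=
    (AddMonoidHom.toMultiplicative (QuotientAddGroup.mk' (LCS.periodGroup Ψ))).comp Ψ
  -- The kernel of `G` consists of the classes whose flux is the flux of a loop.
  have hG (u : LCS.UniversalCover S) : G u = 1 ↔ ∃ w ∈ (LCS.coverProj S).ker, Ψ w = Ψ u :=
    QuotientAddGroup.eq_zero_iff (Multiplicative.toAdd (Ψ u))
  have hker : (LCS.coverProj S).ker ≤ G.ker := fun u hu => (hG u).2 ⟨u, hu, rfl⟩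
  let F := (LCS.coverProj S).liftOfSurjective (LCS.coverProj_surjective S) ⟨G, hker⟩
  have hF (u : LCS.UniversalCover S) : F (LCS.coverProj S u) = G u :=
    (LCS.coverProj S).liftOfRightInverse_comp_apply _ _ ⟨G, hker⟩ u
  refine ⟨F, hF, Subtype.val_injective, ?_, ?_⟩
  · rw [Subgroup.range_subtype]
    ext g
    obtain ⟨u, rfl⟩ := LCS.coverProj_surjective S g
    rw [MonoidHom.mem_ker, hF, hG]
    constructor
    · rintro ⟨w, hw, hwu⟩
      refine ⟨w⁻¹ * u, ?_, ?_⟩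
      · rw [MonoidHom.mem_ker, map_mul, map_inv, hwu, inv_mul_cancel]
      · rw [map_mul, map_inv, MonoidHom.mem_ker.1 hw, inv_one, one_mul]
    · rintro ⟨w, hw, hwu⟩
      refine ⟨u * w⁻¹, ?_, ?_⟩
      · change Ψ (u * w⁻¹) = 1
        rw [map_mul, map_inv, hwu, mul_inv_cancel]
      · rw [map_mul, map_inv, MonoidHom.mem_ker.1 hw, inv_one, mul_one]
  · intro c
    obtain ⟨a, ha⟩ := QuotientAddGroup.mk_surjective (Multiplicative.toAdd c)
    obtain ⟨u, hu⟩ := LCS.liftedFlux_surjective S (Multiplicative.ofAdd a)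
    refine ⟨LCS.coverProj S u, (hF u).trans ?_⟩
    change Multiplicative.ofAdd (QuotientAddGroup.mk (Multiplicative.toAdd (Ψ u))) = c
    have hu' : Ψ u = Multiplicative.ofAdd a := hu
    rw [hu', toAdd_ofAdd, ha, ofAdd_toAdd]
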